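/- Let $\overline{\mathbb Q}$ be the field of algebraic numbers and $\mathbf K=\bigcup_{d\ge 1}\overline{\mathbb Q}((z^{1/d}))$ the field of Puiseux series. For an integer $n\ge 1$ let $\phi_n(f(z))=f(z^n)$, applied entrywise to matrices. Let $p\ge 2$ and $m\ge 1$ be integers and $A\in\mathrm{GL}_m(\overline{\mathbb Q}(z))$. The Mahler system $\phi_p(Y)=AY$ is called regular singular at $0$ if there is $\Psi\in\mathrm{GL}_m(\mathbf K)$ such that $\phi_p(\Psi)^{-1}A\Psi$ is a constant matrix; for a field $k\subset\mathbf K$ it is called $k$-equivalent to a constant system if there are $\Psi\in\mathrm{GL}_m(k)$ and $\Lambda\in\mathrm{GL}_m(\overline{\mathbb Q})$ with $\phi_p(\Psi)\Lambda=A\Psi$. Let $v_0$ of a matrix be the minimum of the valuations at $z=0$ of its entries. For $d\ge 1$ let $\phi_d(A)^{-1}=\sum_n B_n(d)z^n$ be the Laurent expansion at $0$, and put $$\mu_d=\left\lceil\frac{-d\,v_0(A^{-1})}{p-1}\right\rceil,\qquad \nu_d=\left\lceil\frac{d\,v_0(A)}{p-1}\right\rceil ,$$ so that $\nu_d\le\mu_d$.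 Let $M_d=(B_{i-pj}(d))_{\nu_d\le i,j\le\mu_d}$ and, if $\nu_d<\mu_d$, let $N_d=(B_{i-pj}(d))_{i,j}$ with $d\,v_0(A^{-1})+p\nu_d\le i\le\nu_d-1$ and $\nu_d\le j\le\mu_d$ (block matrices with $m\times m$ blocks); if $\nu_d=\mu_d$, let $N_d=0$, so that $\ker(N_d)=\overline{\mathbb Q}^{\,m(\mu_d-\nu_d+1)}$. For $n\ge 0$, $M_d^{n}\cdot\ker(N_d)$ is the image of $\ker(N_d)$ under $M_d^n$, and $M_d^{-n}\cdot\ker(N_d)=\ker(N_dM_d^n)$. Let $$\mathfrak X_d=\bigcap_{n\in\mathbb Z}M_d^n\cdot\ker(N_d),\qquad \mathcal D=\{d\in\mathbb N: 1\le d\le p^m-1,\ \gcd(d,p)=1\}.$$ **Theorem.** The system $\phi_p(Y)=AY$ is regular singular at $0$ if and only if there is $d\in\mathcal D$ such that $\dim_{\overline{\mathbb Q}}\mathfrak X_d\ge m$. For every such $d$, one has $\dim_{\overline{\mathbb Q}}\mathfrak X_d=m$ and the system is $\overline{\mathbb Q}((z^{1/d}))$-equivalent to a constant system. Furthermore, such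 an integer $d$ can be computed: there is one algorithm (a computable function) which, given $p\ge2$, $m\ge1$ and $A\in\mathrm{GL}_m(\overline{\mathbb Q}(z))$, returns an integer $d\in\mathcal D$ such that $\dim_{\overline{\mathbb Q}}\mathfrak X_d\ge m$ whenever the system is regular singular at $0$. Here $A$ is given exactly, over a number field $\mathbb Q(\alpha)$: the input consists of the coefficients of an irreducible $f\in\mathbb Z[x]$ with $f(\alpha)=0$ and, for each entry of $A$, of a numerator and a nonzero denominator, which are polynomials in $z$ whose coefficients are given as integer polynomials in $\alpha$. -/

import Mathlib

namespace MahlerSystem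

open Polynomial

noncomputable section

/-- The field of algebraic numbers, inside the complex numbers. -/
abbrev Qbar : Type := algebraicClosure ℚ ℂ

instance : Algebra.IsAlgebraic ℚ Qbar := algebraicClosure.isAlgebraic ℚ ℂ

instance : IsAlgClosed Qbar := (algebraicClosure.isAlgClosure ℚ ℂ).1

section Series

variable {Γ : Type*} [AddCommGroup Γ] [LinearOrder Γ] [IsOrderedAddMonoid Γ]
variable (F : Type*) [Field F]

/-- The substitution `f(z) ↦ f(z ^ n)` on Hahn series with exponents in `Γ`: it moves the
coefficient of `z ^ γ` to `z ^ (n γ)`. It is used for `n ≥ 1` only (and is the identity for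
`n = 0`, where the substitution makes no sense). With `Γ = ℤ` this is the substitution on Laurent
series, with `Γ = ℚ` on Hahn series with rational exponents, in particular on Puiseux series. -/
def phi (n : ℕ) : HahnSeries Γ F →+* HahnSeries Γ F :=
  if hn : n ≠ 0 then
    HahnSeries.embDomainRingHom (nsmulAddMonoidHom n : Γ →+ Γ)
      (fun _ _ h => (nsmul_right_injective hn) h)
      (fun _ _ => (nsmul_le_nsmul_iff_right hn))
  else RingHom.id _

theorem phi_coeff_nsmul {n : ℕ} (hn : n ≠ 0) (f : HahnSeries Γ F) (γ : Γ) :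
    (phi F n f).coeff (n • γ) = f.coeff γ := by
  unfold phi
  rw [dif_pos hn]
  exact HahnSeries.embDomain_coeff
    (f := ⟨⟨(nsmulAddMonoidHom n : Γ →+ Γ), _⟩, _⟩) (x := f) (a := γ)

/-- Laurent series in `z`, seen as Hahn series with rational exponents. -/
def laurentToHahn : LaurentSeries F →+* HahnSeries ℚ F :=
  HahnSeries.embDomainRingHom (Int.castAddHom ℚ) Int.cast_injective (fun _ _ => Int.cast_le)

open scoped RatFunc in
/-- The Laurent expansion at `z = 0` of a rational function. -/
def laurent : RatFunc F →+* LaurentSeries F := algebraMap (RatFunc F) (LaurentSeries F)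

/-- The expansion at `0` of a rational function, inside the Hahn series. -/
def ratToHahn : RatFunc F →+* HahnSeries ℚ F := (laurentToHahn F).comp (laurent F)

/-- The field `F((z ^ (1/d)))` for `d ≥ 1`, inside the Hahn series with rational exponents:
`f(z)` belongs to it iff `f(z ^ d)` is a Laurent series in `z`. -/
def rootField (d : ℕ) : Subfield (HahnSeries ℚ F) :=
  (laurentToHahn F).fieldRange.comap (phi F d)

theorem mem_rootField_iff {d : ℕ} (hd : d ≠ 0) (f : HahnSeries ℚ F) :
    f ∈ rootField F d ↔ ∀ q ∈ f.support, ∃ k : ℤ, q = k / d := by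
  have hd' : (d : ℚ) ≠ 0 := by exact_mod_cast hd
  have key : ∀ q : ℚ, (phi F d f).coeff (d * q) = f.coeff q := fun q => by
    simpa using phi_coeff_nsmul F hd f q
  change (∃ g, laurentToHahn F g = phi F d f) ↔ _
  constructor
  · rintro ⟨g, hg⟩ q hq
    by_contra! hk
    refine hq ?_
    rw [← key q, ← hg]
    refine HahnSeries.embDomain_of_notMem_range ?_
    rintro ⟨k, h⟩
    exact hk k (by rw [eq_div_iff hd', mul_comm]; exact h.symm)
  · intro h
    have hmono : StrictMono (fun k : ℤ => (k : ℚ)) := fun _ _ h => Int.cast_lt.2 h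
    refine ⟨⟨fun k => (phi F d f).coeff (k : ℚ), ?_⟩, ?_⟩
    · refine Set.IsWF.isPWO ?_
      have h0 := (phi F d f).isWF_support
      rw [Set.isWF_iff_no_descending_seq] at h0 ⊢
      intro u hu hmem
      exact h0 (fun n => (u n : ℚ)) (fun a b hab => Int.cast_lt.2 (hu hab)) hmem
    · ext q
      by_cases hq : ∃ k : ℤ, (k : ℚ) = q
      · obtain ⟨k, rfl⟩ := hq
        exact HahnSeries.embDomain_coeff (f := ⟨⟨Int.castAddHom ℚ, _⟩, _⟩) (a := k)
      · have h1 : (phi F d f).coeff q = 0 := by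
          have e : q = d * (q / d) := by field_simp
          rw [e, key]
          by_contra hne
          obtain ⟨k, hk⟩ := h _ hne
          exact hq ⟨k, by field_simp at hk; exact hk.symm⟩
        rw [h1]
        refine HahnSeries.embDomain_of_notMem_range ?_
        rintro ⟨k, h⟩
        exact hq ⟨k, h⟩

/-- The field of Puiseux series: the union (see `mem_puiseuxField_iff`) of the fields
`F((z ^ (1/d)))`, `d ≥ 1`. -/
def puiseuxField : Subfield (HahnSeries ℚ F) := ⨆ d : ℕ+, rootField F d

theorem rootField_mono {d e : ℕ} (he : e ≠ 0) (h : d ∣ e) : rootField F d ≤ rootField F e := by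
  intro f hf
  have hd : d ≠ 0 := by rintro rfl; exact he (zero_dvd_iff.1 h)
  rw [mem_rootField_iff F he]
  rw [mem_rootField_iff F hd] at hf
  intro q hq
  obtain ⟨k, rfl⟩ := hf q hq
  obtain ⟨c, rfl⟩ := h
  have hd' : (d : ℚ) ≠ 0 := by exact_mod_cast hd
  have hc' : (c : ℚ) ≠ 0 := by
    have : c ≠ 0 := by rintro rfl; simp at he
    exact_mod_cast this
  exact ⟨k * c, by push_cast; field_simp⟩

theorem mem_puiseuxField_iff (f : HahnSeries ℚ F) :
    f ∈ puiseuxField F ↔ ∃ d : ℕ, 1 ≤ d ∧ f ∈ rootField F d := by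
  unfold puiseuxField
  rw [Subfield.mem_iSup_of_directed]
  · exact ⟨fun ⟨d, h⟩ => ⟨d, d.pos, h⟩, fun ⟨d, h, hf⟩ => ⟨⟨d, h⟩, hf⟩⟩
  · intro a b
    exact ⟨a * b, rootField_mono F (by positivity) (by simp),
      rootField_mono F (by positivity) (by simp)⟩

end Series

section Systems

variable {F : Type*} [Field F] {m : ℕ}

/-- The systems `φ_p(Y) = A Y` and `φ_p(Y) = B Y` are `k`-equivalent: there is `Ψ ∈ GL_m(k)` with
`φ_p(Ψ) B = A Ψ`. -/
def IsEquivalent (k : Subfield (HahnSeries ℚ F)) (p : ℕ) (A B : GL (Fin m) (RatFunc F)) : Prop :=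
  ∃ Ψ : GL (Fin m) k,
    (Ψ.1.map fun x => phi F p (x : HahnSeries ℚ F)) * B.1.map (ratToHahn F) =
      A.1.map (ratToHahn F) * Ψ.1.map fun x => (x : HahnSeries ℚ F)

/-- A constant matrix, seen as a matrix of rational functions. -/
def constSystem (Λ : GL (Fin m) F) : GL (Fin m) (RatFunc F) :=
  Matrix.GeneralLinearGroup.map RatFunc.C Λ

/-- The system `φ_p(Y) = A Y` is `k`-equivalent to a constant system. -/
def IsEquivalentToConst (k : Subfield (HahnSeries ℚ F)) (p : ℕ) (A : GL (Fin m) (RatFunc F)) :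
    Prop :=
  ∃ Λ : GL (Fin m) F, IsEquivalent k p A (constSystem Λ)

/-- The system `φ_p(Y) = A Y` is regular singular at `0`: for some `Ψ ∈ GL_m` with Puiseux series
entries, the matrix `φ_p(Ψ)⁻¹ A Ψ` is constant. -/
def IsRegularSingular (p : ℕ) (A : GL (Fin m) (RatFunc F)) : Prop :=
  ∃ (Ψ : GL (Fin m) (puiseuxField F)) (Λ : Matrix (Fin m) (Fin m) F),
    (Ψ.1.map fun x => phi F p (x : HahnSeries ℚ F))⁻¹ * A.1.map (ratToHahn F) *
      (Ψ.1.map fun x => (x : HahnSeries ℚ F)) = Λ.map HahnSeries.C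

/-- The valuation at `0` of a (nonzero) matrix of Laurent series: the minimum of the valuations of
its entries. -/
def v0 (U : Matrix (Fin m) (Fin m) (LaurentSeries F)) : ℤ :=
  (Finset.univ.inf fun ij : Fin m × Fin m => (U ij.1 ij.2).orderTop).untopD 0

/-- The valuation `v₀(A)`. -/
def val (A : GL (Fin m) (RatFunc F)) : ℤ := v0 (A.1.map (laurent F))

/-- The coefficient `B_n(d)` of `z ^ n` in the Laurent expansion of `B(d) = φ_d(A)⁻¹`. -/
def coeffB (A : GL (Fin m) (RatFunc F)) (d : ℕ) (n : ℤ) : Matrix (Fin m) (Fin m) F :=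
  ((A.1.map fun x => phi F d (laurent F x))⁻¹).map fun f => f.coeff n

/-- `μ_d = ⌈- d v₀(A⁻¹) / (p - 1)⌉`. -/
def mu (p : ℕ) (A : GL (Fin m) (RatFunc F)) (d : ℕ) : ℤ :=
  ⌈(-(d * val A⁻¹) : ℚ) / ((p : ℚ) - 1)⌉

/-- `ν_d = ⌈d v₀(A) / (p - 1)⌉`. -/
def nu (p : ℕ) (A : GL (Fin m) (RatFunc F)) (d : ℕ) : ℤ :=
  ⌈(d * val A : ℚ) / ((p : ℚ) - 1)⌉

/-- The index set of the rows and columns of `M_d`: `μ_d - ν_d + 1` blocks of size `m`. -/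
abbrev Idx (p : ℕ) (A : GL (Fin m) (RatFunc F)) (d : ℕ) : Type :=
  ↥(Finset.Icc (nu p A d) (mu p A d)) × Fin m

/-- The index set of the rows of `N_d`: the blocks `d v₀(A⁻¹) + p ν_d ≤ i ≤ ν_d - 1`. -/
abbrev RowIdx (p : ℕ) (A : GL (Fin m) (RatFunc F)) (d : ℕ) : Type :=
  ↥(Finset.Icc (d * val A⁻¹ + p * nu p A d) (nu p A d - 1)) × Fin m

/-- The block matrix `M_d = (B_{i - p j}(d))`, `ν_d ≤ i, j ≤ μ_d`. -/
def matM (p : ℕ) (A : GL (Fin m) (RatFunc F)) (d : ℕ) : Matrix (Idx p A d) (Idx p A d) F :=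
  fun r c => coeffB A d ((r.1 : ℤ) - p * (c.1 : ℤ)) r.2 c.2

/-- The block matrix `N_d = (B_{i - p j}(d))`, `d v₀(A⁻¹) + p ν_d ≤ i ≤ ν_d - 1`,
`ν_d ≤ j ≤ μ_d`. If `ν_d = μ_d`, it is a zero matrix (there are then no rows, and the kernel is the
whole space, as for a zero row). -/
def matN (p : ℕ) (A : GL (Fin m) (RatFunc F)) (d : ℕ) : Matrix (RowIdx p A d) (Idx p A d) F :=
  fun r c => if nu p A d < mu p A d then coeffB A d ((r.1 : ℤ) - p * (c.1 : ℤ)) r.2 c.2 else 0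

/-- `M ^ n · ker N` for `n ∈ ℤ`: the image of `ker N` under `M ^ n` if `n ≥ 0`, and
`ker (N M ^ (-n))` if `n < 0`. -/
def powKer {ι κ : Type*} [Fintype ι] [DecidableEq ι] [Fintype κ]
    (M : Matrix ι ι F) (N : Matrix κ ι F) (n : ℤ) : Submodule F (ι → F) :=
  if 0 ≤ n then (LinearMap.ker N.mulVecLin).map (M ^ n.toNat).mulVecLin
  else LinearMap.ker (N * M ^ (-n).toNat).mulVecLin

/-- The space `𝔛_d = ⋂_{n ∈ ℤ} M_d ^ n · ker N_d`. -/
def spaceX (p : ℕ) (A : GL (Fin m) (RatFunc F)) (d : ℕ) : Submodule F (Idx p A d → F) :=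
  ⨅ n : ℤ, powKer (matM p A d) (matN p A d) n

end Systems

/-- The set of the integers `1 ≤ d ≤ p ^ m - 1` that are coprime to `p`. -/
def setD (p m : ℕ) : Set ℕ := {d | 1 ≤ d ∧ d ≤ p ^ m - 1 ∧ Nat.gcd d p = 1}

section Codes

/-- `∑ aᵢ xⁱ` for a list `a₀, a₁, …`. -/
def evalList {R : Type*} [CommRing R] (x : R) (l : List R) : R :=
  l.foldr (fun a s => a + x * s) 0

/-- A finite code for a square matrix of rational functions over a number field `ℚ(α)`: the integer
coefficients of the irreducible polynomial of `α`, and for each entry (row by row) a numerator and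
a denominator. These are polynomials in `z` whose coefficients are integer polynomials in `α`, all
polynomials being given by their lists of coefficients, from the constant term on. -/
abbrev Code : Type := List ℤ × List (List (List (List ℤ) × List (List ℤ)))

/-- The integer polynomial with the given list of coefficients. -/
def intPoly (l : List ℤ) : ℤ[X] := evalList X (l.map C)

/-- The polynomial in `z` over the field of algebraic numbers whose coefficients are the values at
`α` of the given integer polynomials. -/
def algPoly (α : Qbar) (L : List (List ℤ)) : Qbar[X] :=
  evalList X (L.map fun l => C (aeval α (intPoly l)))

/-- The code `c` describes the matrix `A`. -/
def Describes {m : ℕ} (c : Code) (A : GL (Fin m) (RatFunc Qbar)) : Prop :=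
  Irreducible (intPoly c.1) ∧ ∃ α : Qbar, aeval α (intPoly c.1) = 0 ∧
    ∀ i j : Fin m,
      algPoly α ((c.2.getD i []).getD j ([], [])).2 ≠ 0 ∧
      A.1 i j = algebraMap Qbar[X] (RatFunc Qbar) (algPoly α ((c.2.getD i []).getD j ([], [])).1) /
        algebraMap Qbar[X] (RatFunc Qbar) (algPoly α ((c.2.getD i []).getD j ([], [])).2)

theorem exists_evalList {R : Type*} [CommRing R] (q : R[X]) :
    ∃ l : List R, evalList X (l.map C) = q := by
  induction q using Polynomial.recOnHorner with
  | M0 => exact ⟨[], rfl⟩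
  | MC p a _ _ ih =>
    obtain ⟨l, rfl⟩ := ih
    cases l with
    | nil => exact ⟨[a], by simp [evalList]⟩
    | cons b t => exact ⟨(b + a) :: t, by simp [evalList]; ring⟩
  | MX p _ ih =>
    obtain ⟨l, rfl⟩ := ih
    exact ⟨0 :: l, by simp [evalList, mul_comm]⟩

theorem exists_algPoly (α : Qbar) (P : ℤ[X][X]) :
    ∃ L, algPoly α L = P.map (aeval α : ℤ[X] →ₐ[ℤ] Qbar).toRingHom := by
  obtain ⟨l, rfl⟩ := exists_evalList P
  choose g hg using fun q : ℤ[X] => exists_evalList q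
  refine ⟨l.map g, ?_⟩
  induction l with
  | nil => simp [algPoly, evalList]
  | cons a t ih =>
    simp only [algPoly, evalList, List.map_cons, List.foldr_cons, Polynomial.map_add,
      Polynomial.map_mul, Polynomial.map_X, Polynomial.map_C] at ih ⊢
    rw [ih]
    congr 2
    rw [show intPoly (g a) = a from hg a]
    rfl

theorem exists_multiple (α : Qbar) (P : Qbar[X])
    (hP : ∀ k, ∃ g : ℚ[X], aeval α g = P.coeff k) :
    ∃ (n : ℤ) (q : ℤ[X][X]), n ≠ 0 ∧
      q.map (aeval α : ℤ[X] →ₐ[ℤ] Qbar).toRingHom = (n : Qbar[X]) * P := by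
  induction P using Polynomial.recOnHorner with
  | M0 => exact ⟨1, 0, one_ne_zero, by simp⟩
  | MC p a h0 _ ih =>
    obtain ⟨n, q, hn, hq⟩ := ih fun k => by
      rcases k with _ | k
      · exact ⟨0, by simp [h0]⟩
      · simpa [Polynomial.coeff_C] using hP (k + 1)
    obtain ⟨g, hg⟩ := hP 0
    obtain ⟨b, hbm, hb⟩ := IsLocalization.integerNormalization_spec (nonZeroDivisors ℤ) g
    have hb0 : b ≠ 0 := nonZeroDivisors.ne_zero hbm
    set G := IsLocalization.integerNormalization (nonZeroDivisors ℤ) g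
    have hG : aeval α G = (b : Qbar) * a := by
      have h2 : aeval α (G.map (algebraMap ℤ ℚ)) = aeval α (b • g) := congrArg _ hb
      rw [Polynomial.aeval_map_algebraMap] at h2
      rw [h2, map_zsmul, hg]
      simp [h0]
    refine ⟨n * b, Polynomial.C (Polynomial.C b) * q + Polynomial.C (n * G),
      mul_ne_zero hn hb0, ?_⟩
    have e1 : (aeval α : ℤ[X] →ₐ[ℤ] Qbar).toRingHom G = (b : Qbar) * a := hG
    simp only [Polynomial.map_add, Polynomial.map_mul, Polynomial.map_C, hq, map_mul, e1]
    simp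
    ring
  | MX p _ ih =>
    obtain ⟨n, q, hn, hq⟩ := ih fun k => by simpa using hP (k + 1)
    exact ⟨n, q * X, hn, by rw [Polynomial.map_mul, hq, Polynomial.map_X, mul_assoc]⟩

theorem exists_primitive {K L : Type*} [Field K] [CharZero K] [Field L] [Algebra K L]
    [Algebra.IsAlgebraic K L] (S : Finset L) : ∃ α : L, ∀ x ∈ S, ∃ g : K[X], aeval α g = x := by
  let E := IntermediateField.adjoin K (S : Set L)
  have : FiniteDimensional K E :=
    IntermediateField.finiteDimensional_adjoin fun x _ => Algebra.IsIntegral.isIntegral x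
  obtain ⟨β, hβ⟩ := Field.exists_primitive_element K E
  refine ⟨E.val β, fun x hx => ?_⟩
  have h1 : (⟨x, IntermediateField.subset_adjoin _ _ hx⟩ : E) ∈ IntermediateField.adjoin K {β} := by
    rw [hβ]; trivial
  rw [← IntermediateField.mem_toSubalgebra,
    IntermediateField.adjoin_simple_toSubalgebra_of_isAlgebraic (Algebra.IsAlgebraic.isAlgebraic β),
    Algebra.adjoin_singleton_eq_range_aeval] at h1
  obtain ⟨g, hg⟩ := h1
  refine ⟨g, ?_⟩
  rw [Polynomial.aeval_algHom_apply]
  exact congrArg E.val hg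

/-- Every matrix of rational functions with algebraic coefficients is described by some code. -/
theorem exists_describes {m : ℕ} (A : GL (Fin m) (RatFunc Qbar)) : ∃ c, Describes c A := by
  classical
  let S : Finset Qbar := Finset.univ.biUnion fun ij : Fin m × Fin m =>
    (A.1 ij.1 ij.2).num.coeffs ∪ (A.1 ij.1 ij.2).denom.coeffs
  obtain ⟨α, hE⟩ := exists_primitive (K := ℚ) S
  have hS : ∀ P : Qbar[X], (P.coeffs : Set Qbar) ⊆ S → ∀ k, ∃ g : ℚ[X], aeval α g = P.coeff k := by
    intro P hP k
    by_cases h : P.coeff k = 0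
    · exact ⟨0, by simp [h]⟩
    · exact hE _ (hP (Polynomial.coeff_mem_coeffs h))
  have hent : ∀ i j, ∃ e : List (List ℤ) × List (List ℤ), algPoly α e.2 ≠ 0 ∧
      A.1 i j = algebraMap Qbar[X] (RatFunc Qbar) (algPoly α e.1) /
        algebraMap Qbar[X] (RatFunc Qbar) (algPoly α e.2) := by
    intro i j
    have hsub : ∀ x, x ∈ (A.1 i j).num.coeffs ∪ (A.1 i j).denom.coeffs → x ∈ S := fun x hx =>
      Finset.mem_biUnion.2 ⟨(i, j), Finset.mem_univ _, hx⟩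
    obtain ⟨n₁, q₁, hn₁, hq₁⟩ := exists_multiple α (A.1 i j).num
      (hS _ fun x hx => hsub x (Finset.mem_union_left _ hx))
    obtain ⟨n₂, q₂, hn₂, hq₂⟩ := exists_multiple α (A.1 i j).denom
      (hS _ fun x hx => hsub x (Finset.mem_union_right _ hx))
    obtain ⟨L₁, hL₁⟩ := exists_algPoly α ((n₂ : ℤ[X][X]) * q₁)
    obtain ⟨L₂, hL₂⟩ := exists_algPoly α ((n₁ : ℤ[X][X]) * q₂)
    have hd := (A.1 i j).denom_ne_zero
    have hn₁' : (n₁ : Qbar[X]) ≠ 0 := by exact_mod_cast hn₁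
    have hn₂' : (n₂ : Qbar[X]) ≠ 0 := by exact_mod_cast hn₂
    rw [Polynomial.map_mul, hq₁, Polynomial.map_intCast] at hL₁
    rw [Polynomial.map_mul, hq₂, Polynomial.map_intCast] at hL₂
    refine ⟨(L₁, L₂), ?_, ?_⟩
    · rw [hL₂]; exact mul_ne_zero hn₁' (mul_ne_zero hn₂' hd)
    · simp only [hL₁, hL₂]
      rw [← mul_assoc, ← mul_assoc, mul_comm (n₁ : Qbar[X]), map_mul, map_mul _ _ (RatFunc.denom _),
        mul_div_mul_left, RatFunc.num_div_denom]
      exact (map_ne_zero_iff _ (RatFunc.algebraMap_injective Qbar)).2 (mul_ne_zero hn₂' hn₁')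
  choose e he using hent
  obtain ⟨f, hf, hfα⟩ : ∃ f : ℤ[X], Irreducible f ∧ aeval α f = 0 := by
    have hint : IsAlgebraic ℤ α :=
      (IsFractionRing.isAlgebraic_iff ℤ ℚ Qbar).2 (Algebra.IsAlgebraic.isAlgebraic α)
    obtain ⟨f, hf0, hf⟩ := hint
    obtain ⟨s, hs, u, hu⟩ := WfDvdMonoid.exists_factors f hf0
    have h1 : aeval α s.prod = 0 := by
      have : aeval α s.prod * aeval α (u : ℤ[X]) = 0 := by rw [← map_mul, hu, hf]
      exact (mul_eq_zero.1 this).resolve_right ((u.isUnit.map (aeval α)).ne_zero)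
    rw [map_multiset_prod, Multiset.prod_eq_zero_iff] at h1
    obtain ⟨g, hg, hg0⟩ := Multiset.mem_map.1 h1
    exact ⟨g, hs g hg, hg0⟩
  obtain ⟨l, hl⟩ := exists_evalList f
  refine ⟨(l, List.ofFn fun i => List.ofFn fun j => e i j), ?_, α, ?_, ?_⟩
  · rw [show intPoly l = f from hl]; exact hf
  · rw [show intPoly l = f from hl]; exact hfα
  · intro i j
    have : ((List.ofFn fun i => List.ofFn fun j => e i j).getD i []).getD j ([], []) = e i j := by
      simp [List.getD_eq_getElem?_getD]
    rw [this]
    exact he i j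

end Codes

end

end MahlerSystem

namespace MahlerSystem

open Polynomial

noncomputable section

/-! ### Coefficients of products and of φ_p on matrices of Laurent series. -/

section Coefficients

variable {F : Type*} [Field F]

/-! Replacing z by z^d turns equivalence over F((z^(1/d))) to a constant system into the equation B
φ_p(Ψ) = Ψ Λ over Laurent series, with B = φ_d(A)⁻¹ and Ψ, Λ invertible (`isEquivalentToConst_iff`).
The object of study is thus the operator f ↦ B φ_p(f), whose i-th coefficient is ∑_j B_{i-pj} f_j.
As φ_p stretches exponents, rows i ≤ μ_d involve only columns j ≤ μ_d, every coefficient above μ_d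
is determined by earlier ones, and an invertible solution has no coefficient below ν_d. What remains
is a finite window: a block column u with M u = u Λ and N u = 0. Conversely, such a u with Λ
invertible extends recursively to a solution (`exists_isFrame_of_window`). The largest space
carrying such u is the core ⋂ Mⁿ ker N, on which M is bijective (`exists_basis_core`). Columns of a
solution are independent over the Laurent series field (`IsFrame.eq_zero_of_mul_eq_zero`), so the
core has dimension at most m, with equality exactly when a square solution exists.

To bound d, take a solution in z^(1/e) for some e. Then B has only exponents divisible by e, so the
operator sends the residue class s modulo e to p s. The classes that occur form a set S permuted by
p, with at most m elements (`exists_exponents`). Writing elements of the subgroup generated by S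
with base-p digits and carries shows that its order d is at most p^m - 1 (`card_closure_le`), and d
is coprime to p (`coprime_card_closure`). All exponents are multiples of e/d, so the solution
already lives in F((z^(1/d))).

For computability, no rank or valuation is computed. Both dim 𝔛_d ≥ m and dim 𝔛_d < m have finite
certificates made of identities over ℚ(α) (`exists_certificate`), which are checked as congruences
modulo f in ℤ[x]. Every input is certified to be invalid, large or small
(`isInvalid_or_isLarge_or_isSmall`). These three conditions are recursively enumerable, so a
parallel search decides between them, and a bounded search over d < p^m finds the exponent. -/

theorem phi_coeff_of_dvd {p : ℕ} (hp : p ≠ 0) (f : LaurentSeries F) (n : ℤ) (h : (p : ℤ) ∣ n) :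
    (phi F p f).coeff n = f.coeff (n / p) := by
  obtain ⟨k, rfl⟩ := h
  have := phi_coeff_nsmul F hp f k
  rw [nsmul_eq_mul] at this
  rw [this, Int.mul_ediv_cancel_left _ (by exact_mod_cast hp)]

theorem phi_coeff_of_not_dvd {p : ℕ} (hp : p ≠ 0) (f : LaurentSeries F) (n : ℤ)
    (h : ¬ (p : ℤ) ∣ n) : (phi F p f).coeff n = 0 := by
  unfold phi
  rw [dif_pos hp]
  refine HahnSeries.embDomain_of_notMem_range ?_
  rintro ⟨k, hk⟩
  exact h ⟨k, by rw [← hk]; exact nsmul_eq_mul _ _⟩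

theorem phi_coeff_mul {p : ℕ} (hp : p ≠ 0) (f : LaurentSeries F) (n : ℤ) :
    (phi F p f).coeff (p * n) = f.coeff n := by
  rw [phi_coeff_of_dvd hp _ _ ⟨n, rfl⟩, Int.mul_ediv_cancel_left _ (by exact_mod_cast hp)]

theorem phi_C {Γ : Type*} [AddCommGroup Γ] [LinearOrder Γ] [IsOrderedAddMonoid Γ] (p : ℕ) (x : F) :
    phi (Γ := Γ) F p (HahnSeries.C x) = HahnSeries.C x := by
  by_cases hp : p ≠ 0
  · unfold phi
    rw [dif_pos hp]
    exact HahnSeries.embDomainRingHom_C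
  · unfold phi
    rw [dif_neg hp]; rfl

/-- Any finite `s` that catches all nonzero terms is allowed, so that later arguments can choose the
range of exponents freely, including the empty one. -/
theorem coeff_mul_eq_sum (f g : LaurentSeries F) (i : ℤ) (s : Finset ℤ)
    (h : ∀ j ∉ s, f.coeff (i - j) = 0 ∨ g.coeff j = 0) :
    (f * g).coeff i = ∑ j ∈ s, f.coeff (i - j) * g.coeff j := by
  rw [HahnSeries.coeff_mul]
  refine Finset.sum_bij_ne_zero (fun a _ _ => a.2) ?_ ?_ ?_ ?_
  · intro a ha h0
    by_contra hs
    rw [Finset.mem_antidiagonal] at ha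
    have e : a.1 = i - a.2 := by have := ha.2.2; omega
    rcases h _ hs with h1 | h1
    · rw [e, h1, zero_mul] at h0; exact h0 rfl
    · rw [h1, mul_zero] at h0; exact h0 rfl
  · intro a ha _ b hb _ hab
    rw [Finset.mem_antidiagonal] at ha hb
    have := ha.2.2; have := hb.2.2
    ext
    · omega
    · exact hab
  · intro b _ h0
    refine ⟨(i - b, b), ?_, h0, rfl⟩
    rw [Finset.mem_antidiagonal]
    exact ⟨left_ne_zero_of_mul h0, right_ne_zero_of_mul h0, by ring⟩
  · intro a ha _
    rw [Finset.mem_antidiagonal] at ha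
    have e : a.1 = i - a.2 := by have := ha.2.2; omega
    rw [e]

theorem coeff_mul_phi_eq_sum {p : ℕ} (hp : p ≠ 0) (f g : LaurentSeries F) (i : ℤ) (s : Finset ℤ)
    (h : ∀ j ∉ s, f.coeff (i - p * j) = 0 ∨ g.coeff j = 0) :
    (f * phi F p g).coeff i = ∑ j ∈ s, f.coeff (i - p * j) * g.coeff j := by
  have hinj : Function.Injective fun j : ℤ => (p : ℤ) * j :=
    mul_right_injective₀ (by exact_mod_cast hp)
  rw [coeff_mul_eq_sum f _ i (s.image fun j => (p : ℤ) * j),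
    Finset.sum_image fun _ _ _ _ h => hinj h]
  · simp_rw [phi_coeff_mul hp]
  · intro j hj
    by_cases hd : (p : ℤ) ∣ j
    · obtain ⟨k, rfl⟩ := hd
      rw [phi_coeff_mul hp]
      exact h k fun hk => hj (Finset.mem_image_of_mem _ hk)
    · exact Or.inr (phi_coeff_of_not_dvd hp _ _ hd)

variable {ι κ τ : Type*}

/-- The coefficient of `z ^ j` in a matrix of Laurent series. -/
def coeffMatrix (U : Matrix ι κ (LaurentSeries F)) (j : ℤ) : Matrix ι κ F :=
  U.map fun f => f.coeff j

@[simp] theorem coeffMatrix_apply (U : Matrix ι κ (LaurentSeries F)) (j : ℤ) (a : ι) (b : κ) :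
    coeffMatrix U j a b = (U a b).coeff j := rfl

/-- A constant matrix, seen as a matrix of Laurent series. -/
def constMatrix (G : Matrix ι κ F) : Matrix ι κ (LaurentSeries F) :=
  G.map (HahnSeries.C : F →+* LaurentSeries F)

theorem constMatrix_apply (G : Matrix ι κ F) (a : ι) (b : κ) :
    constMatrix G a b = HahnSeries.C (G a b) := rfl

theorem map_phi_constMatrix (p : ℕ) (G : Matrix ι κ F) :
    (constMatrix G).map (phi F p) = constMatrix G := by
  ext1 a b
  exact phi_C p _

theorem ext_coeffMatrix {U V : Matrix ι κ (LaurentSeries F)}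
    (h : ∀ j, coeffMatrix U j = coeffMatrix V j) : U = V := by
  ext a b j
  exact congrFun (congrFun (h j) a) b

theorem coeffMatrix_phi_mul {p : ℕ} (hp : p ≠ 0) (U : Matrix ι κ (LaurentSeries F)) (i : ℤ) :
    coeffMatrix (U.map (phi F p)) (p * i) = coeffMatrix U i := by
  ext a b
  exact phi_coeff_mul hp _ _

theorem coeffMatrix_phi_of_not_dvd {p : ℕ} (hp : p ≠ 0) (U : Matrix ι κ (LaurentSeries F)) (i : ℤ)
    (h : ¬ (p : ℤ) ∣ i) : coeffMatrix (U.map (phi F p)) i = 0 := by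
  ext a b
  exact phi_coeff_of_not_dvd hp _ _ h

variable [Fintype κ]

theorem coeffMatrix_mul_phi {p : ℕ} (hp : p ≠ 0) (U : Matrix ι κ (LaurentSeries F))
    (V : Matrix κ τ (LaurentSeries F)) (i : ℤ) (s : Finset ℤ)
    (h : ∀ j ∉ s, coeffMatrix U (i - p * j) = 0 ∨ coeffMatrix V j = 0) :
    coeffMatrix (U * V.map (phi F p)) i = ∑ j ∈ s, coeffMatrix U (i - p * j) * coeffMatrix V j := by
  ext a b
  simp only [coeffMatrix_apply, Matrix.mul_apply, Matrix.sum_apply, HahnSeries.coeff_sum,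
    Matrix.map_apply]
  rw [Finset.sum_comm]
  refine Finset.sum_congr rfl fun l _ => coeff_mul_phi_eq_sum hp _ _ i s fun j hj => ?_
  rcases h j hj with h | h
  · exact Or.inl (congrFun (congrFun h a) l)
  · exact Or.inr (congrFun (congrFun h l) b)

theorem coeffMatrix_mul (U : Matrix ι κ (LaurentSeries F))
    (V : Matrix κ τ (LaurentSeries F)) (i : ℤ) (s : Finset ℤ)
    (h : ∀ j ∉ s, coeffMatrix U (i - j) = 0 ∨ coeffMatrix V j = 0) :
    coeffMatrix (U * V) i = ∑ j ∈ s, coeffMatrix U (i - j) * coeffMatrix V j := by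
  ext a b
  simp only [coeffMatrix_apply, Matrix.mul_apply, Matrix.sum_apply, HahnSeries.coeff_sum]
  rw [Finset.sum_comm]
  refine Finset.sum_congr rfl fun l _ => coeff_mul_eq_sum _ _ i s fun j hj => ?_
  rcases h j hj with h | h
  · exact Or.inl (congrFun (congrFun h a) l)
  · exact Or.inr (congrFun (congrFun h l) b)

theorem coeffMatrix_mul_C (U : Matrix ι κ (LaurentSeries F)) (G : Matrix κ τ F) (i : ℤ) :
    coeffMatrix (U * constMatrix G) i = coeffMatrix U i * G := by
  ext a b
  simp [Matrix.mul_apply, constMatrix, HahnSeries.C_apply]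

theorem coeffMatrix_C_mul (U : Matrix κ τ (LaurentSeries F)) (G : Matrix ι κ F) (i : ℤ) :
    coeffMatrix (constMatrix G * U) i = G * coeffMatrix U i := by
  ext a b
  simp [Matrix.mul_apply, constMatrix, HahnSeries.C_apply]

theorem exists_coeffMatrix_eq_zero [Finite ι] (U : Matrix ι κ (LaurentSeries F)) :
    ∃ n : ℤ, ∀ j < n, coeffMatrix U j = 0 := by
  cases nonempty_fintype ι
  by_cases hne : Nonempty (ι × κ)
  · obtain ⟨ab, -, hab⟩ := Finset.exists_min_image (Finset.univ : Finset (ι × κ))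
      (fun ab => (U ab.1 ab.2).order) Finset.univ_nonempty
    refine ⟨(U ab.1 ab.2).order, fun j hj => ?_⟩
    ext a b
    exact HahnSeries.coeff_eq_zero_of_lt_order (hj.trans_le (hab (a, b) (Finset.mem_univ _)))
  · exact ⟨0, fun j _ => by ext a b; exact (hne ⟨(a, b)⟩).elim⟩

end Coefficients

/-! ### Frames: uniqueness, independence, orders and extension from a window. -/

section Frames

variable {F : Type*} [Field F] {μ ι : Type*} [Fintype μ] [Fintype ι] [DecidableEq ι]

/-- The columns of `Ψ` span a space of vectors on which `f ↦ B φ_p(f)` is invertible, with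
matrix `Λ`. -/
structure IsFrame (p : ℕ) (B : Matrix μ μ (LaurentSeries F)) (Ψ : Matrix μ ι (LaurentSeries F))
    (Λ : Matrix ι ι F) : Prop where
  isUnit : IsUnit Λ
  eq : B * Ψ.map (phi F p) = Ψ * constMatrix Λ

theorem IsFrame.sum_eq {p : ℕ} (hp : p ≠ 0) {B : Matrix μ μ (LaurentSeries F)}
    {Ψ : Matrix μ ι (LaurentSeries F)} {Λ : Matrix ι ι F} (h : IsFrame p B Ψ Λ) (i : ℤ)
    (s : Finset ℤ) (hs : ∀ j ∉ s, coeffMatrix B (i - p * j) = 0 ∨ coeffMatrix Ψ j = 0) :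
    ∑ j ∈ s, coeffMatrix B (i - p * j) * coeffMatrix Ψ j = coeffMatrix Ψ i * Λ := by
  rw [← coeffMatrix_mul_phi hp _ _ _ _ hs, h.eq, coeffMatrix_mul_C]

/-- A combination of the columns of a frame that vanishes up to the order `hi` is zero. -/
theorem IsFrame.mulVec_eq_zero {p : ℕ} (hp : 2 ≤ p) {B : Matrix μ μ (LaurentSeries F)}
    {Ψ : Matrix μ ι (LaurentSeries F)} {Λ : Matrix ι ι F} (h : IsFrame p B Ψ Λ) {b hi : ℤ}
    (hB : ∀ n < -b, coeffMatrix B n = 0) (hb : b ≤ (p - 1) * hi) (x : ι → F)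
    (hx : ∀ j ≤ hi, (coeffMatrix Ψ j).mulVec x = 0) (j : ℤ) : (coeffMatrix Ψ j).mulVec x = 0 := by
  have hp' : (2 : ℤ) ≤ p := by exact_mod_cast hp
  -- `E t` consists of the constant combinations vanishing up to order `hi + t`. The operator pushes
  -- orders beyond `hi` further up, so Λ maps `E t` into `E (t + 1) ≤ E t`. As Λ is injective,
  -- dimensions force all the `E t` to coincide.
  let E : ℕ → Submodule F (ι → F) := fun t => ⨅ j : {j : ℤ // j ≤ hi + t},
    LinearMap.ker (coeffMatrix Ψ j).mulVecLin
  have memE : ∀ t x, x ∈ E t ↔ ∀ j ≤ hi + t, (coeffMatrix Ψ j).mulVec x = 0 := by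
    intro t x
    simp [E, Submodule.mem_iInf]
  have hanti : ∀ t, E (t + 1) ≤ E t := fun t x hx => by
    rw [memE] at hx ⊢
    exact fun j hj => hx j (by push_cast; omega)
  have hstep : ∀ t, (E t).map Λ.mulVecLin ≤ E (t + 1) := by
    rintro t _ ⟨x, hx, rfl⟩
    rw [SetLike.mem_coe, memE] at hx
    rw [memE]
    intro i hi'
    have e : Ψ * constMatrix Λ * constMatrix (Matrix.replicateCol Unit x) =
        B * (Ψ * constMatrix (Matrix.replicateCol Unit x)).map (phi F p) := by
      rw [Matrix.map_mul, ← Matrix.mul_assoc, h.eq, map_phi_constMatrix]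
    have e2 : coeffMatrix _ i = coeffMatrix _ i := congrArg (fun U => coeffMatrix U i) e
    rw [coeffMatrix_mul_C, coeffMatrix_mul_C, coeffMatrix_mul_phi (by omega) _ _ _ ∅,
      Finset.sum_empty] at e2
    · rw [Matrix.mulVecLin_apply, Matrix.mulVec_mulVec]
      ext a
      have := congrFun (congrFun e2 a) ()
      simpa [Matrix.mul_apply, Matrix.mulVec, dotProduct] using this
    · intro j _
      rw [coeffMatrix_mul_C]
      by_cases hj : j ≤ hi + t
      · right
        ext a b
        exact congrFun (hx j hj) a
      · left
        refine hB _ ?_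
        push_cast at hi'
        -- For i ≤ hi + t + 1 ≤ j one gets i - p j ≤ -(p - 1)(hi + t + 1) < -b.
        have h1 : (hi + t + 1) * (p - 1 : ℤ) ≤ j * (p - 1) :=
          mul_le_mul_of_nonneg_right (by omega) (by omega)
        have h2 : (t + 1 : ℤ) * 1 ≤ (t + 1) * (p - 1) :=
          mul_le_mul_of_nonneg_left (by omega) (by omega)
        nlinarith
  have hinj : Function.Injective Λ.mulVecLin := by
    rw [← LinearMap.ker_eq_bot, LinearMap.ker_eq_bot']
    intro y hy
    exact (Matrix.mulVec_injective_iff_isUnit.2 h.isUnit) (by simpa using hy)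
  have heq : ∀ t, E (t + 1) = E t := fun t => by
    refine Submodule.eq_of_le_of_finrank_le (hanti t) ?_
    rw [(Submodule.equivMapOfInjective _ hinj (E t)).finrank_eq]
    exact Submodule.finrank_mono (hstep t)
  have hall : ∀ t, E t = E 0 := fun t => by
    induction t with
    | zero => rfl
    | succ t ih => rw [heq, ih]
  have h0 : x ∈ E 0 := (memE 0 x).2 (by simpa using hx)
  have h1 : x ∈ E (j - hi).toNat := by rwa [hall]
  exact (memE _ _).1 h1 j (by omega)

end Frames

section Frames

variable {F : Type*} [Field F] {μ ι : Type*} [Fintype μ] [Fintype ι] [DecidableEq ι]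

theorem exists_coeffMatrix_ne_zero {κ τ : Type*} [Finite κ] [Fintype τ]
    (U : Matrix κ τ (LaurentSeries F)) (hU : U ≠ 0) :
    ∃ o : ℤ, coeffMatrix U o ≠ 0 ∧ ∀ j < o, coeffMatrix U j = 0 := by
  obtain ⟨n, hn⟩ := exists_coeffMatrix_eq_zero U
  have hne : ∃ j, coeffMatrix U j ≠ 0 := by
    by_contra! h
    exact hU (ext_coeffMatrix fun j => (h j).trans (by ext; simp))
  obtain ⟨o, ho, hmin⟩ := Int.exists_least_of_bdd
    ⟨n, fun z hz => by by_contra h; exact hz (hn z (by omega))⟩ hne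
  exact ⟨o, ho, fun j hj => by by_contra h; exact absurd (hmin j h) (by omega)⟩

/-- The columns of a frame are linearly independent over the field of Laurent series if no
nontrivial constant combination of them vanishes up to some order. -/
theorem IsFrame.eq_zero_of_mul_eq_zero {p : ℕ} (hp : 2 ≤ p) {B : Matrix μ μ (LaurentSeries F)}
    {Ψ : Matrix μ ι (LaurentSeries F)} {Λ : Matrix ι ι F} (h : IsFrame p B Ψ Λ) {hi : ℤ}
    (hinj : ∀ x : ι → F, (∀ j ≤ hi, (coeffMatrix Ψ j).mulVec x = 0) → x = 0)
    (c : Matrix ι Unit (LaurentSeries F)) (hc : Ψ * c = 0) : c = 0 := by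
  by_contra hne
  have hp0 : p ≠ 0 := by omega
  have hp2 : (2 : ℤ) ≤ p := by exact_mod_cast hp
  obtain ⟨o, ho, hmin⟩ := exists_coeffMatrix_ne_zero c hne
  obtain ⟨lo, hlo⟩ := exists_coeffMatrix_eq_zero Ψ
  -- A relation d yields the relation Λ φ_p(d), because Ψ Λ φ_p(d) = B φ_p(Ψ d). Starting from
  -- z^(-o) c and iterating, the leading coefficient stays at exponent 0 and becomes Λ^k c_o, while
  -- all other exponents move beyond k.
  have key : ∀ k : ℕ, ∃ d : Matrix ι Unit (LaurentSeries F), Ψ * d = 0 ∧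
      (∀ j < 0, coeffMatrix d j = 0) ∧ coeffMatrix d 0 = Λ ^ k * coeffMatrix c o ∧
      ∀ j : ℤ, 0 < j → j ≤ k → coeffMatrix d j = 0 := by
    intro k
    induction k with
    | zero =>
      have hd : ∀ j, coeffMatrix ((HahnSeries.single (-o) (1 : F) : LaurentSeries F) • c) j =
          coeffMatrix c (j + o) := fun j => by
        ext a b
        simp [HahnSeries.coeff_single_mul]
      refine ⟨(HahnSeries.single (-o) (1 : F) : LaurentSeries F) • c, ?_, ?_, ?_, ?_⟩
      · rw [Matrix.mul_smul, hc, smul_zero]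
      · intro j hj
        rw [hd]; exact hmin _ (by omega)
      · rw [hd]; simp
      · intro j hj hj'
        simp at hj'; omega
    | succ k ih =>
      obtain ⟨d, h1, h2, h3, h4⟩ := ih
      refine ⟨constMatrix Λ * d.map (phi F p), ?_, ?_, ?_, ?_⟩
      · rw [← Matrix.mul_assoc, ← h.eq, Matrix.mul_assoc, ← Matrix.map_mul, h1]
        simp
      · intro j hj
        rw [coeffMatrix_C_mul]
        by_cases hd : (p : ℤ) ∣ j
        · obtain ⟨i, rfl⟩ := hd
          rw [coeffMatrix_phi_mul hp0, h2 i (by by_contra hi; nlinarith), Matrix.mul_zero]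
        · rw [coeffMatrix_phi_of_not_dvd hp0 _ _ hd, Matrix.mul_zero]
      · have := coeffMatrix_phi_mul hp0 d 0
        rw [mul_zero] at this
        rw [coeffMatrix_C_mul, this, h3, pow_succ', Matrix.mul_assoc]
      · intro j hj hj'
        rw [coeffMatrix_C_mul]
        by_cases hd : (p : ℤ) ∣ j
        · obtain ⟨i, rfl⟩ := hd
          have hi0 : 0 < i := by by_contra hi; nlinarith
          rw [coeffMatrix_phi_mul hp0, h4 i hi0 (by push_cast at hj'; nlinarith), Matrix.mul_zero]
        · rw [coeffMatrix_phi_of_not_dvd hp0 _ _ hd, Matrix.mul_zero]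
  -- Since Ψ starts at `lo` and d has no exponents in 1, …, hi - lo, only the leading coefficient of
  -- d contributes to the coefficients of Ψ d up to `hi`.
  obtain ⟨d, h1, h2, h3, h4⟩ := key (hi - lo).toNat
  have h5 : ∀ j ≤ hi, coeffMatrix Ψ j * coeffMatrix d 0 = 0 := fun j hj => by
    have := coeffMatrix_mul Ψ d j {0} fun t ht => by
      simp only [Finset.mem_singleton] at ht
      rcases lt_or_gt_of_ne ht with h | h
      · exact Or.inr (h2 t h)
      · by_cases ht' : t ≤ (hi - lo).toNat
        · exact Or.inr (h4 t h ht')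
        · exact Or.inl (hlo _ (by omega))
    rw [h1] at this
    simp only [Finset.sum_singleton, sub_zero] at this
    rw [← this]; ext; simp
  have h6 : coeffMatrix d 0 = 0 := by
    ext a b
    refine congrFun (hinj (fun a => coeffMatrix d 0 a b) fun j hj => ?_) a
    ext l
    exact congrFun (congrFun (h5 j hj) l) b
  rw [h6] at h3
  have hu : IsUnit (Λ ^ (hi - lo).toNat) := h.isUnit.pow _
  apply ho
  obtain ⟨v, hv⟩ := hu
  calc coeffMatrix c o = (↑v⁻¹ * ↑v : Matrix ι ι F) * coeffMatrix c o := by simp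
    _ = 0 := by rw [Matrix.mul_assoc, hv, ← h3, Matrix.mul_zero]

/-- A lower bound for the orders of the columns of a frame. -/
theorem IsFrame.coeffMatrix_eq_zero_of_lt {p : ℕ} (hp : 2 ≤ p) [DecidableEq μ]
    {A B : Matrix μ μ (LaurentSeries F)}
    {Ψ : Matrix μ ι (LaurentSeries F)} {Λ : Matrix ι ι F} (h : IsFrame p B Ψ Λ) (hAB : A * B = 1)
    {a ν : ℤ} (hA : ∀ n < a, coeffMatrix A n = 0) (hν : (p - 1) * (ν - 1) < a) (j : ℤ)
    (hj : j < ν) : coeffMatrix Ψ j = 0 := by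
  by_cases hΨ : Ψ = 0
  · subst hΨ; ext; simp
  obtain ⟨o, ho, hmin⟩ := exists_coeffMatrix_ne_zero Ψ hΨ
  by_cases hoν : ν ≤ o
  · exact hmin j (by omega)
  exfalso
  -- Compare orders: if Ψ has order o, the left side has a nonzero coefficient at p o, but the right
  -- side has order at least a + o, and a + o > p o when o < ν.
  have e : Ψ.map (phi F p) = A * (Ψ * constMatrix Λ) := by
    rw [← h.eq, ← Matrix.mul_assoc, hAB, Matrix.one_mul]
  have hp2 : (2 : ℤ) ≤ p := by exact_mod_cast hp
  have hlt : (p - 1) * o < a := lt_of_le_of_lt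
    (mul_le_mul_of_nonneg_left (by omega) (by omega)) hν
  apply ho
  rw [← coeffMatrix_phi_mul (by omega : p ≠ 0), e, coeffMatrix_mul _ _ _ ∅, Finset.sum_empty]
  intro t _
  by_cases ht : t < o
  · right
    rw [coeffMatrix_mul_C, hmin t ht, Matrix.zero_mul]
  · left
    exact hA _ (by nlinarith)

/-- Course-of-values recursion. -/
def courseOfValues {α : Type*} (f : (n : ℕ) → (Fin n → α) → α) : ℕ → α
  | n => f n fun k => courseOfValues f k
decreasing_by exact k.2

/-- A solution of the truncated equation extends to a frame. -/
theorem exists_isFrame_of_window {p : ℕ} (hp : 2 ≤ p) {B : Matrix μ μ (LaurentSeries F)} {b : ℤ}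
    (hB : ∀ n < -b, coeffMatrix B n = 0) {lo hi : ℤ} (hb : b ≤ (p - 1) * hi)
    (u : ℤ → Matrix μ ι F) {Λ : Matrix ι ι F} (hΛ : IsUnit Λ)
    (hu : ∀ i ≤ hi, ∑ j ∈ Finset.Icc lo hi, coeffMatrix B (i - p * j) * u j =
      if lo ≤ i then u i * Λ else 0) :
    ∃ Ψ : Matrix μ ι (LaurentSeries F), IsFrame p B Ψ Λ ∧ (∀ j < lo, coeffMatrix Ψ j = 0) ∧
      ∀ j ∈ Finset.Icc lo hi, coeffMatrix Ψ j = u j := by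
  have hp2 : (2 : ℤ) ≤ p := by exact_mod_cast hp
  -- The index n stands for the exponent lo + n. Beyond `hi`, the equation at i reads Ψ_i Λ = ∑_{j <
  -- i} B_{i-pj} Ψ_j, which is solved for Ψ_i.
  let f : (n : ℕ) → (Fin n → Matrix μ ι F) → Matrix μ ι F := fun n g =>
    if lo + n ≤ hi then u (lo + n) else
      (∑ k : Fin n, coeffMatrix B (lo + n - p * (lo + (k : ℕ))) * g k) * Λ⁻¹
  let g := courseOfValues f
  have hg : ∀ n, g n = f n fun k => g k := fun n => by
    simp only [g]; rw [courseOfValues]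
  let v : ℤ → Matrix μ ι F := fun j => if j < lo then 0 else g (j - lo).toNat
  have hv : ∀ a c, BddBelow (Function.support fun j => v j a c) := fun a c =>
    ⟨lo, fun j hj => by
      by_contra h
      exact hj (by simp [v, not_le.1 h])⟩
  let Ψ : Matrix μ ι (LaurentSeries F) := fun a c => HahnSeries.ofSuppBddBelow _ (hv a c)
  have hΨ : ∀ j, coeffMatrix Ψ j = v j := fun j => by
    ext a c
    exact congrFun (HahnSeries.coeff_ofSuppBddBelow (hf := hv a c)) j
  have hlow : ∀ j < lo, coeffMatrix Ψ j = 0 := fun j hj => by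
    rw [hΨ]; simp [v, hj]
  have hwin : ∀ j ∈ Finset.Icc lo hi, coeffMatrix Ψ j = u j := fun j hj => by
    rw [Finset.mem_Icc] at hj
    have e : lo + ((j - lo).toNat : ℤ) = j := by omega
    rw [hΨ]
    simp only [v]
    rw [if_neg (by omega), hg]
    simp only [f]
    rw [e, if_pos hj.2]
  refine ⟨Ψ, ⟨hΛ, ext_coeffMatrix fun i => ?_⟩, hlow, hwin⟩
  rw [coeffMatrix_mul_C]
  by_cases hi' : i ≤ hi
  · rw [coeffMatrix_mul_phi (by omega) B Ψ i (Finset.Icc lo hi)]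
    · rw [Finset.sum_congr rfl fun j hj => by rw [hwin j hj], hu i hi']
      split_ifs with h
      · rw [hwin i (Finset.mem_Icc.2 ⟨h, hi'⟩)]
      · rw [hlow i (by omega), Matrix.zero_mul]
    · intro j hj
      rw [Finset.mem_Icc] at hj
      by_cases h : j < lo
      · exact Or.inr (hlow j h)
      · refine Or.inl (hB _ ?_)
        have h1 : (hi + 1) * (p - 1 : ℤ) ≤ j * (p - 1) :=
          mul_le_mul_of_nonneg_right (by omega) (by omega)
        nlinarith
  -- Here hi < i < lo, which is possible only when the window is empty.
  by_cases hlo : i < lo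
  · rw [hlow i hlo, Matrix.zero_mul, coeffMatrix_mul_phi (by omega) B Ψ i ∅, Finset.sum_empty]
    intro j _
    by_cases h : j < lo
    · exact Or.inr (hlow j h)
    · refine Or.inl (hB _ ?_)
      have h1 : (hi + 1) * (p - 1 : ℤ) ≤ j * (p - 1) :=
        mul_le_mul_of_nonneg_right (by omega) (by omega)
      nlinarith
  rw [coeffMatrix_mul_phi (by omega) B Ψ i ((Finset.range (i - lo).toNat).image
    fun k : ℕ => lo + (k : ℤ)), Finset.sum_image fun _ _ _ _ h => by simpa using h]
  · have e : lo + ((i - lo).toNat : ℤ) = i := by omega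
    rw [hΨ i]
    simp only [v]
    rw [if_neg hlo, hg]
    simp only [f]
    rw [e, if_neg hi', Matrix.mul_assoc, Matrix.nonsing_inv_mul _ ((Matrix.isUnit_iff_isUnit_det _).1 hΛ), Matrix.mul_one,
      Finset.sum_range]
    refine Finset.sum_congr rfl fun k _ => ?_
    rw [hΨ]
    simp only [v]
    rw [if_neg (by omega), add_sub_cancel_left, Int.toNat_natCast]
  · intro j hj
    by_cases h : j < lo
    · exact Or.inr (hlow j h)
    · refine Or.inl (hB _ ?_)
      have h2 : i ≤ j := by
        by_contra h3
        refine hj (Finset.mem_image.2 ⟨(j - lo).toNat, Finset.mem_range.2 (by omega), by omega⟩)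
      have h1 : (hi + 1) * (p - 1 : ℤ) ≤ i * (p - 1) :=
        mul_le_mul_of_nonneg_right (by omega) (by omega)
      nlinarith

end Frames

/-! ### The core: the largest subspace of ker N on which M is bijective. -/

section Core

variable {F : Type*} [Field F] {ι κ : Type*} [Fintype ι] [DecidableEq ι] [Fintype κ]

/-- The intersection of the spaces `M ^ n · ker N`, `n ∈ ℤ`. -/
def core (M : Matrix ι ι F) (N : Matrix κ ι F) : Submodule F (ι → F) := ⨅ n : ℤ, powKer M N n

/-- The preimages for different k are not required to be compatible. Compatibility is recovered from
the injectivity of M on the core, `eq_zero_of_mem_core`. -/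
theorem mem_core_iff (M : Matrix ι ι F) (N : Matrix κ ι F) (x : ι → F) :
    x ∈ core M N ↔ (∀ k : ℕ, ∃ y, N.mulVec y = 0 ∧ (M ^ k).mulVec y = x) ∧
      ∀ k : ℕ, N.mulVec ((M ^ k).mulVec x) = 0 := by
  unfold core powKer
  rw [Submodule.mem_iInf]
  constructor
  · intro h
    have h1 : ∀ k : ℕ, ∃ y, N.mulVec y = 0 ∧ (M ^ k).mulVec y = x := fun k => by
      have := h k
      rw [if_pos (by omega)] at this
      obtain ⟨y, hy, e⟩ := this
      exact ⟨y, by simpa using hy, by simpa using e⟩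
    refine ⟨h1, fun k => ?_⟩
    rcases k with _ | k
    · obtain ⟨y, hy, e⟩ := h1 0
      rw [pow_zero, Matrix.one_mulVec] at e ⊢
      rw [← e, hy]
    · have := h (-((k + 1 : ℕ) : ℤ))
      rw [if_neg (by omega), neg_neg, Int.toNat_natCast, LinearMap.mem_ker, Matrix.mulVecLin_apply,
        ← Matrix.mulVec_mulVec] at this
      exact this
  · rintro ⟨h1, h2⟩ n
    split_ifs with hn
    · obtain ⟨y, hy, e⟩ := h1 n.toNat
      exact ⟨y, by simpa using hy, by simpa using e⟩
    · rw [LinearMap.mem_ker, Matrix.mulVecLin_apply, ← Matrix.mulVec_mulVec]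
      exact h2 _

theorem mulVec_mem_core {M : Matrix ι ι F} {N : Matrix κ ι F} {x : ι → F} (hx : x ∈ core M N) :
    M.mulVec x ∈ core M N := by
  rw [mem_core_iff] at hx ⊢
  refine ⟨fun k => ?_, fun k => ?_⟩
  · rcases k with _ | k
    · exact ⟨M.mulVec x, by simpa using hx.2 1, by simp⟩
    · obtain ⟨y, hy, e⟩ := hx.1 k
      exact ⟨y, hy, by rw [pow_succ', ← Matrix.mulVec_mulVec, e]⟩
  · rw [Matrix.mulVec_mulVec _ (M ^ k), ← pow_succ]
    exact hx.2 (k + 1)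

theorem mulVec_eq_zero_of_mem_core {M : Matrix ι ι F} {N : Matrix κ ι F} {x : ι → F}
    (hx : x ∈ core M N) : N.mulVec x = 0 := by
  simpa using ((mem_core_iff M N x).1 hx).2 0

theorem mulVecLin_pow (M : Matrix ι ι F) (k : ℕ) : (M ^ k).mulVecLin = M.mulVecLin ^ k :=
  Matrix.toLin'_pow M k

/-- Write x = Mⁿ y with n the dimension of the whole space. If M x = 0 then y lies in ker M^(n+1),
which equals ker Mⁿ because the kernels have stabilized. -/
theorem eq_zero_of_mem_core {M : Matrix ι ι F} {N : Matrix κ ι F} {x : ι → F}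
    (hx : x ∈ core M N) (h0 : M.mulVec x = 0) : x = 0 := by
  obtain ⟨y, -, rfl⟩ := ((mem_core_iff M N x).1 hx).1 (Module.finrank F (ι → F))
  set n := Module.finrank F (ι → F)
  have h1 : y ∈ LinearMap.ker (M.mulVecLin ^ (n + 1)) := by
    rw [← mulVecLin_pow, LinearMap.mem_ker, Matrix.mulVecLin_apply, pow_succ',
      ← Matrix.mulVec_mulVec, h0]
  rw [Module.End.ker_pow_eq_ker_pow_finrank_of_le (by omega), ← mulVecLin_pow] at h1
  exact h1

/-- A basis of the core, as a matrix. -/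
theorem exists_basis_core (M : Matrix ι ι F) (N : Matrix κ ι F) :
    ∃ (u : Matrix ι (Fin (Module.finrank F (core M N))) F)
      (Λ : Matrix (Fin (Module.finrank F (core M N))) (Fin (Module.finrank F (core M N))) F),
      IsUnit Λ ∧ M * u = u * Λ ∧ N * u = 0 ∧ (∀ x, u.mulVec x = 0 → x = 0) ∧
        LinearMap.range u.mulVecLin = core M N := by
  let b := Module.finBasis F (core M N)
  let g : core M N →ₗ[F] core M N := M.mulVecLin.restrict fun x hx => mulVec_mem_core hx
  have hg : Function.Injective g := by
    rw [← LinearMap.ker_eq_bot, LinearMap.ker_eq_bot']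
    intro x hx
    exact Subtype.ext (eq_zero_of_mem_core x.2 (congrArg Subtype.val hx))
  let u : Matrix ι (Fin (Module.finrank F (core M N))) F := Matrix.of fun i k => (b k).1 i
  have hu : ∀ x, u.mulVec x = (∑ k, x k • b k : core M N).1 := fun x => by
    ext i
    simp [u, Matrix.mulVec, dotProduct, Finset.sum_apply, mul_comm]
  refine ⟨u, LinearMap.toMatrix b b g, ?_, ?_, ?_, ?_, ?_⟩
  · rw [LinearMap.isUnit_toMatrix_iff, Module.End.isUnit_iff]
    exact ⟨hg, LinearMap.injective_iff_surjective.1 hg⟩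
  · ext i k
    have h1 : (g (b k)).1 i =
        (∑ l, (LinearMap.toMatrix b b g : Matrix _ _ F) l k • b l : core M N).1 i := by
      simp only [LinearMap.toMatrix_apply, b.sum_repr]
    have h2 : (g (b k)).1 i = (M * u) i k := rfl
    rw [← h2, h1]
    simp only [Matrix.mul_apply, u, Matrix.of_apply, AddSubmonoidClass.coe_finsetSum,
      Submodule.coe_smul, Finset.sum_apply, Pi.smul_apply, smul_eq_mul, mul_comm]
  · ext i k
    exact congrFun (mulVec_eq_zero_of_mem_core (b k).2) i
  · intro x hx
    rw [hu] at hx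
    ext k
    exact Fintype.linearIndependent_iff.1 b.linearIndependent x (Subtype.ext hx) k
  · ext x
    constructor
    · rintro ⟨y, rfl⟩
      rw [Matrix.mulVecLin_apply, hu]
      exact Subtype.prop _
    · intro hx
      refine ⟨b.repr ⟨x, hx⟩, ?_⟩
      rw [Matrix.mulVecLin_apply, hu, b.sum_repr]

/-- Maximality of the core: the powers of Λ⁻¹ supply the preimages under the powers of M, and N M^k
u = N u Λ^k = 0. -/
theorem range_le_core {τ : Type*} [Fintype τ] [DecidableEq τ] {M : Matrix ι ι F}
    {N : Matrix κ ι F} {u : Matrix ι τ F} {Λ : Matrix τ τ F} (hΛ : IsUnit Λ)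
    (h1 : M * u = u * Λ) (h2 : N * u = 0) : LinearMap.range u.mulVecLin ≤ core M N := by
  rintro _ ⟨x, rfl⟩
  rw [Matrix.mulVecLin_apply, mem_core_iff]
  have hp : ∀ k : ℕ, M ^ k * u = u * Λ ^ k := fun k => by
    induction k with
    | zero => simp
    | succ k ih => rw [pow_succ, Matrix.mul_assoc, h1, ← Matrix.mul_assoc, ih, Matrix.mul_assoc,
        ← pow_succ]
  refine ⟨fun k => ?_, fun k => ?_⟩
  · obtain ⟨v, hv⟩ := hΛ.pow k
    refine ⟨u.mulVec ((v⁻¹.1 : Matrix τ τ F).mulVec x), ?_, ?_⟩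
    · rw [Matrix.mulVec_mulVec, h2, Matrix.zero_mulVec]
    · rw [Matrix.mulVec_mulVec, Matrix.mulVec_mulVec, hp, Matrix.mul_assoc, ← hv]
      simp
  · rw [Matrix.mulVec_mulVec, Matrix.mulVec_mulVec, Matrix.mul_assoc, hp, ← Matrix.mul_assoc, h2,
      Matrix.zero_mul, Matrix.zero_mulVec]

theorem card_le_finrank_core {τ : Type*} [Fintype τ] [DecidableEq τ] {M : Matrix ι ι F}
    {N : Matrix κ ι F} {u : Matrix ι τ F} {Λ : Matrix τ τ F} (hΛ : IsUnit Λ)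
    (h1 : M * u = u * Λ) (h2 : N * u = 0) (h3 : ∀ x, u.mulVec x = 0 → x = 0) :
    Fintype.card τ ≤ Module.finrank F (core M N) := by
  have h4 : Function.Injective u.mulVecLin := by
    rw [← LinearMap.ker_eq_bot, LinearMap.ker_eq_bot']
    exact h3
  rw [← Module.finrank_fintype_fun_eq_card F (η := τ), ← LinearMap.finrank_range_of_inj h4]
  exact Submodule.finrank_mono (range_le_core hΛ h1 h2)

end Core

/-! ### Truncation of the operator to a finite window of exponents. -/

section Window

variable {F : Type*} [Field F] {m : ℕ} {ι : Type*}

/-- The part with rows `s` and columns `t` of the matrix of `f ↦ B φ_p(f)` on coefficients. -/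
def windowMatrix (s t : Finset ℤ) (p : ℕ) (B : Matrix (Fin m) (Fin m) (LaurentSeries F)) :
    Matrix (s × Fin m) (t × Fin m) F :=
  fun r c => (B r.2 c.2).coeff ((r.1 : ℤ) - p * (c.1 : ℤ))

/-- The coefficients with index in `t` of a sequence of matrices, as a block column. -/
def windowColumn (t : Finset ℤ) (v : ℤ → Matrix (Fin m) ι F) : Matrix (t × Fin m) ι F :=
  fun c k => v c.1 c.2 k

theorem exists_windowColumn (t : Finset ℤ) (u : Matrix (t × Fin m) ι F) :
    ∃ v, windowColumn t v = u := by
  classical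
  refine ⟨fun j => if h : j ∈ t then fun a k => u (⟨j, h⟩, a) k else 0, ?_⟩
  ext ⟨j, a⟩ k
  simp [windowColumn]

theorem windowMatrix_mul (s t : Finset ℤ) (p : ℕ) (B : Matrix (Fin m) (Fin m) (LaurentSeries F))
    (v : ℤ → Matrix (Fin m) ι F) : windowMatrix s t p B * windowColumn t v =
      windowColumn s fun i => ∑ j ∈ t, coeffMatrix B (i - p * j) * v j := by
  ext r k
  simp only [windowMatrix, windowColumn, Matrix.mul_apply, Matrix.sum_apply, coeffMatrix_apply,
    Fintype.sum_prod_type]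
  exact Finset.sum_coe_sort t fun j => ∑ l, (B r.2 l).coeff (r.1 - p * j) * v j l k

variable [Fintype ι]

theorem windowColumn_mul (t : Finset ℤ) (v : ℤ → Matrix (Fin m) ι F) (Λ : Matrix ι ι F) :
    windowColumn t v * Λ = windowColumn t fun j => v j * Λ := by
  ext r k
  simp [windowColumn, Matrix.mul_apply]

theorem card_le_of_mul_injective {K : Type*} [Field K] {Ψ : Matrix (Fin m) ι K}
    (h : ∀ c : Matrix ι Unit K, Ψ * c = 0 → c = 0) : Fintype.card ι ≤ m := by
  have h4 : Function.Injective Ψ.mulVecLin := by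
    rw [← LinearMap.ker_eq_bot, LinearMap.ker_eq_bot']
    intro x hx
    have := h (Matrix.replicateCol Unit x) (by
      ext a b
      simpa [Matrix.mul_apply, Matrix.mulVec, dotProduct] using congrFun hx a)
    ext a
    exact congrFun (congrFun this a) ()
  simpa using LinearMap.finrank_le_finrank_of_injective h4

variable [DecidableEq ι]
variable {p : ℕ} {B : Matrix (Fin m) (Fin m) (LaurentSeries F)} {b lo hi r : ℤ}

/-- A solution of the windowed equation extends to a square frame, or a frame with fewer
columns. -/
theorem exists_isFrame_of_windowColumn (hp : 2 ≤ p) (hB : ∀ n < -b, coeffMatrix B n = 0)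
    (hb : b ≤ (p - 1) * hi) (hr : r ≤ -b + p * lo) {u : Matrix (Finset.Icc lo hi × Fin m) ι F}
    {Λ : Matrix ι ι F} (hΛ : IsUnit Λ)
    (h1 : windowMatrix (Finset.Icc lo hi) (Finset.Icc lo hi) p B * u = u * Λ)
    (h2 : windowMatrix (Finset.Icc r (lo - 1)) (Finset.Icc lo hi) p B * u = 0)
    (h3 : ∀ x, u.mulVec x = 0 → x = 0) :
    ∃ Ψ : Matrix (Fin m) ι (LaurentSeries F), IsFrame p B Ψ Λ ∧ (∀ j < lo, coeffMatrix Ψ j = 0) ∧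
      windowColumn (Finset.Icc lo hi) (coeffMatrix Ψ) = u ∧
      ∀ c : Matrix ι Unit (LaurentSeries F), Ψ * c = 0 → c = 0 := by
  have hp2 : (2 : ℤ) ≤ p := by exact_mod_cast hp
  obtain ⟨v, rfl⟩ := exists_windowColumn _ u
  rw [windowMatrix_mul] at h1 h2
  rw [windowColumn_mul] at h1
  obtain ⟨Ψ, hΨ, hlow, hwin⟩ := exists_isFrame_of_window hp hB hb v (lo := lo) hΛ fun i hi' => by
    split_ifs with hlo
    · ext a k
      exact congrFun (congrFun h1 (⟨i, Finset.mem_Icc.2 ⟨hlo, hi'⟩⟩, a)) k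
    · by_cases hri : r ≤ i
      · ext a k
        exact congrFun (congrFun h2 (⟨i, Finset.mem_Icc.2 ⟨hri, by omega⟩⟩, a)) k
      -- Rows below `r` impose no condition: there i - p j < r - p lo ≤ -b for every j in the
      -- window.
      · refine Finset.sum_eq_zero fun j hj => ?_
        rw [hB, Matrix.zero_mul]
        have : (p : ℤ) * lo ≤ p * j :=
          mul_le_mul_of_nonneg_left (Finset.mem_Icc.1 hj).1 (by omega)
        omega
  have hcol : windowColumn (Finset.Icc lo hi) (coeffMatrix Ψ) =
      windowColumn (Finset.Icc lo hi) v := by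
    ext c k
    exact congrFun (congrFun (hwin c.1 c.1.2) c.2) k
  refine ⟨Ψ, hΨ, hlow, hcol, hΨ.eq_zero_of_mul_eq_zero hp (hi := hi) fun x hx => h3 x ?_⟩
  rw [← hcol]
  ext c
  exact congrFun (hx c.1 (Finset.mem_Icc.1 c.1.2).2) c.2

theorem isUnit_of_mul_injective {K : Type*} [Field K] {Ψ : Matrix (Fin m) (Fin m) K}
    (h : ∀ c : Matrix (Fin m) Unit K, Ψ * c = 0 → c = 0) : IsUnit Ψ := by
  rw [← Matrix.mulVec_injective_iff_isUnit]
  have h4 : LinearMap.ker Ψ.mulVecLin = ⊥ := by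
    rw [LinearMap.ker_eq_bot']
    intro x hx
    have := h (Matrix.replicateCol Unit x) (by
      ext a b
      simpa [Matrix.mul_apply, Matrix.mulVec, dotProduct] using congrFun hx a)
    ext a
    exact congrFun (congrFun this a) ()
  exact LinearMap.ker_eq_bot.1 h4

/-- The core of the windowed equation. -/
def windowCore (p : ℕ) (B : Matrix (Fin m) (Fin m) (LaurentSeries F)) (r lo hi : ℤ) :
    Submodule F (Finset.Icc lo hi × Fin m → F) :=
  core (windowMatrix (Finset.Icc lo hi) (Finset.Icc lo hi) p B)
    (windowMatrix (Finset.Icc r (lo - 1)) (Finset.Icc lo hi) p B)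

/-- A basis of the core extends to a frame whose columns are independent over the Laurent series
field inside a space of dimension m. This caps the dimension of the core at m, and when it is m the
frame is square and invertible. -/
theorem exists_isFrame_of_le_finrank (hp : 2 ≤ p) (hB : ∀ n < -b, coeffMatrix B n = 0)
    (hb : b ≤ (p - 1) * hi) (hr : r ≤ -b + p * lo)
    (hm : m ≤ Module.finrank F (windowCore p B r lo hi)) :
    Module.finrank F (windowCore p B r lo hi) = m ∧
      ∃ (Ψ : Matrix (Fin m) (Fin m) (LaurentSeries F)) (Λ : Matrix (Fin m) (Fin m) F),
        IsFrame p B Ψ Λ ∧ IsUnit Ψ ∧ (∀ j < lo, coeffMatrix Ψ j = 0) ∧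
          ∀ x, (windowColumn (Finset.Icc lo hi) (coeffMatrix Ψ)).mulVec x = 0 → x = 0 := by
  obtain ⟨u, Λ, hΛ, h1, h2, h3, -⟩ := exists_basis_core
    (windowMatrix (Finset.Icc lo hi) (Finset.Icc lo hi) p B)
    (windowMatrix (Finset.Icc r (lo - 1)) (Finset.Icc lo hi) p B)
  obtain ⟨Ψ, hΨ, hlow, hcol, hinj⟩ := exists_isFrame_of_windowColumn hp hB hb hr hΛ h1 h2 h3
  have e : Module.finrank F (windowCore p B r lo hi) = m :=
    le_antisymm (by
      have := card_le_of_mul_injective hinj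
      rw [Fintype.card_fin] at this
      exact this) hm
  refine ⟨e, ?_⟩
  unfold windowCore at e
  -- The dimension indexes the columns of u and Ψ, so it must become a variable before it can be
  -- replaced by m.
  generalize Module.finrank F (core (windowMatrix (Finset.Icc lo hi) (Finset.Icc lo hi) p B)
    (windowMatrix (Finset.Icc r (lo - 1)) (Finset.Icc lo hi) p B)) = n at *
  subst e
  exact ⟨Ψ, Λ, hΨ, isUnit_of_mul_injective hinj, hlow, by rw [hcol]; exact h3⟩

/-- Truncation to the window loses nothing: rows up to `hi` only see columns up to `hi`, and by
`IsFrame.mulVec_eq_zero` a constant combination that vanishes on the window vanishes altogether. -/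
theorem IsFrame.le_finrank_windowCore (hp : 2 ≤ p) (hB : ∀ n < -b, coeffMatrix B n = 0)
    (hb : b ≤ (p - 1) * hi) {Ψ : Matrix (Fin m) ι (LaurentSeries F)}
    {Λ : Matrix ι ι F} (h : IsFrame p B Ψ Λ)
    (hΨ : ∀ c : Matrix ι Unit (LaurentSeries F), Ψ * c = 0 → c = 0)
    (hlow : ∀ j < lo, coeffMatrix Ψ j = 0) :
    Fintype.card ι ≤ Module.finrank F (windowCore p B r lo hi) := by
  have hp2 : (2 : ℤ) ≤ p := by exact_mod_cast hp
  have hsum : ∀ i ≤ hi, ∑ j ∈ Finset.Icc lo hi, coeffMatrix B (i - p * j) * coeffMatrix Ψ j =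
      coeffMatrix Ψ i * Λ := fun i hi' => h.sum_eq (by omega) i _ fun j hj => by
    by_cases hj' : j < lo
    · exact Or.inr (hlow j hj')
    · rw [Finset.mem_Icc] at hj
      refine Or.inl (hB _ ?_)
      have h1 : (hi + 1) * (p - 1 : ℤ) ≤ j * (p - 1) :=
        mul_le_mul_of_nonneg_right (by omega) (by omega)
      nlinarith
  refine card_le_finrank_core (u := windowColumn (Finset.Icc lo hi) (coeffMatrix Ψ)) h.isUnit
    ?_ ?_ ?_
  · rw [windowMatrix_mul, windowColumn_mul]
    ext c k
    simp only [windowColumn]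
    rw [hsum _ (Finset.mem_Icc.1 c.1.2).2]
  · rw [windowMatrix_mul]
    ext c k
    have hc := Finset.mem_Icc.1 c.1.2
    simp only [windowColumn]
    by_cases hc' : (c.1 : ℤ) ≤ hi
    · rw [hsum _ hc', hlow _ (by omega), Matrix.zero_mul]; rfl
    -- A row below `lo` lies above `hi` only if the window is empty.
    · rw [Finset.Icc_eq_empty (by omega)]; rfl
  · intro x hx
    have h0 : ∀ j, (coeffMatrix Ψ j).mulVec x = 0 := h.mulVec_eq_zero hp hB hb x fun j hj => by
      by_cases hj' : j < lo
      · rw [hlow j hj', Matrix.zero_mulVec]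
      · ext a
        exact congrFun hx (⟨j, Finset.mem_Icc.2 ⟨by omega, hj⟩⟩, a)
    have := hΨ (constMatrix (Matrix.replicateCol Unit x)) (ext_coeffMatrix fun j => by
      rw [coeffMatrix_mul_C]
      ext a b
      simpa [Matrix.mul_apply, Matrix.mulVec, dotProduct] using congrFun (h0 j) a)
    ext k
    have := congrFun (congrFun this k) ()
    simpa [constMatrix] using this

end Window

/-! ### From systems over Puiseux series to frames over Laurent series. -/

section Bridge

variable {F : Type*} [Field F] {m : ℕ}

theorem phi_laurentToHahn (p : ℕ) (f : LaurentSeries F) :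
    phi F p (laurentToHahn F f) = laurentToHahn F (phi F p f) := by
  by_cases hp : p ≠ 0
  swap
  · unfold phi; rw [dif_neg hp, dif_neg hp]; rfl
  have key : ∀ (g : LaurentSeries F) (n : ℤ), (laurentToHahn F g).coeff n = g.coeff n :=
    fun g n => HahnSeries.embDomain_coeff (f := ⟨⟨Int.castAddHom ℚ, _⟩, _⟩) (a := n)
  have key0 : ∀ (g : LaurentSeries F) (q : ℚ), (¬ ∃ n : ℤ, (n : ℚ) = q) →
      (laurentToHahn F g).coeff q = 0 := fun g q hq =>
    HahnSeries.embDomain_of_notMem_range fun ⟨n, h⟩ => hq ⟨n, h⟩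
  have hp' : (p : ℚ) ≠ 0 := by exact_mod_cast hp
  have keyp : ∀ (g : HahnSeries ℚ F) (q : ℚ), (phi F p g).coeff q = g.coeff (q / p) :=
    fun g q => by
      have := phi_coeff_nsmul F hp g (q / p)
      rwa [nsmul_eq_mul, mul_div_cancel₀ _ hp'] at this
  ext q
  rw [keyp]
  by_cases hq : ∃ n : ℤ, (n : ℚ) = q
  · obtain ⟨n, rfl⟩ := hq
    rw [key]
    by_cases hd : (p : ℤ) ∣ n
    · rw [phi_coeff_of_dvd hp _ _ hd]
      obtain ⟨k, rfl⟩ := hd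
      have e : (((p : ℤ) * k : ℤ) : ℚ) / p = (k : ℤ) := by push_cast; field_simp
      rw [e, key, Int.mul_ediv_cancel_left _ (by exact_mod_cast hp)]
    · rw [phi_coeff_of_not_dvd hp _ _ hd, key0]
      rintro ⟨k, hk⟩
      refine hd ⟨k, ?_⟩
      rw [eq_div_iff hp'] at hk
      have : (n : ℚ) = ((p * k : ℤ) : ℚ) := by push_cast; rw [← hk]; ring
      exact_mod_cast this
  · rw [key0 _ _ hq, key0]
    rintro ⟨k, hk⟩
    exact hq ⟨p * k, by push_cast; rw [hk]; field_simp⟩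

theorem phi_injective {Γ : Type*} [AddCommGroup Γ] [LinearOrder Γ] [IsOrderedAddMonoid Γ] (d : ℕ) :
    Function.Injective (phi (Γ := Γ) F d) := RingHom.injective _

theorem phi_phi (p d : ℕ) (hp : p ≠ 0) (hd : d ≠ 0) (f : HahnSeries ℚ F) :
    phi F p (phi F d f) = phi F d (phi F p f) := by
  have keyp : ∀ (e : ℕ), e ≠ 0 → ∀ (g : HahnSeries ℚ F) (q : ℚ),
      (phi F e g).coeff q = g.coeff (q / e) := fun e he g q => by
    have he' : (e : ℚ) ≠ 0 := by exact_mod_cast he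
    have := phi_coeff_nsmul F he g (q / e)
    rwa [nsmul_eq_mul, mul_div_cancel₀ _ he'] at this
  ext q
  rw [keyp p hp, keyp d hd, keyp d hd, keyp p hp, div_right_comm]

/-- Rational exponents can be divided by d. This is how a Laurent series in z^(1/d) is recovered
from a Laurent series in z. -/
theorem phi_surjective (d : ℕ) : Function.Surjective (phi (Γ := ℚ) F d) := by
  by_cases hd : d ≠ 0
  swap
  · unfold phi; rw [dif_neg hd]; exact fun f => ⟨f, rfl⟩
  have hd' : (0 : ℚ) < d := by exact_mod_cast Nat.pos_of_ne_zero hd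
  intro f
  let e : ℚ ↪o ℚ := ⟨⟨fun q => q / d, fun a b h => by
    simpa [hd'.ne'] using h⟩, fun {a b} => div_le_div_iff_of_pos_right hd'⟩
  refine ⟨HahnSeries.embDomain e f, ?_⟩
  ext q
  have := phi_coeff_nsmul F hd (HahnSeries.embDomain e f) (q / d)
  rw [nsmul_eq_mul, mul_div_cancel₀ _ hd'.ne'] at this
  rw [this]
  exact HahnSeries.embDomain_coeff (f := e) (a := q)

theorem exists_mem_rootField (d : ℕ) (g : LaurentSeries F) :
    ∃ f : rootField F d, phi F d (f : HahnSeries ℚ F) = laurentToHahn F g := by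
  obtain ⟨f, hf⟩ := phi_surjective d (laurentToHahn F g)
  exact ⟨⟨f, ⟨g, hf.symm⟩⟩, hf⟩

/-- The Laurent series `f(z ^ d)`, for `f` in the field `F((z ^ (1/d)))`. -/
def rootToLaurent (d : ℕ) : rootField F d →+* LaurentSeries F :=
  (laurentToHahn F).rangeRestrictFieldEquiv.symm.toRingHom.comp
    (((phi F d).comp (rootField F d).subtype).codRestrict (laurentToHahn F).fieldRange
      fun f => f.2)

theorem laurentToHahn_rootToLaurent (d : ℕ) (f : rootField F d) :
    laurentToHahn F (rootToLaurent d f) = phi F d (f : HahnSeries ℚ F) :=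
  (laurentToHahn F).rangeRestrictFieldEquiv_apply_symm_apply _

theorem rootToLaurent_surjective (d : ℕ) : Function.Surjective (rootToLaurent (F := F) d) := by
  intro g
  obtain ⟨f, hf⟩ := exists_mem_rootField d g
  exact ⟨f, (laurentToHahn F).injective (by rw [laurentToHahn_rootToLaurent, hf])⟩

open scoped RatFunc in
theorem laurent_algebraMap (P : F[X]) : laurent F (algebraMap F[X] (RatFunc F) P) =
    HahnSeries.ofPowerSeries ℤ F (P : PowerSeries F) :=
  (RatFunc.coe_coe P).symm

theorem laurent_C (x : F) : laurent F (RatFunc.C x) = HahnSeries.C x := by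
  rw [← RatFunc.algebraMap_C, laurent_algebraMap, Polynomial.coe_C, HahnSeries.ofPowerSeries_C]

/-- The matrix `φ_d(A)`, expanded at `0`. -/
def dilate (A : GL (Fin m) (RatFunc F)) (d : ℕ) : Matrix (Fin m) (Fin m) (LaurentSeries F) :=
  A.1.map fun x => phi F d (laurent F x)

theorem dilate_inv (A : GL (Fin m) (RatFunc F)) (d : ℕ) : (dilate A d)⁻¹ = dilate A⁻¹ d := by
  refine Matrix.inv_eq_right_inv ?_
  have : A.1 * A⁻¹.1 = 1 := A.mul_inv
  have h := congrArg (fun U => U.map ((phi F d).comp (laurent F))) this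
  simp only [Matrix.map_mul] at h
  exact h.trans (by ext1; simp [Matrix.one_apply, apply_ite])

theorem dilate_mul_inv (A : GL (Fin m) (RatFunc F)) (d : ℕ) :
    dilate A d * (dilate A d)⁻¹ = 1 := by
  rw [dilate_inv]
  have : A.1 * A⁻¹.1 = 1 := A.mul_inv
  have h := congrArg (fun U => U.map ((phi F d).comp (laurent F))) this
  simp only [Matrix.map_mul] at h
  exact h.trans (by ext1; simp [Matrix.one_apply, apply_ite])

/-- Apply φ_d to both sides: it is injective, commutes with φ_p, fixes constants and turns elements
of F((z^(1/d))) into Laurent series. -/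
theorem equation_iff {d p : ℕ} (hd : d ≠ 0) (hp : p ≠ 0) (A : GL (Fin m) (RatFunc F))
    (Ψ : Matrix (Fin m) (Fin m) (rootField F d)) (Λ : Matrix (Fin m) (Fin m) F) :
    (Ψ.map fun x => phi F p (x : HahnSeries ℚ F)) *
        (Λ.map HahnSeries.C : Matrix (Fin m) (Fin m) (HahnSeries ℚ F)) =
      A.1.map (ratToHahn F) * Ψ.map (fun x => (x : HahnSeries ℚ F)) ↔
    (Ψ.map (rootToLaurent d)).map (phi F p) * constMatrix Λ =
      dilate A d * Ψ.map (rootToLaurent d) := by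
  have hinj1 : Function.Injective fun U : Matrix (Fin m) (Fin m) (HahnSeries ℚ F) =>
      U.map (phi F d) := Matrix.map_injective (phi_injective d)
  have hinj2 : Function.Injective fun U : Matrix (Fin m) (Fin m) (LaurentSeries F) =>
      U.map (laurentToHahn F) := Matrix.map_injective (laurentToHahn F).injective
  rw [← hinj1.eq_iff, ← hinj2.eq_iff]
  simp only [Matrix.map_mul, Matrix.map_map]
  have e1 : (phi F d ∘ fun x : rootField F d => phi F p (x : HahnSeries ℚ F)) =
      laurentToHahn F ∘ phi F p ∘ rootToLaurent d := by
    funext x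
    simp only [Function.comp_apply]
    rw [← phi_laurentToHahn, laurentToHahn_rootToLaurent, phi_phi p d hp hd]
  have e2 : (phi F d ∘ fun x : rootField F d => (x : HahnSeries ℚ F)) =
      laurentToHahn F ∘ rootToLaurent d := by
    funext x
    exact (laurentToHahn_rootToLaurent d x).symm
  have e3 : (A.1.map (phi F d ∘ ratToHahn F)) = (dilate A d).map (laurentToHahn F) := by
    ext1 i j
    exact phi_laurentToHahn d _
  have e4 : Λ.map (phi (Γ := ℚ) F d ∘ HahnSeries.C) = (constMatrix Λ).map (laurentToHahn F) := by
    ext1 i j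
    simp only [Matrix.map_apply, Function.comp_apply, phi_C, constMatrix_apply]
    exact (HahnSeries.embDomainRingHom_C).symm
  rw [e1, e2, e3, e4]

theorem constSystem_map (Λ : GL (Fin m) F) : (constSystem Λ).1.map (ratToHahn F) =
    (Λ.1.map HahnSeries.C : Matrix (Fin m) (Fin m) (HahnSeries ℚ F)) := by
  ext1 i j
  change laurentToHahn F (laurent F (RatFunc.C (Λ.1 i j))) = _
  rw [laurent_C]
  exact HahnSeries.embDomainRingHom_C

theorem isUnit_map_iff {K L : Type*} [Field K] [Field L] (f : K →+* L)
    (U : Matrix (Fin m) (Fin m) K) : IsUnit (U.map f) ↔ IsUnit U := by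
  rw [Matrix.isUnit_iff_isUnit_det, Matrix.isUnit_iff_isUnit_det,
    show U.map f = f.mapMatrix U from rfl, ← RingHom.map_det, isUnit_iff_ne_zero,
    isUnit_iff_ne_zero, _root_.map_ne_zero]

theorem constMatrix_mul {ι κ τ : Type*} [Fintype κ] (U : Matrix ι κ F) (V : Matrix κ τ F) :
    constMatrix (U * V) = constMatrix U * constMatrix V := Matrix.map_mul

theorem constMatrix_one {ι : Type*} [DecidableEq ι] :
    constMatrix (1 : Matrix ι ι F) = 1 := by
  ext1 i j
  simp [constMatrix_apply, Matrix.one_apply, apply_ite]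

/-- A system is equivalent over `F((z ^ (1/d)))` to a constant one iff it has a square frame. -/
theorem isEquivalentToConst_iff {d p : ℕ} (hd : d ≠ 0) (hp : p ≠ 0)
    (A : GL (Fin m) (RatFunc F)) : IsEquivalentToConst (rootField F d) p A ↔
      ∃ (Ψ : Matrix (Fin m) (Fin m) (LaurentSeries F)) (Λ : Matrix (Fin m) (Fin m) F),
        IsUnit Ψ ∧ IsFrame p (dilate A d)⁻¹ Ψ Λ := by
  have hB : (dilate A d)⁻¹ * dilate A d = 1 := mul_eq_one_comm.1 (dilate_mul_inv A d)
  constructor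
  · rintro ⟨Λ, Ψ, h⟩
    rw [constSystem_map, equation_iff hd hp] at h
    -- The frame carries the inverse constant matrix: φ_p(Ψ) Λ = A Ψ is equivalent to A⁻¹ φ_p(Ψ) = Ψ
    -- Λ⁻¹.
    refine ⟨Ψ.1.map (rootToLaurent d), Λ⁻¹.1, (isUnit_map_iff _ _).2 Ψ.isUnit, Λ⁻¹.isUnit, ?_⟩
    have e : constMatrix Λ.1 * constMatrix Λ⁻¹.1 = 1 := by
      rw [← constMatrix_mul, Λ.mul_inv, constMatrix_one]
    calc _ = (dilate A d)⁻¹ * ((Ψ.1.map (rootToLaurent d)).map (phi F p) *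
          (constMatrix Λ.1 * constMatrix Λ⁻¹.1)) := by rw [e, Matrix.mul_one]
      _ = _ := by
        rw [← Matrix.mul_assoc _ (constMatrix Λ.1), h, Matrix.mul_assoc (dilate A d),
          ← Matrix.mul_assoc, hB, Matrix.one_mul]
  · rintro ⟨Ψ, Λ, hΨ, hΛ, h⟩
    choose g hg using fun i j => rootToLaurent_surjective d (Ψ i j)
    have hg' : (Matrix.of g).map (rootToLaurent d) = Ψ := by ext1 i j; exact hg i j
    rw [← hg'] at h hΨ
    rw [isUnit_map_iff] at hΨ
    obtain ⟨v, rfl⟩ := hΛ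
    refine ⟨v⁻¹, hΨ.unit, ?_⟩
    have e : constMatrix v.1 * constMatrix v⁻¹.1 = 1 := by
      rw [← constMatrix_mul, v.mul_inv, constMatrix_one]
    rw [constSystem_map, equation_iff hd hp]
    change ((Matrix.of g).map _).map _ * _ = _ * (Matrix.of g).map _
    calc _ = dilate A d * ((dilate A d)⁻¹ * ((Matrix.of g).map (rootToLaurent d)).map (phi F p)) *
          constMatrix v⁻¹.1 := by
          rw [← Matrix.mul_assoc, dilate_mul_inv, Matrix.one_mul]
      _ = _ := by rw [h, Matrix.mul_assoc, Matrix.mul_assoc, e, Matrix.mul_one]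

/-- The finitely many entries of Ψ have a common root index d, the product of the individual ones.
The constant matrix, a product of invertible matrices, is automatically invertible. -/
theorem isRegularSingular_iff {p : ℕ} (A : GL (Fin m) (RatFunc F)) :
    IsRegularSingular p A ↔ ∃ d : ℕ, d ≠ 0 ∧ IsEquivalentToConst (rootField F d) p A := by
  constructor
  · rintro ⟨Ψ, Λ, h⟩
    choose e he he' using fun i j => (mem_puiseuxField_iff F _).1 (Ψ.1 i j).2
    let d := ∏ ij : Fin m × Fin m, e ij.1 ij.2
    have hd : d ≠ 0 := Finset.prod_ne_zero_iff.2 fun ij _ => by have := he ij.1 ij.2; omega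
    have hmem : ∀ i j, (Ψ.1 i j : HahnSeries ℚ F) ∈ rootField F d := fun i j =>
      rootField_mono F hd (Finset.dvd_prod_of_mem (fun ij : Fin m × Fin m => e ij.1 ij.2)
        (Finset.mem_univ (i, j))) (he' i j)
    let Φ : Matrix (Fin m) (Fin m) (rootField F d) := Matrix.of fun i j => ⟨Ψ.1 i j, hmem i j⟩
    have hΦ : Φ.map (rootField F d).subtype = Ψ.1.map (puiseuxField F).subtype := rfl
    have hΦu : IsUnit Φ := by
      rw [← isUnit_map_iff (rootField F d).subtype, hΦ, isUnit_map_iff]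
      exact Ψ.isUnit
    have h1 : IsUnit (Ψ.1.map fun x => phi F p (x : HahnSeries ℚ F)) :=
      (isUnit_map_iff ((phi F p).comp (puiseuxField F).subtype) Ψ.1).2 Ψ.isUnit
    have h2 : IsUnit (A.1.map (ratToHahn F)) := (isUnit_map_iff _ _).2 A.isUnit
    have h3 : IsUnit (Ψ.1.map fun x => (x : HahnSeries ℚ F)) :=
      (isUnit_map_iff (puiseuxField F).subtype _).2 Ψ.isUnit
    have h4 : IsUnit (Λ.map (HahnSeries.C : F →+* HahnSeries ℚ F)) := by
      rw [← h]
      exact ((Matrix.isUnit_nonsing_inv_iff.2 h1).mul h2).mul h3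
    rw [isUnit_map_iff] at h4
    obtain ⟨v, rfl⟩ := h4
    refine ⟨d, hd, v, hΦu.unit, ?_⟩
    rw [constSystem_map, ← h, ← Matrix.mul_assoc, ← Matrix.mul_assoc]
    change (Ψ.1.map fun x => phi F p (x : HahnSeries ℚ F)) * _ * _ * _ = _
    rw [Matrix.mul_nonsing_inv _ ((Matrix.isUnit_iff_isUnit_det _).1 h1), Matrix.one_mul]
    rfl
  · rintro ⟨d, hd, Λ, Ψ, h⟩
    have hle : rootField F d ≤ puiseuxField F := fun f hf =>
      (mem_puiseuxField_iff F f).2 ⟨d, Nat.pos_of_ne_zero hd, hf⟩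
    refine ⟨Matrix.GeneralLinearGroup.map (Subfield.inclusion hle) Ψ, Λ.1, ?_⟩
    have h1 : IsUnit (Ψ.1.map fun x => phi F p (x : HahnSeries ℚ F)) :=
      (isUnit_map_iff ((phi F p).comp (rootField F d).subtype) Ψ.1).2 Ψ.isUnit
    rw [constSystem_map] at h
    change (Ψ.1.map fun x => phi F p (x : HahnSeries ℚ F))⁻¹ * _ *
      (Ψ.1.map fun x => (x : HahnSeries ℚ F)) = _
    rw [Matrix.mul_assoc, ← h, ← Matrix.mul_assoc,
      Matrix.nonsing_inv_mul _ ((Matrix.isUnit_iff_isUnit_det _).1 h1), Matrix.one_mul]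

theorem coeffMatrix_dilate_eq_zero {d : ℕ} (hd : d ≠ 0) (A : GL (Fin m) (RatFunc F)) (n : ℤ)
    (hn : n < d * val A) : coeffMatrix (dilate A d) n = 0 := by
  ext i j
  change (phi F d (laurent F (A.1 i j))).coeff n = 0
  by_cases h : (d : ℤ) ∣ n
  · obtain ⟨k, rfl⟩ := h
    rw [phi_coeff_mul hd]
    have hk : k < val A := lt_of_mul_lt_mul_left hn (by omega)
    by_contra hne
    have h1 : (laurent F (A.1 i j)).orderTop ≤ k := HahnSeries.orderTop_le_of_coeff_ne_zero hne
    have h2 : (Finset.univ.inf fun ij : Fin m × Fin m =>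
        ((A.1.map (laurent F)) ij.1 ij.2).orderTop) ≤ k :=
      (Finset.inf_le (Finset.mem_univ (i, j))).trans h1
    -- The default value 0 in `v0` plays no role here: a nonzero coefficient makes the minimum
    -- finite.
    obtain ⟨t, ht⟩ := WithTop.ne_top_iff_exists.1 (ne_top_of_le_ne_top WithTop.coe_ne_top h2)
    unfold val v0 at hk
    rw [← ht] at h2 hk
    rw [WithTop.untopD_coe] at hk
    exact absurd (WithTop.coe_le_coe.1 h2) (by omega)
  · exact phi_coeff_of_not_dvd hd _ _ h

variable {p d : ℕ}

/-- This inequality and `bound_nu` are all that the argument uses about the two ceilings. -/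
theorem bound_mu (hp : 2 ≤ p) (A : GL (Fin m) (RatFunc F)) :
    -(d * val A⁻¹) ≤ (p - 1) * mu p A d := by
  have hp' : (0 : ℚ) < (p : ℚ) - 1 := by
    have : (2 : ℚ) ≤ p := by exact_mod_cast hp
    linarith
  have := Int.le_ceil ((-(d * val A⁻¹) : ℚ) / ((p : ℚ) - 1))
  rw [div_le_iff₀ hp'] at this
  have h : ((-(d * val A⁻¹) : ℤ) : ℚ) ≤ (((p - 1) * mu p A d : ℤ) : ℚ) := by
    push_cast; rw [mul_comm ((p : ℚ) - 1)]; exact this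
  exact_mod_cast h

theorem bound_nu (hp : 2 ≤ p) (A : GL (Fin m) (RatFunc F)) :
    (p - 1) * (nu p A d - 1) < d * val A := by
  have hp' : (0 : ℚ) < (p : ℚ) - 1 := by
    have : (2 : ℚ) ≤ p := by exact_mod_cast hp
    linarith
  have := Int.ceil_lt_add_one ((d * val A : ℚ) / ((p : ℚ) - 1))
  rw [← sub_lt_iff_lt_add, lt_div_iff₀ hp'] at this
  have h : (((p - 1) * (nu p A d - 1) : ℤ) : ℚ) < ((d * val A : ℤ) : ℚ) := by
    push_cast; rw [mul_comm ((p : ℚ) - 1)]; exact this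
  exact_mod_cast h

/-- The case distinction in `matN` is vacuous: by `bound_mu`, a row of N can exist only if ν_d <
μ_d. -/
theorem spaceX_eq_windowCore (hp : 2 ≤ p) (A : GL (Fin m) (RatFunc F)) :
    spaceX p A d =
      windowCore p (dilate A d)⁻¹ (d * val A⁻¹ + p * nu p A d) (nu p A d) (mu p A d) := by
  have hN : matN p A d = windowMatrix (Finset.Icc (d * val A⁻¹ + p * nu p A d) (nu p A d - 1))
      (Finset.Icc (nu p A d) (mu p A d)) p (dilate A d)⁻¹ := by
    ext r c
    unfold matN
    split_ifs with h
    · rfl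
    · exfalso
      have h1 := Finset.mem_Icc.1 r.1.2
      have h2 := bound_mu (d := d) hp A
      have hp2 : (2 : ℤ) ≤ p := by exact_mod_cast hp
      nlinarith [mul_le_mul_of_nonneg_left (not_lt.1 h) (by omega : (0 : ℤ) ≤ p - 1)]
  unfold spaceX windowCore core
  rw [hN]
  rfl

theorem finrank_spaceX_of_le (hp : 2 ≤ p) (hd : d ≠ 0) (A : GL (Fin m) (RatFunc F))
    (h : m ≤ Module.finrank F (spaceX p A d)) :
    Module.finrank F (spaceX p A d) = m ∧ IsEquivalentToConst (rootField F d) p A := by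
  rw [spaceX_eq_windowCore hp] at h ⊢
  obtain ⟨h1, Ψ, Λ, h2, h3, -⟩ := exists_isFrame_of_le_finrank hp (b := -(d * val A⁻¹))
    (fun n hn => by rw [dilate_inv]; exact coeffMatrix_dilate_eq_zero hd _ _ (by omega))
    (bound_mu hp A) (by omega) h
  exact ⟨h1, (isEquivalentToConst_iff hd (by omega) A).2 ⟨Ψ, Λ, h3, h2⟩⟩

theorem le_finrank_spaceX (hp : 2 ≤ p) (hd : d ≠ 0) (A : GL (Fin m) (RatFunc F))
    (h : IsEquivalentToConst (rootField F d) p A) : m ≤ Module.finrank F (spaceX p A d) := by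
  obtain ⟨Ψ, Λ, h1, h2⟩ := (isEquivalentToConst_iff hd (by omega) A).1 h
  rw [spaceX_eq_windowCore hp]
  have := h2.le_finrank_windowCore (r := d * val A⁻¹ + p * nu p A d) (lo := nu p A d) hp
    (b := -(d * val A⁻¹))
    (fun n hn => by rw [dilate_inv]; exact coeffMatrix_dilate_eq_zero hd _ _ (by omega))
    (bound_mu hp A) (fun c hc => by
      obtain ⟨v, rfl⟩ := h1
      calc c = (v⁻¹.1 * v.1) * c := by simp
        _ = 0 := by rw [Matrix.mul_assoc, hc, Matrix.mul_zero])
    (h2.coeffMatrix_eq_zero_of_lt hp (dilate_mul_inv A d)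
      (fun n hn => coeffMatrix_dilate_eq_zero hd A n hn) (bound_nu hp A))
  rwa [Fintype.card_fin] at this

end Bridge

/-! ### Subgroups of ℤ/e generated by a set permuted by multiplication by p. -/

section Digits

variable {e : ℕ} [NeZero e] {p : ℕ}

/-- Carrying: p copies of t are worth one copy of p t, which is again in S. Each carry lowers the
total number of copies by p - 1 > 0, so the process ends with digits below p. -/
theorem exists_digits (hp : 2 ≤ p) (S : Finset (ZMod e)) (hS : ∀ s ∈ S, (p : ZMod e) * s ∈ S)
    (n : ZMod e → ℕ) : ∃ n' : ZMod e → ℕ, (∀ s ∈ S, n' s < p) ∧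
      ∑ s ∈ S, n' s • s = ∑ s ∈ S, n s • s := by
  induction hN : ∑ s ∈ S, n s using Nat.strong_induction_on generalizing n with
  | _ N ih =>
    subst hN
    by_cases h : ∀ s ∈ S, n s < p
    · exact ⟨n, h, rfl⟩
    push Not at h
    obtain ⟨t, ht, hpt⟩ := h
    let k : ZMod e → ℕ := fun s => if s = t then n t - p else n s
    let n₁ : ZMod e → ℕ := fun s => k s + if s = p * t then 1 else 0
    have hk : ∀ s, n s = k s + if s = t then p else 0 := fun s => by
      by_cases hs : s = t
      · subst hs; simp [k]; omega
      · simp [k, hs]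
    have h1 : ∑ s ∈ S, n₁ s • s = ∑ s ∈ S, n s • s := by
      simp only [n₁, hk, add_smul, Finset.sum_add_distrib, ite_smul, zero_smul, one_smul,
        Finset.sum_ite_eq', ht, hS t ht, if_true, nsmul_eq_mul]
    have h2 : ∑ s ∈ S, n₁ s < ∑ s ∈ S, n s := by
      simp only [n₁, hk, Finset.sum_add_distrib, Finset.sum_ite_eq', ht, hS t ht, if_true]
      omega
    obtain ⟨n', h3, h4⟩ := ih _ h2 n₁ rfl
    exact ⟨n', h3, h4.trans h1⟩

theorem exists_nat_combination (S : Finset (ZMod e)) (x : ZMod e)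
    (hx : x ∈ AddSubgroup.closure (S : Set (ZMod e))) :
    ∃ n : ZMod e → ℕ, ∑ s ∈ S, n s • s = x := by
  classical
  induction hx using AddSubgroup.closure_induction with
  | mem x hx => exact ⟨fun s => if s = x then 1 else 0, by
    simp only [ite_smul, one_smul, zero_smul, Finset.sum_ite_eq', if_pos (Finset.mem_coe.1 hx)]⟩
  | zero => exact ⟨0, by simp⟩
  | add x y _ _ hx hy =>
    obtain ⟨n, rfl⟩ := hx
    obtain ⟨k, rfl⟩ := hy
    exact ⟨n + k, by simp [add_mul, Finset.sum_add_distrib]⟩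
  | neg x _ hx =>
    obtain ⟨n, rfl⟩ := hx
    -- Negatives need no negative coefficients, since -1 = e - 1 modulo e.
    refine ⟨fun s => (e - 1) * n s, ?_⟩
    have he : 1 ≤ e := Nat.one_le_iff_ne_zero.2 (NeZero.ne e)
    simp only [nsmul_eq_mul, Nat.cast_mul, Nat.cast_sub he, CharP.cast_eq_zero, Nat.cast_one,
      zero_sub, neg_mul, one_mul, Finset.sum_neg_distrib]

/-- Digit vectors with entries below p represent every element of the subgroup, which gives at most
p^|S| elements. The vector of all digits p - 1 represents p ∑ s - ∑ s = 0, because p permutes S, and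
so does the zero vector; this saves one. -/
theorem card_closure_le (hp : 2 ≤ p) (S : Finset (ZMod e))
    (hS : S.image (fun s => (p : ZMod e) * s) = S) {m : ℕ} (hm : 1 ≤ m) (hSm : S.card ≤ m) :
    Nat.card (AddSubgroup.closure (S : Set (ZMod e))) ≤ p ^ m - 1 := by
  classical
  have hpm : p ^ 1 ≤ p ^ m := Nat.pow_le_pow_right (by omega) hm
  -- For empty S the zero vector and the top vector coincide, so the count below would fail; the
  -- subgroup is then trivial and p ^ m - 1 ≥ 1.
  rcases S.eq_empty_or_nonempty with rfl | hne
  · rw [Finset.coe_empty, AddSubgroup.closure_empty, AddSubgroup.card_bot]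
    rw [pow_one] at hpm
    omega
  have hpS : p ^ S.card ≤ p ^ m := Nat.pow_le_pow_right (by omega) hSm
  have hmem : ∀ s ∈ S, (p : ZMod e) * s ∈ S := fun s hs => by
    rw [← hS]; exact Finset.mem_image_of_mem _ hs
  let top : S → Fin p := fun _ => ⟨p - 1, by omega⟩
  let D := {n : S → Fin p // n ≠ top}
  have hmemH : ∀ n : S → Fin p, ∑ s : S, (n s : ℕ) • s.1 ∈ AddSubgroup.closure (S : Set (ZMod e)) :=
    fun n => AddSubgroup.sum_mem _ fun s _ =>
      AddSubgroup.nsmul_mem _ (AddSubgroup.subset_closure s.2) _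
  let g : D → AddSubgroup.closure (S : Set (ZMod e)) := fun n => ⟨_, hmemH n.1⟩
  have hinj : Set.InjOn (fun s => (p : ZMod e) * s) S := by
    rw [← Finset.card_image_iff, hS]
  have htop : ∑ s : S, ((top s : Fin p) : ℕ) • s.1 = 0 := by
    have h1 : ∑ s ∈ S, (p : ZMod e) * s = ∑ s ∈ S, s := by
      conv_rhs => rw [← hS]
      rw [Finset.sum_image hinj]
    rw [Finset.sum_coe_sort S fun s => (p - 1) • s]
    simp only [nsmul_eq_mul, Nat.cast_sub (by omega : 1 ≤ p), sub_mul, Nat.cast_one, one_mul,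
      Finset.sum_sub_distrib, h1, sub_self]
  have hsurj : Function.Surjective g := by
    rintro ⟨x, hx⟩
    obtain ⟨n, rfl⟩ := exists_nat_combination S x hx
    obtain ⟨n', h1, h2⟩ := exists_digits hp S hmem n
    let d : S → Fin p := fun s => ⟨n' s, h1 s s.2⟩
    have hd : ∑ s : S, (d s : ℕ) • s.1 = ∑ s ∈ S, n s • s := by
      rw [← h2]; exact Finset.sum_coe_sort S fun s => n' s • s
    by_cases hdt : d = top
    · refine ⟨⟨fun _ => ⟨0, by omega⟩, fun h => ?_⟩, Subtype.ext ?_⟩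
      · obtain ⟨s, hs⟩ := hne
        have := congrArg Fin.val (congrFun h ⟨s, hs⟩)
        simp only [top] at this
        omega
      · rw [hdt, htop] at hd
        change _ = ∑ s ∈ S, n s • s
        rw [← hd]
        simp [g]
    · exact ⟨⟨d, hdt⟩, Subtype.ext hd⟩
  have h1 := Nat.card_le_card_of_surjective g hsurj
  have h2 : Nat.card D = p ^ S.card - 1 := by
    rw [Nat.card_eq_fintype_card, Fintype.card_subtype_compl, Fintype.card_subtype_eq]
    simp
  omega

/-- Multiplication by p maps the generators onto themselves, so it is surjective, hence injective,
on this finite group. A prime dividing both p and the order would give, by Cauchy's theorem, a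
nonzero element killed by p. -/
theorem coprime_card_closure (S : Finset (ZMod e))
    (hS : S.image (fun s => (p : ZMod e) * s) = S) :
    Nat.gcd (Nat.card (AddSubgroup.closure (S : Set (ZMod e)))) p = 1 := by
  classical
  set H := AddSubgroup.closure (S : Set (ZMod e)) with hH
  have hmap : H.map (AddMonoidHom.mulLeft (p : ZMod e)) = H := by
    rw [hH, AddMonoidHom.map_closure]
    congr 1
    conv_rhs => rw [← hS]
    simp
  let g : H → H := fun x => ⟨p * x.1, by
    have := AddSubgroup.mem_map_of_mem (AddMonoidHom.mulLeft (p : ZMod e)) x.2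
    rwa [hmap] at this⟩
  have hsurj : Function.Surjective g := by
    rintro ⟨x, hx⟩
    rw [← hmap] at hx
    obtain ⟨y, hy, rfl⟩ := hx
    exact ⟨⟨y, hy⟩, rfl⟩
  have hinj : Function.Injective g := Finite.injective_iff_surjective.2 hsurj
  by_contra hne
  obtain ⟨q, hq, hqd⟩ := Nat.exists_prime_and_dvd hne
  have : Fact q.Prime := ⟨hq⟩
  obtain ⟨x, hx⟩ := exists_prime_addOrderOf_dvd_card' q (hqd.trans (Nat.gcd_dvd_left _ _))
  have h0 : g x = g 0 := by
    have : p • x = 0 := by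
      rw [← addOrderOf_dvd_iff_nsmul_eq_zero, hx]
      exact hqd.trans (Nat.gcd_dvd_right _ _)
    have h2 : (p • x : H).1 = 0 := by rw [this]; rfl
    refine Subtype.ext ?_
    simp only [g, ZeroMemClass.coe_zero, mul_zero]
    simpa using h2
  rw [hinj h0, addOrderOf_zero] at hx
  exact hq.one_lt.ne hx

end Digits

/-! ### Grading by exponents modulo e and the bound p ^ m - 1 for d. -/

section Graded

variable {F : Type*} [Field F] {m p e : ℕ}

/-- The operator `f ↦ B φ_p(f)`. -/
def mahlerMap (p : ℕ) (B : Matrix (Fin m) (Fin m) (LaurentSeries F)) :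
    (Fin m → LaurentSeries F) →ₗ[F] (Fin m → LaurentSeries F) where
  toFun f := B.mulVec fun i => phi F p (f i)
  map_add' f g := by
    rw [← Matrix.mulVec_add]
    congr 1
    funext i
    simp
  map_smul' c f := by
    funext i
    simp only [Matrix.mulVec, dotProduct, Pi.smul_apply, RingHom.id_apply,
      ← HahnSeries.C_mul_eq_smul, map_mul, phi_C, Finset.mul_sum]
    exact Finset.sum_congr rfl fun _ _ => mul_left_comm _ _ _

/-- A finite-dimensional space on which `f ↦ B φ_p(f)` is invertible has dimension at most `m`. -/
theorem finrank_le_of_map_mahlerMap_eq (hp : 2 ≤ p)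
    (B : Matrix (Fin m) (Fin m) (LaurentSeries F)) (V : Submodule F (Fin m → LaurentSeries F))
    [FiniteDimensional F V] (hV : V.map (mahlerMap p B) = V) : Module.finrank F V ≤ m := by
  let b := Module.finBasis F V
  have hmem : ∀ x ∈ V, mahlerMap p B x ∈ V := fun x hx => by
    have := Submodule.mem_map_of_mem (f := mahlerMap p B) hx
    rwa [hV] at this
  let g : V →ₗ[F] V := (mahlerMap p B).restrict hmem
  have hsurj : Function.Surjective g := by
    rintro ⟨x, hx⟩
    rw [← hV] at hx
    obtain ⟨y, hy, rfl⟩ := hx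
    exact ⟨⟨y, hy⟩, rfl⟩
  let Ψ : Matrix (Fin m) (Fin (Module.finrank F V)) (LaurentSeries F) :=
    Matrix.of fun i k => (b k).1 i
  -- A basis of V is a frame, so the independence of its columns over the Laurent series field
  -- bounds their number by m.
  have hframe : IsFrame p B Ψ (LinearMap.toMatrix b b g) := by
    constructor
    · rw [LinearMap.isUnit_toMatrix_iff, Module.End.isUnit_iff]
      exact ⟨LinearMap.injective_iff_surjective.2 hsurj, hsurj⟩
    · ext1 i k
      have h1 : (g (b k)).1 i =
          (∑ l, (LinearMap.toMatrix b b g : Matrix _ _ F) l k • b l : V).1 i := by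
        simp only [LinearMap.toMatrix_apply, b.sum_repr]
      have h2 : (g (b k)).1 i = (B * Ψ.map (phi F p)) i k := rfl
      rw [← h2, h1]
      simp only [Matrix.mul_apply, Ψ, Matrix.of_apply, AddSubmonoidClass.coe_finsetSum,
        Submodule.coe_smul, Finset.sum_apply, Pi.smul_apply, constMatrix_apply]
      refine Finset.sum_congr rfl fun l _ => ?_
      rw [mul_comm, HahnSeries.C_mul_eq_smul]
  obtain ⟨n, hn⟩ := exists_coeffMatrix_eq_zero B
  have hp2 : (2 : ℤ) ≤ p := by exact_mod_cast hp
  -- With b = -n, the requirement is b ≤ (p - 1) hi; as p ≥ 2, hi = max b 0 satisfies it.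
  have hinj := hframe.eq_zero_of_mul_eq_zero hp (hi := max (-n) 0) fun x hx => by
    have h0 := hframe.mulVec_eq_zero hp (b := -n) (by simpa using hn) (by
      have h1 := le_max_left (-n) 0
      have h2 := le_max_right (-n) 0
      nlinarith) x hx
    have h1 : (∑ k, x k • b k : V) = 0 := by
      refine Subtype.ext (funext fun i => ?_)
      ext j
      have := congrFun (h0 j) i
      simp only [Matrix.mulVec, dotProduct, coeffMatrix_apply, Ψ, Matrix.of_apply] at this
      simp only [AddSubmonoidClass.coe_finsetSum, Submodule.coe_smul, Finset.sum_apply,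
        Pi.smul_apply, HahnSeries.coeff_sum, HahnSeries.coeff_smul, smul_eq_mul]
      rw [← Finset.sum_congr rfl fun k _ => mul_comm _ _]
      exact this
    funext k
    exact Fintype.linearIndependent_iff.1 b.linearIndependent x h1 k
  have := card_le_of_mul_injective hinj
  rwa [Fintype.card_fin] at this

/-- The part of a Laurent series with the exponents whose class modulo `e` belongs to `Q`. -/
def gradedPart (Q : Set (ZMod e)) : LaurentSeries F →ₗ[F] LaurentSeries F := by
  classical
  exact
  { toFun := fun f => ⟨fun n => if (n : ZMod e) ∈ Q then f.coeff n else 0,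
      f.isPWO_support.mono fun n hn hn0 => hn (by simp [hn0])⟩
    map_add' := fun f g => by
      ext n
      simp only [HahnSeries.coeff_add]
      split_ifs <;> simp
    map_smul' := fun c f => by
      ext n
      simp }

open scoped Classical in
theorem gradedPart_coeff (Q : Set (ZMod e)) (f : LaurentSeries F) (n : ℤ) :
    (gradedPart Q f).coeff n = if (n : ZMod e) ∈ Q then f.coeff n else 0 := by
  unfold gradedPart
  simp

theorem gradedPart_phi (hp : p ≠ 0) (Q : Set (ZMod e)) (f : LaurentSeries F) :
    gradedPart Q (phi F p f) = phi F p (gradedPart {s | (p : ZMod e) * s ∈ Q} f) := by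
  classical
  ext n
  rw [gradedPart_coeff]
  by_cases hd : (p : ℤ) ∣ n
  · obtain ⟨k, rfl⟩ := hd
    rw [phi_coeff_mul hp, phi_coeff_mul hp, gradedPart_coeff]
    simp
  · rw [phi_coeff_of_not_dvd hp _ _ hd, phi_coeff_of_not_dvd hp _ _ hd, ite_self]

theorem gradedPart_mul (Q : Set (ZMod e)) (g f : LaurentSeries F)
    (hg : ∀ n, ¬ (e : ℤ) ∣ n → g.coeff n = 0) :
    gradedPart Q (g * f) = g * gradedPart Q f := by
  classical
  ext n
  have hs : (gradedPart Q f).support ⊆ f.support := fun n hn hn0 => hn (by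
    rw [gradedPart_coeff, hn0, ite_self])
  have key : ∀ ij ∈ Finset.antidiagonal g.isPWO_support f.isPWO_support n,
      g.coeff ij.1 * (gradedPart Q f).coeff ij.2 =
        if (n : ZMod e) ∈ Q then g.coeff ij.1 * f.coeff ij.2 else 0 := fun ij hij => by
    rw [Finset.mem_antidiagonal] at hij
    have hd : (e : ℤ) ∣ ij.1 := by
      by_contra h
      exact hij.1 (hg _ h)
    have h2 : (n : ZMod e) = (ij.2 : ZMod e) := by
      rw [← hij.2.2, Int.cast_add, (ZMod.intCast_zmod_eq_zero_iff_dvd _ _).2 hd, zero_add]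
    rw [gradedPart_coeff, h2]
    split_ifs <;> simp
  rw [gradedPart_coeff, HahnSeries.coeff_mul_right' f.isPWO_support hs, HahnSeries.coeff_mul,
    Finset.sum_congr rfl key]
  split_ifs <;> simp

/-- Multiplication by B preserves residue classes modulo e because B only has exponents divisible by
e, and φ_p multiplies the classes by p. -/
theorem gradedPart_mahlerMap (hp : p ≠ 0) (Q : Set (ZMod e))
    (B : Matrix (Fin m) (Fin m) (LaurentSeries F))
    (hB : ∀ n, ¬ (e : ℤ) ∣ n → coeffMatrix B n = 0) (f : Fin m → LaurentSeries F) :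
    (gradedPart Q).compLeft (Fin m) (mahlerMap p B f) =
      mahlerMap p B ((gradedPart {s | (p : ZMod e) * s ∈ Q}).compLeft (Fin m) f) := by
  funext i
  simp only [LinearMap.compLeft_apply, Function.comp_apply, mahlerMap, LinearMap.coe_mk,
    AddHom.coe_mk, Matrix.mulVec, dotProduct, map_sum]
  refine Finset.sum_congr rfl fun l _ => ?_
  rw [gradedPart_mul Q _ _ fun n hn => congrFun (congrFun (hB n hn) i) l, gradedPart_phi hp]

/-- The exponents modulo `e` that occur in a space on which `f ↦ B φ_p(f)` is invertible are
permuted by the multiplication by `p`, and there are at most `m` of them. -/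
theorem exists_exponents (hp : 2 ≤ p) [NeZero e]
    (B : Matrix (Fin m) (Fin m) (LaurentSeries F))
    (hB : ∀ n, ¬ (e : ℤ) ∣ n → coeffMatrix B n = 0) (V : Submodule F (Fin m → LaurentSeries F))
    [FiniteDimensional F V] (hV : V.map (mahlerMap p B) = V) :
    ∃ S : Finset (ZMod e), S.image (fun s => (p : ZMod e) * s) = S ∧ S.card ≤ m ∧
      ∀ f ∈ V, ∀ i n, (f i).coeff n ≠ 0 → (n : ZMod e) ∈ S := by
  classical
  have hp0 : p ≠ 0 := by omega
  let π : Set (ZMod e) → (Fin m → LaurentSeries F) →ₗ[F] (Fin m → LaurentSeries F) :=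
    fun Q => (gradedPart Q).compLeft (Fin m)
  have hπ : ∀ Q f i n, (π Q f i).coeff n = if (n : ZMod e) ∈ Q then (f i).coeff n else 0 :=
    fun Q f i n => gradedPart_coeff Q (f i) n
  let S : Finset (ZMod e) := Finset.univ.filter fun s => ∃ f ∈ V, ∃ i n, (f i).coeff n ≠ 0 ∧
    (n : ZMod e) = s
  have hS : ∀ f ∈ V, ∀ i n, (f i).coeff n ≠ 0 → (n : ZMod e) ∈ S := fun f hf i n hn =>
    Finset.mem_filter.2 ⟨Finset.mem_univ _, f, hf, i, n, hn, rfl⟩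
  -- A nonzero component of class r in the image of V comes from a nonzero component of some class s
  -- with p s = r. This gives S ⊆ p S, and equality follows by counting.
  have hsub : S ⊆ S.image fun s => (p : ZMod e) * s := by
    intro r hr
    obtain ⟨-, f, hf, i, n, hn, rfl⟩ := Finset.mem_filter.1 hr
    rw [← hV] at hf
    obtain ⟨g, hg, rfl⟩ := hf
    have h1 : π {(n : ZMod e)} (mahlerMap p B g) ≠ 0 := fun h => hn (by
      have := hπ {(n : ZMod e)} (mahlerMap p B g) i n
      rw [h] at this
      simpa using this.symm)
    have h2 := gradedPart_mahlerMap hp0 {(n : ZMod e)} B hB g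
    have h3 : π {s | (p : ZMod e) * s ∈ ({(n : ZMod e)} : Set (ZMod e))} g ≠ 0 := fun h => by
      refine h1 (h2.trans ?_)
      exact (congrArg (mahlerMap p B) h).trans (map_zero _)
    obtain ⟨l, hl⟩ := Function.ne_iff.1 h3
    obtain ⟨k, hk⟩ : ∃ k, (π {s | (p : ZMod e) * s ∈ ({(n : ZMod e)} : Set (ZMod e))} g l).coeff k
        ≠ 0 := by
      by_contra! h
      exact hl (by ext k; exact h k)
    rw [hπ] at hk
    split_ifs at hk with h
    · exact Finset.mem_image.2 ⟨k, hS g hg l k hk, h⟩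
    · exact absurd rfl hk
  have himg : S.image (fun s => (p : ZMod e) * s) = S :=
    (Finset.eq_of_subset_of_card_le hsub Finset.card_image_le).symm
  have hinj : Set.InjOn (fun s => (p : ZMod e) * s) S := by
    rw [← Finset.card_image_iff, himg]
  refine ⟨S, himg, ?_, hS⟩
  have hzero : ∀ s ∉ S, ∀ g ∈ V, π {s} g = 0 := fun s hs g hg => by
    funext i
    ext n
    rw [hπ]
    split_ifs with h
    · by_contra hne
      exact hs (by rw [← Set.mem_singleton_iff.1 h]; exact hS g hg i n hne)
    · rfl
  -- Several classes of ℤ/e may be multiplied to p s, but among those in S only s is, and elements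
  -- of V have no other classes.
  have hcomm : ∀ s ∈ S, ∀ g ∈ V, π {(p : ZMod e) * s} (mahlerMap p B g) =
      mahlerMap p B (π {s} g) := fun s hs g hg => by
    refine (gradedPart_mahlerMap hp0 _ B hB g).trans (congrArg _ ?_)
    funext i
    ext n
    refine (hπ _ g i n).trans ((hπ _ g i n).trans ?_).symm
    by_cases h0 : (g i).coeff n = 0
    · simp [h0]
    · have hn := hS g hg i n h0
      have : (n : ZMod e) ∈ ({s} : Set (ZMod e)) ↔
          (n : ZMod e) ∈ {t | (p : ZMod e) * t ∈ ({(p : ZMod e) * s} : Set (ZMod e))} :=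
        ⟨fun h => by rw [Set.mem_singleton_iff.1 h]; rfl, fun h => hinj hn hs h⟩
      by_cases hm : (n : ZMod e) ∈ ({s} : Set (ZMod e))
      · rw [if_pos hm, if_pos (this.1 hm)]
      · rw [if_neg hm, if_neg (mt this.2 hm)]
  -- V need not be stable under the grading, so it is replaced by the span W of its homogeneous
  -- components, which the operator still maps onto itself; hence dim W ≤ m. Choosing one nonzero
  -- homogeneous vector for each class in S gives |S| independent vectors of W.
  let W : Submodule F (Fin m → LaurentSeries F) := ⨆ s : ZMod e, V.map (π {s})
  have hW : W.map (mahlerMap p B) = W := by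
    refine le_antisymm ?_ ?_
    · rw [Submodule.map_iSup]
      refine iSup_le fun s => ?_
      rintro _ ⟨_, ⟨g, hg, rfl⟩, rfl⟩
      by_cases hs : s ∈ S
      · rw [← hcomm s hs g hg]
        refine Submodule.mem_iSup_of_mem ((p : ZMod e) * s) ⟨_, ?_, rfl⟩
        rw [← hV]
        exact ⟨g, hg, rfl⟩
      · rw [hzero s hs g hg, map_zero]
        exact zero_mem _
    · refine iSup_le fun r => ?_
      rintro _ ⟨f, hf, rfl⟩
      by_cases hr : r ∈ S
      · rw [← himg] at hr
        obtain ⟨s, hs, rfl⟩ := Finset.mem_image.1 hr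
        rw [SetLike.mem_coe, ← hV] at hf
        obtain ⟨g, hg, rfl⟩ := hf
        refine ⟨π {s} g, Submodule.mem_iSup_of_mem s ⟨g, hg, rfl⟩, (hcomm s hs g hg).symm⟩
      · rw [hzero r hr f hf]
        exact zero_mem _
  have hchoice : ∀ s : S, ∃ w : Fin m → LaurentSeries F, w ∈ W ∧ w ≠ 0 ∧ π {s.1} w = w ∧
      ∀ t ≠ s.1, π {t} w = 0 := fun s => by
    obtain ⟨-, f, hf, i, n, hn, hns⟩ := Finset.mem_filter.1 s.2
    refine ⟨π {s.1} f, Submodule.mem_iSup_of_mem s.1 ⟨f, hf, rfl⟩, fun h => hn ?_, ?_, ?_⟩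
    · have := hπ {s.1} f i n
      rw [h, if_pos (Set.mem_singleton_iff.2 hns)] at this
      exact this.symm
    · funext i
      ext n
      rw [hπ, hπ]
      split_ifs <;> rfl
    · intro t ht
      funext i
      ext n
      rw [hπ, hπ]
      split_ifs with h1 h2
      · exact absurd (h1.symm.trans h2) ht
      · rfl
      · rfl
  choose w hwW hw0 hws hwt using hchoice
  have hli : LinearIndependent F fun s : S => (⟨w s, hwW s⟩ : W) := by
    rw [Fintype.linearIndependent_iff]
    intro c hc s
    have h1 : ∑ t : S, c t • w t = 0 := by
      have := congrArg Subtype.val hc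
      simpa using this
    have h2 := congrArg (π {s.1}) h1
    rw [map_sum, map_zero, Finset.sum_eq_single s] at h2
    · rw [map_smul, hws] at h2
      exact (smul_eq_zero.1 h2).resolve_right (hw0 s)
    · intro t _ hts
      rw [map_smul, hwt t s.1 (fun h => hts (Subtype.ext h.symm)), smul_zero]
    · intro h
      exact absurd (Finset.mem_univ _) h
  have h1 := hli.fintype_card_le_finrank
  rw [Fintype.card_coe] at h1
  exact h1.trans (finrank_le_of_map_mahlerMap_eq hp B W hW)

theorem exists_phi_eq {c : ℕ} (hc : c ≠ 0) (f : LaurentSeries F)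
    (hf : ∀ n, f.coeff n ≠ 0 → (c : ℤ) ∣ n) : ∃ g, phi F c g = f := by
  have hbdd : BddBelow (Function.support fun n : ℤ => f.coeff (c * n)) := by
    refine ⟨-|f.order|, fun n hn => ?_⟩
    by_contra h
    have h1 : f.order ≤ c * n := HahnSeries.order_le_of_coeff_ne_zero hn
    have h2 : (1 : ℤ) ≤ c := by exact_mod_cast Nat.one_le_iff_ne_zero.2 hc
    have h3 := neg_abs_le f.order
    have h4 := abs_nonneg f.order
    nlinarith
  refine ⟨HahnSeries.ofSuppBddBelow _ hbdd, ?_⟩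
  ext n
  by_cases hd : (c : ℤ) ∣ n
  · rw [phi_coeff_of_dvd hc _ _ hd, HahnSeries.coeff_ofSuppBddBelow, Int.mul_ediv_cancel' hd]
  · rw [phi_coeff_of_not_dvd hc _ _ hd]
    by_contra h
    exact hd (hf n (Ne.symm h))

theorem phi_mul_laurent {a c : ℕ} (ha : a ≠ 0) (hc : c ≠ 0) (f : LaurentSeries F) :
    phi F a (phi F c f) = phi F (a * c) f := by
  ext n
  by_cases hd : (a : ℤ) ∣ n
  · obtain ⟨k, rfl⟩ := hd
    rw [phi_coeff_mul ha]
    by_cases hk : (c : ℤ) ∣ k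
    · obtain ⟨l, rfl⟩ := hk
      have := phi_coeff_mul (mul_ne_zero ha hc) f l
      push_cast at this
      rw [phi_coeff_mul hc, ← mul_assoc, this]
    · rw [phi_coeff_of_not_dvd hc _ _ hk, phi_coeff_of_not_dvd (mul_ne_zero ha hc)]
      push_cast
      rwa [mul_dvd_mul_iff_left (by exact_mod_cast ha)]
  · rw [phi_coeff_of_not_dvd ha _ _ hd, phi_coeff_of_not_dvd (mul_ne_zero ha hc)]
    push_cast
    exact fun h => hd (dvd_of_mul_right_dvd h)

/-- A regular singular system is equivalent to a constant one over `F((z ^ (1/d)))` for some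
`1 ≤ d ≤ p ^ m - 1` coprime to `p`. -/
theorem exists_mem_setD (hp : 2 ≤ p) (hm : 1 ≤ m) (A : GL (Fin m) (RatFunc F))
    (h : IsRegularSingular p A) :
    ∃ d ∈ setD p m, IsEquivalentToConst (rootField F d) p A := by
  classical
  have hp0 : p ≠ 0 := by omega
  obtain ⟨e, he, h1⟩ := (isRegularSingular_iff A).1 h
  obtain ⟨Ψ, Λ, hΨ, hframe⟩ := (isEquivalentToConst_iff he hp0 A).1 h1
  have : NeZero e := ⟨he⟩
  have hB : ∀ n, ¬ (e : ℤ) ∣ n → coeffMatrix (dilate A e)⁻¹ n = 0 := fun n hn => by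
    rw [dilate_inv]
    ext i j
    exact phi_coeff_of_not_dvd he _ _ hn
  let col : Fin m → (Fin m → LaurentSeries F) := fun k i => Ψ i k
  let V := Submodule.span F (Set.range col)
  have : FiniteDimensional F V := FiniteDimensional.span_of_finite F (Set.finite_range _)
  obtain ⟨v, hv⟩ := hframe.isUnit
  have hcol : ∀ k, mahlerMap p (dilate A e)⁻¹ (col k) = ∑ l, Λ l k • col l := fun k => by
    funext i
    have := congrFun (congrFun hframe.eq i) k
    refine (show _ = ((dilate A e)⁻¹ * Ψ.map (phi F p)) i k from rfl).trans (this.trans ?_)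
    simp only [Matrix.mul_apply, constMatrix_apply, Finset.sum_apply, Pi.smul_apply, col]
    refine Finset.sum_congr rfl fun l _ => ?_
    rw [mul_comm, HahnSeries.C_mul_eq_smul]
  have hV : V.map (mahlerMap p (dilate A e)⁻¹) = V := by
    refine le_antisymm ?_ ?_
    · rw [Submodule.map_span, Submodule.span_le]
      rintro _ ⟨_, ⟨k, rfl⟩, rfl⟩
      rw [hcol]
      exact Submodule.sum_mem _ fun l _ =>
        Submodule.smul_mem _ _ (Submodule.subset_span ⟨l, rfl⟩)
    · rw [Submodule.span_le]
      rintro _ ⟨k, rfl⟩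
      refine ⟨∑ l, v⁻¹.1 l k • col l, Submodule.sum_mem _ fun l _ =>
        Submodule.smul_mem _ _ (Submodule.subset_span ⟨l, rfl⟩), ?_⟩
      rw [map_sum]
      simp only [map_smul, hcol, Finset.smul_sum, smul_smul]
      rw [Finset.sum_comm]
      have e1 : ∀ j, ∑ l, v⁻¹.1 l k * Λ j l = if j = k then 1 else 0 := fun j => by
        have : (v.1 * v⁻¹.1) j k = (1 : Matrix (Fin m) (Fin m) F) j k := by rw [v.mul_inv]
        rw [Matrix.mul_apply, hv, Matrix.one_apply] at this
        rw [← this]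
        exact Finset.sum_congr rfl fun l _ => mul_comm _ _
      simp only [← Finset.sum_smul, e1, ite_smul, one_smul, zero_smul, Finset.sum_ite_eq',
        Finset.mem_univ, if_true]
  obtain ⟨S, hS, hcard, hsupp⟩ := exists_exponents hp _ hB V hV
  -- The sought d is |H|. With e = d c, every exponent n of Ψ satisfies d n ≡ 0 modulo e, so c
  -- divides n. Dividing all exponents by c turns the frame for z^(1/e) into one for z^(1/d).
  set H := AddSubgroup.closure (S : Set (ZMod e)) with hH
  have hHe : Nat.card H ∣ e := by
    have := AddSubgroup.card_addSubgroup_dvd_card H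
    rwa [Nat.card_zmod] at this
  have hd0 : Nat.card H ≠ 0 := fun h0 => he (by rw [h0] at hHe; exact zero_dvd_iff.1 hHe)
  refine ⟨Nat.card H, ⟨Nat.pos_of_ne_zero hd0, card_closure_le hp S hS hm hcard,
    coprime_card_closure S hS⟩, ?_⟩
  obtain ⟨c, hc⟩ := hHe
  set d := Nat.card H with hd
  have hc0 : c ≠ 0 := by rintro rfl; exact he (by rw [hc, mul_zero])
  have hexp : ∀ i k, ∃ g, phi F c g = Ψ i k := fun i k => by
    refine exists_phi_eq hc0 _ fun n hn => ?_
    have h2 : (n : ZMod e) ∈ S := hsupp (col k) (Submodule.subset_span ⟨k, rfl⟩) i n hn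
    have h3 : d • (⟨(n : ZMod e), AddSubgroup.subset_closure h2⟩ : H) = 0 := by
      rw [hd]; exact card_nsmul_eq_zero'
    have h4 : ((d * n : ℤ) : ZMod e) = 0 := by
      have := congrArg Subtype.val h3
      push_cast
      simpa using this
    rw [ZMod.intCast_zmod_eq_zero_iff_dvd, hc] at h4
    push_cast at h4
    exact (mul_dvd_mul_iff_left (by exact_mod_cast hd0)).1 h4
  choose g hg using hexp
  have hg' : (Matrix.of g).map (phi F c) = Ψ := by ext1 i j; exact hg i j
  have hA : (dilate A d)⁻¹.map (phi F c) = (dilate A e)⁻¹ := by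
    rw [dilate_inv, dilate_inv]
    ext1 i j
    change phi F c (phi F d _) = phi F e _
    rw [phi_mul_laurent hc0 hd0, hc, mul_comm]
  refine (isEquivalentToConst_iff hd0 hp0 A).2 ⟨Matrix.of g, Λ, ?_, hframe.isUnit, ?_⟩
  · rw [← isUnit_map_iff (phi F c), hg']
    exact hΨ
  · refine Matrix.map_injective (phi_injective c) ?_
    change Matrix.map _ (phi F c) = Matrix.map _ (phi F c)
    rw [Matrix.map_mul, Matrix.map_mul, hA, hg', map_phi_constMatrix, ← hframe.eq, ← hg']
    congr 1
    ext1 i j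
    change phi F c (phi F p _) = phi F p (phi F c _)
    rw [phi_mul_laurent hc0 hp0, phi_mul_laurent hp0 hc0, mul_comm]

/-- The criterion for regular singularity, and its refinement. -/
theorem isRegularSingular_iff_exists (hp : 2 ≤ p) (hm : 1 ≤ m) (A : GL (Fin m) (RatFunc F)) :
    IsRegularSingular p A ↔ ∃ d ∈ setD p m, m ≤ Module.finrank F (spaceX p A d) := by
  constructor
  · intro h
    obtain ⟨d, hd, h1⟩ := exists_mem_setD hp hm A h
    exact ⟨d, hd, le_finrank_spaceX hp (Nat.one_le_iff_ne_zero.1 hd.1) A h1⟩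
  · rintro ⟨d, hd, h⟩
    have hd0 := Nat.one_le_iff_ne_zero.1 hd.1
    exact (isRegularSingular_iff A).2 ⟨d, hd0, (finrank_spaceX_of_le hp hd0 A h).2⟩

end Graded

/-! ### Matrix factorizations bounding the dimension of the core from above. -/

section Factorization

variable {F : Type*} [Field F] {ι κ : Type*} [Fintype ι] [DecidableEq ι] [Fintype κ]

/-- Some power `M ^ n` and the matrices `N`, `N M`, … have the property that `M ^ n` maps the
common kernel of the latter into the core. -/
theorem exists_pow_mulVec_mem_core (M : Matrix ι ι F) (N : Matrix κ ι F) :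
    ∃ q : ℕ, ∀ x, (∀ i ≤ q, N.mulVec ((M ^ i).mulVec x) = 0) →
      (M ^ (q + 1)).mulVec x ∈ core M N := by
  -- The decreasing chain of common kernels of N, N M, …, N M^k stabilizes at an M-stable space. Its
  -- images under the powers of M decrease and stabilize as well; past both indices, these images
  -- lie in the core.
  let W : ℕ → Submodule F (ι → F) := fun k =>
    ⨅ i : {i : ℕ // i ≤ k}, LinearMap.ker (N * M ^ i.1).mulVecLin
  have memW : ∀ k x, x ∈ W k ↔ ∀ i ≤ k, N.mulVec ((M ^ i).mulVec x) = 0 := fun k x => by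
    simp [W, Submodule.mem_iInf]
  let f : ℕ →o (Submodule F (ι → F))ᵒᵈ := ⟨W, fun a b hab => by
    change W b ≤ W a
    intro x hx
    rw [memW] at hx ⊢
    exact fun i hi => hx i (hi.trans hab)⟩
  obtain ⟨k, hk⟩ := IsArtinian.monotone_stabilizes f
  have hall : ∀ x ∈ W k, ∀ i, N.mulVec ((M ^ i).mulVec x) = 0 := fun x hx i => by
    have h1 : W k = W (max k i) := hk _ (le_max_left _ _)
    rw [h1, memW] at hx
    exact hx i (le_max_right _ _)
  have hstab : ∀ x ∈ W k, M.mulVec x ∈ W k := fun x hx => by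
    rw [memW]
    intro i _
    rw [Matrix.mulVec_mulVec _ (M ^ i), ← pow_succ]
    exact hall x hx (i + 1)
  have hpow : ∀ j, ∀ x ∈ W k, (M ^ j).mulVec x ∈ W k := fun j => by
    induction j with
    | zero => intro x hx; simpa using hx
    | succ j ih =>
      intro x hx
      rw [pow_succ, ← Matrix.mulVec_mulVec]
      exact ih _ (hstab x hx)
  let g : ℕ →o (Submodule F (ι → F))ᵒᵈ := ⟨fun j => (W k).map (M ^ j).mulVecLin, fun a b hab => by
    change (W k).map (M ^ b).mulVecLin ≤ (W k).map (M ^ a).mulVecLin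
    rintro _ ⟨x, hx, rfl⟩
    refine ⟨(M ^ (b - a)).mulVec x, hpow _ x hx, ?_⟩
    rw [Matrix.mulVecLin_apply, Matrix.mulVecLin_apply, Matrix.mulVec_mulVec, ← pow_add,
      Nat.add_sub_cancel' hab]⟩
  obtain ⟨l, hl⟩ := IsArtinian.monotone_stabilizes g
  refine ⟨max k l, fun x hx => ?_⟩
  have hxk : x ∈ W k := (memW k x).2 fun i hi => hx i (hi.trans (le_max_left _ _))
  rw [mem_core_iff]
  refine ⟨fun i => ?_, fun i => ?_⟩
  · have h1 : (W k).map (M ^ l).mulVecLin = (W k).map (M ^ (max k l + 1)).mulVecLin :=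
      hl _ (by have := le_max_right k l; omega)
    have h2 : (W k).map (M ^ l).mulVecLin = (W k).map (M ^ (max l i)).mulVecLin :=
      hl _ (le_max_left _ _)
    have h3 : (M ^ (max k l + 1)).mulVec x ∈ (W k).map (M ^ (max l i)).mulVecLin := by
      rw [← h2, h1]; exact ⟨x, hxk, rfl⟩
    obtain ⟨y, hy, e⟩ := h3
    refine ⟨(M ^ (max l i - i)).mulVec y, ?_, ?_⟩
    · simpa using hall _ (hpow (max l i - i) y hy) 0
    · rw [Matrix.mulVec_mulVec, ← pow_add, Nat.add_sub_cancel' (le_max_right _ _)]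
      exact e
  · rw [Matrix.mulVec_mulVec _ (M ^ i), ← pow_add]
    exact hall x hxk _

/-- Let V be a left inverse of a basis u of the core. Then Δ = M^(q+1) - u V M^(q+1) kills the
common kernel of the N M^i with i ≤ q, since M^(q+1) sends it into the range of u. Hence the rows of
Δ are combinations of rows of these matrices. The factors of u V M^(q+1) are padded with zeros up to
r. -/
theorem exists_factorization_of_finrank_core_le (M : Matrix ι ι F)
    (N : Matrix κ ι F) {r : ℕ} (hr : Module.finrank F (core M N) ≤ r) :
    ∃ (q : ℕ) (C : ℕ → Matrix ι κ F) (J' : ι → ℕ → F) (J : ℕ → ι → F),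
      M ^ (q + 1) = (Matrix.of fun a b => ∑ k ∈ Finset.range r, J' a k * J k b) +
        ∑ i ∈ Finset.range (q + 1), C i * (N * M ^ i) := by
  obtain ⟨q, hq⟩ := exists_pow_mulVec_mem_core M N
  obtain ⟨u, Λ, -, -, -, hinj, hrange⟩ := exists_basis_core M N
  obtain ⟨v, hv⟩ := u.mulVecLin.exists_leftInverse_of_injective (LinearMap.ker_eq_bot'.2 hinj)
  let V := LinearMap.toMatrix' v
  have hV : V * u = 1 := by
    have := congrArg (LinearMap.toMatrix' (R := F)) hv
    rw [LinearMap.toMatrix'_comp, LinearMap.toMatrix'_id, ← Matrix.toLin'_apply', LinearMap.toMatrix'_toLin'] at this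
    exact this
  let J' : ι → ℕ → F := fun a k => if h : k < Module.finrank F (core M N) then u a ⟨k, h⟩ else 0
  let J : ℕ → ι → F := fun k b =>
    if h : k < Module.finrank F (core M N) then (V * M ^ (q + 1)) ⟨k, h⟩ b else 0
  have hJ : (Matrix.of fun a b => ∑ k ∈ Finset.range r, J' a k * J k b) =
      u * (V * M ^ (q + 1)) := by
    ext a b
    rw [Matrix.of_apply, Matrix.mul_apply, ← Finset.sum_subset (Finset.range_subset_range.2 hr),
      Finset.sum_range]
    · refine Finset.sum_congr rfl fun k _ => ?_
      simp [J', J]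
    · intro k _ hk
      simp only [Finset.mem_range] at hk
      simp [J', hk]
  let Δ := M ^ (q + 1) - u * (V * M ^ (q + 1))
  have hΔ : ∀ x, (∀ i ≤ q, N.mulVec ((M ^ i).mulVec x) = 0) → Δ.mulVec x = 0 := fun x hx => by
    have h1 := hq x hx
    rw [← hrange] at h1
    obtain ⟨y, hy⟩ := h1
    rw [Matrix.mulVecLin_apply] at hy
    rw [Matrix.sub_mulVec, ← Matrix.mulVec_mulVec, ← Matrix.mulVec_mulVec, ← hy,
      Matrix.mulVec_mulVec _ V, hV, Matrix.one_mulVec, sub_self]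
  have hrow : ∀ a, ∃ c : Fin (q + 1) × κ → F, ∀ b, Δ a b = ∑ t, c t * (N * M ^ (t.1 : ℕ)) t.2 b := by
    intro a
    let L : Fin (q + 1) × κ → (ι → F) →ₗ[F] F := fun t =>
      (LinearMap.proj t.2).comp (N * M ^ (t.1 : ℕ)).mulVecLin
    let K : (ι → F) →ₗ[F] F := (LinearMap.proj a).comp Δ.mulVecLin
    have h1 : K ∈ Submodule.span F (Set.range L) := by
      refine mem_span_of_iInf_ker_le_ker fun x hx => ?_
      rw [Submodule.mem_iInf] at hx
      refine congrFun (hΔ x fun i hi => ?_) a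
      rw [Matrix.mulVec_mulVec]
      funext k
      exact hx (⟨i, by omega⟩, k)
    obtain ⟨c, hc⟩ := (Submodule.mem_span_range_iff_exists_fun F).1 h1
    refine ⟨c, fun b => ?_⟩
    have h2 := LinearMap.congr_fun hc (Pi.single b 1)
    simp only [LinearMap.sum_apply, LinearMap.smul_apply, smul_eq_mul, L, K, LinearMap.comp_apply,
      Matrix.mulVecLin_apply, Matrix.mulVec_single_one, LinearMap.proj_apply, Matrix.col_apply] at h2
    exact h2.symm
  choose c hc using hrow
  refine ⟨q, fun i => Matrix.of fun a k => if h : i < q + 1 then c a (⟨i, h⟩, k) else 0, J', J, ?_⟩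
  rw [hJ, ← sub_eq_iff_eq_add']
  ext a b
  refine (hc a b).trans ?_
  rw [Fintype.sum_prod_type, Matrix.sum_apply, Finset.sum_range]
  refine Finset.sum_congr rfl fun i _ => ?_
  simp only [Matrix.mul_apply, Matrix.of_apply, i.2, dite_true, Fin.eta]

end Factorization

/-! ### Certificates for both inequalities on the dimension of the core. -/

section CoreCertificates

variable {F : Type*} [Field F] {ι κ : Type*} [Fintype ι] [DecidableEq ι] [Fintype κ]

/-- Selecting rows of N by an arbitrary map `f` can only drop or repeat conditions, so the core does
not shrink. -/
theorem finrank_core_le_submatrix {ι' κ' : Type*} [Fintype ι'] [DecidableEq ι'] [Fintype κ']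
    (M : Matrix ι ι F) (N : Matrix κ ι F) (e : ι' ≃ ι) (f : κ' → κ) :
    Module.finrank F (core M N) ≤
      Module.finrank F (core (M.submatrix e e) (N.submatrix f e)) := by
  obtain ⟨u, Λ, hΛ, h1, h2, h3, -⟩ := exists_basis_core M N
  have := card_le_finrank_core (M := M.submatrix e e) (N := N.submatrix f e)
    (u := u.submatrix e id) hΛ ?_ ?_ fun x hx => h3 x ?_
  · rwa [Fintype.card_fin] at this
  · rw [Matrix.submatrix_mul_equiv, h1, ← Matrix.submatrix_mul_equiv u Λ e (Equiv.refl _) id]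
    rfl
  · rw [Matrix.submatrix_mul_equiv, h2]
    rfl
  · ext i
    have := congrFun hx (e.symm i)
    simpa [Matrix.mulVec, dotProduct] using this

theorem finrank_core_submatrix {ι' κ' : Type*} [Fintype ι'] [DecidableEq ι'] [Fintype κ']
    (M : Matrix ι ι F) (N : Matrix κ ι F) (e : ι' ≃ ι) (f : κ' ≃ κ) :
    Module.finrank F (core (M.submatrix e e) (N.submatrix f e)) =
      Module.finrank F (core M N) := by
  refine le_antisymm ?_ (finrank_core_le_submatrix M N e f)
  have := finrank_core_le_submatrix (M.submatrix e e) (N.submatrix f e) e.symm f.symm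
  have h1 : (M.submatrix e e).submatrix e.symm e.symm = M := by ext; simp
  have h2 : (N.submatrix f e).submatrix f.symm e.symm = N := by ext; simp
  rwa [h1, h2] at this

/-- Γ and L witness the invertibility of Λ and the independence of the columns of u, so that the
lower bound is expressed by matrix identities only. -/
theorem le_finrank_core {m : ℕ} {M : Matrix ι ι F} {N : Matrix κ ι F} {u : Matrix ι (Fin m) F}
    {Λ Γ : Matrix (Fin m) (Fin m) F} {L : Matrix (Fin m) ι F} (h1 : M * u = u * Λ)
    (h2 : N * u = 0) (h3 : Λ * Γ = 1) (h4 : L * u = 1) : m ≤ Module.finrank F (core M N) := by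
  have := card_le_finrank_core (IsUnit.of_mul_eq_one _ h3) h1 h2 fun x hx => by
    rw [← Matrix.one_mulVec x, ← h4, ← Matrix.mulVec_mulVec, hx, Matrix.mulVec_zero]
  rwa [Fintype.card_fin] at this

theorem exists_of_finrank_core_eq {m : ℕ} {M : Matrix ι ι F} {N : Matrix κ ι F}
    (h : Module.finrank F (core M N) = m) : ∃ (u : Matrix ι (Fin m) F)
      (Λ Γ : Matrix (Fin m) (Fin m) F) (L : Matrix (Fin m) ι F),
      M * u = u * Λ ∧ N * u = 0 ∧ Λ * Γ = 1 ∧ L * u = 1 := by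
  subst h
  obtain ⟨u, Λ, hΛ, h1, h2, h3, -⟩ := exists_basis_core M N
  obtain ⟨g, hg⟩ := LinearMap.exists_leftInverse_of_injective u.mulVecLin
    (LinearMap.ker_eq_bot'.2 h3)
  obtain ⟨v, rfl⟩ := hΛ
  refine ⟨u, v.1, v⁻¹.1, LinearMap.toMatrix' g, h1, h2, v.mul_inv, ?_⟩
  apply Matrix.toLin'.injective
  rw [Matrix.toLin'_mul, Matrix.toLin'_toMatrix', Matrix.toLin'_one]
  exact hg

theorem pow_mulVec_eq_zero {M : Matrix ι ι F} {N : Matrix κ ι F} {x : ι → F}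
    (hx : x ∈ core M N) (k : ℕ) (h : (M ^ k).mulVec x = 0) : x = 0 := by
  induction k with
  | zero => simpa using h
  | succ k ih =>
    rw [pow_succ', ← Matrix.mulVec_mulVec] at h
    refine ih (eq_zero_of_mem_core (N := N) ?_ h)
    clear h ih
    induction k with
    | zero => simpa using hx
    | succ k ih =>
      rw [pow_succ', ← Matrix.mulVec_mulVec]
      exact mulVec_mem_core ih

/-- All N M^i vanish on the core, so a vector of the core killed by J is killed by M^(q+1), hence
zero. Thus J embeds the core into F^r. -/
theorem finrank_core_le {r q : ℕ} {M : Matrix ι ι F} {N : Matrix κ ι F} {J' : Matrix ι (Fin r) F}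
    {J : Matrix (Fin r) ι F} {C : ℕ → Matrix ι κ F}
    (h : M ^ (q + 1) = J' * J + ∑ i ∈ Finset.range (q + 1), C i * (N * M ^ i)) :
    Module.finrank F (core M N) ≤ r := by
  have hinj : Function.Injective (J.mulVecLin.domRestrict (core M N)) := by
    rw [injective_iff_map_eq_zero]
    rintro ⟨x, hx⟩ h0
    have h0' : J.mulVec x = 0 := h0
    refine Subtype.ext (pow_mulVec_eq_zero hx (q + 1) ?_)
    rw [h, Matrix.add_mulVec, ← Matrix.mulVec_mulVec, h0', Matrix.mulVec_zero, zero_add,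
      Matrix.sum_mulVec]
    refine Finset.sum_eq_zero fun i _ => ?_
    rw [← Matrix.mulVec_mulVec, ← Matrix.mulVec_mulVec, ((mem_core_iff M N x).1 hx).2 i,
      Matrix.mulVec_zero]
  have := LinearMap.finrank_le_finrank_of_injective hinj
  rwa [Module.finrank_fin_fun] at this

theorem exists_of_finrank_core_le (M : Matrix ι ι F) (N : Matrix κ ι F) {r : ℕ}
    (hr : Module.finrank F (core M N) ≤ r) :
    ∃ (q : ℕ) (C : ℕ → Matrix ι κ F) (J' : Matrix ι (Fin r) F) (J : Matrix (Fin r) ι F),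
      M ^ (q + 1) = J' * J + ∑ i ∈ Finset.range (q + 1), C i * (N * M ^ i) := by
  obtain ⟨q, C, J', J, h⟩ := exists_factorization_of_finrank_core_le M N hr
  refine ⟨q, C, Matrix.of fun a k => J' a k, Matrix.of fun k b => J k b, ?_⟩
  rw [h]
  congr 1
  ext a b
  simp only [Matrix.of_apply, Matrix.mul_apply]
  exact Finset.sum_range fun k => J' a k * J k b

end CoreCertificates

/-! ### A window read off from polynomial data, without exact valuations. -/

section Windows

variable {F : Type*} [Field F] {m : ℕ}

/-- The order of `f` at `0` is at least that of `f g` minus an index where `g` does not vanish. -/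
theorem coeff_eq_zero_of_mul {f g s : LaurentSeries F} {h : ℤ} (hg : g.coeff h ≠ 0)
    (hs : ∀ n < 0, s.coeff n = 0) (hfg : f * g = s) (n : ℤ) (hn : n < -h) : f.coeff n = 0 := by
  by_contra hne
  have hf0 : f ≠ 0 := by rintro rfl; exact hne rfl
  have hg0 : g ≠ 0 := by rintro rfl; exact hg rfl
  have h1 := HahnSeries.order_mul hf0 hg0
  have h2 := HahnSeries.order_le_of_coeff_ne_zero hne
  have h3 := HahnSeries.order_le_of_coeff_ne_zero hg
  rw [hfg] at h1
  refine HahnSeries.coeff_order_eq_zero.not.2 (hfg ▸ mul_ne_zero hf0 hg0) (hs _ ?_)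
  omega

theorem laurent_algebraMap_coeff (P : F[X]) (n : ℤ) :
    (laurent F (algebraMap F[X] (RatFunc F) P)).coeff n = if n < 0 then 0 else P.coeff n.toNat := by
  rw [laurent_algebraMap]
  refine (PowerSeries.coeff_coe (P : PowerSeries F) n).trans ?_
  split_ifs with h
  · rfl
  · rw [Polynomial.coeff_coe]
    congr 1
    omega

/-- A common denominator with a nonzero coefficient at h has order at most h, so the entries of A
have order at least -h. This bound replaces the exact valuation. -/
theorem coeffMatrix_phi_laurent_eq_zero {d : ℕ} (hd : d ≠ 0) (A : GL (Fin m) (RatFunc F))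
    {Δ : F[X]} {P : Matrix (Fin m) (Fin m) F[X]} {h : ℕ} (hΔ : Δ.coeff h ≠ 0)
    (hP : ∀ r l, A.1 r l * algebraMap F[X] (RatFunc F) Δ = algebraMap F[X] (RatFunc F) (P r l))
    (n : ℤ) (hn : n < -(d * h : ℕ)) : coeffMatrix (dilate A d) n = 0 := by
  ext r l
  change (phi F d (laurent F (A.1 r l))).coeff n = 0
  by_cases hdv : (d : ℤ) ∣ n
  · obtain ⟨k, rfl⟩ := hdv
    rw [phi_coeff_mul hd]
    refine coeff_eq_zero_of_mul (h := h) (g := laurent F (algebraMap F[X] (RatFunc F) Δ))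
      (s := laurent F (algebraMap F[X] (RatFunc F) (P r l))) ?_ ?_ ?_ k ?_
    · rwa [laurent_algebraMap_coeff, if_neg (by omega), Int.toNat_natCast]
    · intro j hj
      rw [laurent_algebraMap_coeff, if_pos hj]
    · rw [← map_mul, hP]
    · push_cast at hn
      have hd' : (0 : ℤ) < d := by omega
      by_contra hk
      nlinarith [mul_le_mul_of_nonneg_left (not_lt.1 hk) hd'.le]
  · exact phi_coeff_of_not_dvd hd _ _ hdv

/-- Power series division, on finitely many coefficients. -/
theorem coeff_eq_of_convolution {δ N : F[X]} (hδ : δ.coeff 0 ≠ 0) {E : ℕ → F} {L : ℕ}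
    (hE : ∀ n < L, ∑ i ∈ Finset.range (n + 1), δ.coeff i * E (n - i) = N.coeff n)
    {s : PowerSeries F} (hs : (δ : PowerSeries F) * s = N) {n : ℕ} (hn : n < L) :
    PowerSeries.coeff n s = E n := by
  induction n using Nat.strong_induction_on with
  | _ n ih =>
    have h1 := congrArg (PowerSeries.coeff n) hs
    rw [PowerSeries.coeff_mul, Polynomial.coeff_coe, ← hE n hn,
      Finset.Nat.sum_antidiagonal_eq_sum_range_succ fun i j =>
        PowerSeries.coeff i (δ : PowerSeries F) * PowerSeries.coeff j s,
      Finset.sum_range_succ', Finset.sum_range_succ'] at h1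
    have h2 : ∑ k ∈ Finset.range n, PowerSeries.coeff (k + 1) (δ : PowerSeries F) *
        PowerSeries.coeff (n - (k + 1)) s =
        ∑ k ∈ Finset.range n, δ.coeff (k + 1) * E (n - (k + 1)) := by
      refine Finset.sum_congr rfl fun k hk => ?_
      have := Finset.mem_range.1 hk
      rw [ih (n - (k + 1)) (by omega) (by omega), Polynomial.coeff_coe]
    rw [h2, add_right_inj, Polynomial.coeff_coe, Nat.sub_zero] at h1
    exact mul_left_cancel₀ hδ h1

/-- The hypothesis says A⁻¹ = N / (z^v δ), so φ_d(A)⁻¹ = z^(-dv) E(z^d) with E the expansion of N /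
δ. The bound `s` keeps the needed index among the L known coefficients; negative indices and those
not divisible by d give an empty sum. -/
theorem coeffMatrix_dilate_inv {d : ℕ} (hd : d ≠ 0) (A : GL (Fin m) (RatFunc F)) {δ : F[X]}
    {N : Matrix (Fin m) (Fin m) F[X]} {v : ℕ} (hδ : δ.coeff 0 ≠ 0)
    (hA : A.1 * N.map (algebraMap F[X] (RatFunc F)) =
      algebraMap F[X] (RatFunc F) (X ^ v * δ) • 1) {E : ℕ → ℕ → ℕ → F} {L : ℕ}
    (hE : ∀ n < L, ∀ r l : Fin m,
      ∑ i ∈ Finset.range (n + 1), δ.coeff i * E (n - i) r l = (N r l).coeff n)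
    (n : ℤ) (s : ℕ) (hs : n + d * v < s) (hsL : s ≤ L) (r l : Fin m) :
    coeffMatrix (dilate A d)⁻¹ n r l =
      ∑ k ∈ Finset.range L, if (d * k : ℤ) = n + d * v then E k r l else 0 := by
  have hδ0 : (δ : PowerSeries F) ≠ 0 := fun h => hδ (by
    rw [← Polynomial.coeff_coe, h, map_zero])
  have hX : algebraMap F[X] (RatFunc F) (X ^ v * δ) ≠ 0 := by
    rw [map_ne_zero_iff _ (RatFunc.algebraMap_injective F)]
    refine mul_ne_zero (pow_ne_zero _ Polynomial.X_ne_zero) ?_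
    rintro rfl
    simp at hδ
  have hAinv : algebraMap F[X] (RatFunc F) (X ^ v * δ) * (A⁻¹).1 r l =
      algebraMap F[X] (RatFunc F) (N r l) := by
    have h1 : A⁻¹.1 * A.1 = 1 := A.inv_mul
    have h2 := congrArg (A⁻¹.1 * ·) hA
    simp only [← Matrix.mul_assoc, h1, Matrix.one_mul, Matrix.mul_smul, Matrix.mul_one] at h2
    exact (congrFun (congrFun h2 r) l).symm
  let t : PowerSeries F := (N r l : PowerSeries F) * (δ : PowerSeries F)⁻¹
  have ht : (δ : PowerSeries F) * t = N r l := by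
    change (δ : PowerSeries F) * (N r l * (δ : PowerSeries F)⁻¹) = N r l
    rw [mul_left_comm, PowerSeries.mul_inv_cancel _ (by
      rwa [← PowerSeries.coeff_zero_eq_constantCoeff_apply, Polynomial.coeff_coe]), mul_one]
  have hlau : HahnSeries.single (v : ℤ) (1 : F) * laurent F (A⁻¹.1 r l) =
      HahnSeries.ofPowerSeries ℤ F t := by
    have h1 := congrArg (laurent F) hAinv
    rw [map_mul, laurent_algebraMap, laurent_algebraMap, ← ht, Polynomial.coe_mul, map_mul,
      Polynomial.coe_pow, Polynomial.coe_X, HahnSeries.ofPowerSeries_X_pow, map_mul,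
      mul_comm (HahnSeries.single _ _), mul_assoc] at h1
    refine mul_left_cancel₀ ?_ h1
    rwa [Ne, map_eq_zero_iff _ HahnSeries.ofPowerSeries_injective]
  have hc : ∀ j : ℤ, (laurent F (A⁻¹.1 r l)).coeff j =
      if j + v < 0 then 0 else PowerSeries.coeff (j + v).natAbs t := by
    intro j
    have h1 := congrArg (fun f => HahnSeries.coeff f (j + v)) hlau
    simp only [HahnSeries.coeff_single_mul_add, one_mul] at h1
    rw [h1]
    exact PowerSeries.coeff_coe t _
  have hdz : (d : ℤ) ≠ 0 := by exact_mod_cast hd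
  rw [dilate_inv]
  change (phi F d (laurent F (A⁻¹.1 r l))).coeff n = _
  by_cases hdv : (d : ℤ) ∣ n
  · obtain ⟨j, rfl⟩ := hdv
    have heq : ∀ k : ℕ, (d * k : ℤ) = d * j + d * v ↔ (k : ℤ) = j + v := fun k => by
      rw [← mul_add, mul_right_inj' hdz]
    simp only [phi_coeff_mul hd, hc, heq]
    split_ifs with h0
    · refine (Finset.sum_eq_zero fun k _ => if_neg (by omega)).symm
    · have hL : (j + v).natAbs < L := by
        have h1 : (1 : ℤ) * (j + v) ≤ d * (j + v) :=
          mul_le_mul_of_nonneg_right (by omega) (not_lt.1 h0)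
        have h2 : ((j + v).natAbs : ℤ) = j + v := Int.natAbs_of_nonneg (not_lt.1 h0)
        rw [mul_add (d : ℤ)] at h1
        omega
      rw [Finset.sum_eq_single (j + v).natAbs]
      · rw [if_pos (by omega)]
        exact coeff_eq_of_convolution hδ (E := fun k => E k r l) (fun n hn => hE n hn r l) ht hL
      · intro k _ hk
        rw [if_neg (by omega)]
      · intro h
        exact absurd (Finset.mem_range.2 hL) h
  · rw [phi_coeff_of_not_dvd hd _ _ hdv]
    refine (Finset.sum_eq_zero fun k _ => if_neg fun h => hdv ?_).symm
    exact ⟨k - v, by rw [mul_sub]; omega⟩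

/-- The entries of the matrix of `f ↦ B φ_p(f)` on coefficients, with a block index `i` and an
index `r < m` inside the block combined into `m i + r`, where `B` is `z ^ (-d v) E(z ^ d)`. -/
def opEntry {R : Type*} [CommRing R] (E : ℕ → ℕ → ℕ → R) (d p m L a b : ℕ) : R :=
  ∑ k ∈ Finset.range L, if d * k + p * (b / m) = a / m then E k (a % m) (b % m) else 0

def intervalEquiv (lo hi : ℤ) (W : ℕ) (h : hi + 1 = lo + W) : Fin W ≃ Finset.Icc lo hi where
  toFun i := ⟨lo + i, Finset.mem_Icc.2 (by have := i.2; omega)⟩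
  invFun j := ⟨(j.1 - lo).toNat, by have := Finset.mem_Icc.1 j.2; omega⟩
  left_inv i := by ext; simp
  right_inv j := by
    have := Finset.mem_Icc.1 j.2
    ext
    simp
    omega

/-- Indices of the rows of a window, as natural numbers. -/
def windowEquiv (m : ℕ) (lo hi : ℤ) (W : ℕ) (h : hi + 1 = lo + W) :
    Fin (W * m) ≃ Finset.Icc lo hi × Fin m :=
  finProdFinEquiv.symm.trans (Equiv.prodCongr (intervalEquiv lo hi W h) (Equiv.refl _))

theorem windowEquiv_snd (lo hi : ℤ) (W : ℕ) (h : hi + 1 = lo + W) (a : Fin (W * m)) :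
    ((windowEquiv m lo hi W h a).2 : ℕ) = a % m := rfl

/-- The size of the window of exponents. -/
def winSize (d v h : ℕ) : ℕ := d * v + d * h + 1

/-- The number of exponents below the window which the operator reaches from the window. -/
def lowSize (d p v h : ℕ) : ℕ := d * v + (p - 1) * (d * h)

/-- Block rows are counted from the lowest exponent -dv - p d h that the window -dh, …, dv reaches.
The first `lowSize` of them form `opN` and the next `winSize` form `opM`, hence the shift by
`lowSize * m`. -/
def opM {R : Type*} [CommRing R] (E : ℕ → ℕ → ℕ → R) (d p m v h : ℕ) :
    Matrix (Fin (winSize d v h * m)) (Fin (winSize d v h * m)) R :=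
  Matrix.of fun a b => opEntry E d p m (lowSize d p v h + winSize d v h)
    (a + lowSize d p v h * m) b

def opN {R : Type*} [CommRing R] (E : ℕ → ℕ → ℕ → R) (d p m v h : ℕ) :
    Matrix (Fin (lowSize d p v h * m)) (Fin (winSize d v h * m)) R :=
  Matrix.of fun a b => opEntry E d p m (lowSize d p v h + winSize d v h) a b

variable {p d : ℕ}

/-- Any window that reaches high enough for the recursion and low enough to contain the orders of
all square frames detects them as well as [ν_d, μ_d] does; [-dh, dv] is such a window. The two cores
are compared only through the existence of a square frame. -/
theorem le_finrank_spaceX_iff (hp : 2 ≤ p) (hm : 1 ≤ m) (hd : d ≠ 0) (A : GL (Fin m) (RatFunc F))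
    {δ Δ : F[X]} {N P : Matrix (Fin m) (Fin m) F[X]} {v h : ℕ} (hδ : δ.coeff 0 ≠ 0)
    (hA : A.1 * N.map (algebraMap F[X] (RatFunc F)) =
      algebraMap F[X] (RatFunc F) (X ^ v * δ) • 1) (hΔ : Δ.coeff h ≠ 0)
    (hP : ∀ r l, A.1 r l * algebraMap F[X] (RatFunc F) Δ = algebraMap F[X] (RatFunc F) (P r l))
    {E : ℕ → ℕ → ℕ → F} (hE : ∀ n < lowSize d p v h + winSize d v h, ∀ r l : Fin m,
      ∑ i ∈ Finset.range (n + 1), δ.coeff i * E (n - i) r l = (N r l).coeff n) :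
    (m ≤ Module.finrank F (spaceX p A d) ↔
      m ≤ Module.finrank F (core (opM E d p m v h) (opN E d p m v h))) ∧
    Module.finrank F (core (opM E d p m v h) (opN E d p m v h)) ≤ m := by
  obtain ⟨lo, hlo⟩ : ∃ lo : ℤ, lo = -(d * h : ℕ) := ⟨_, rfl⟩
  obtain ⟨hi, hhi⟩ : ∃ hi : ℤ, hi = (d * v : ℕ) := ⟨_, rfl⟩
  obtain ⟨r, hr⟩ : ∃ r : ℤ, r = -hi + p * lo := ⟨_, rfl⟩
  have hW : hi + 1 = lo + winSize d v h := by rw [winSize]; push_cast; omega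
  have hp1 : ((p - 1 : ℕ) : ℤ) = p - 1 := by omega
  have hW' : lo - 1 + 1 = r + lowSize d p v h := by
    rw [lowSize, hr, hlo, hhi]; push_cast [hp1]; ring
  have hm0 : 0 < m := hm
  have hB : ∀ n < -hi, coeffMatrix (dilate A d)⁻¹ n = 0 := fun n hn => by
    ext i j
    rw [coeffMatrix_dilate_inv hd A hδ hA hE n 0 (by push_cast; push_cast at hhi; omega)
      (by omega)]
    exact Finset.sum_eq_zero fun k _ => if_neg (by push_cast at hhi; nlinarith)
  have hlow : (lowSize d p v h : ℤ) = hi + lo - p * lo := by linarith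
  have hdv : (d * v : ℤ) = hi := by rw [hhi]; push_cast; rfl
  have hM : opM E d p m v h = (windowMatrix _ _ p (dilate A d)⁻¹).submatrix
      (windowEquiv m lo hi _ hW) (windowEquiv m lo hi _ hW) := by
    ext1 a b
    have ha : (a : ℕ) / m < winSize d v h :=
      Nat.div_lt_of_lt_mul (a.2.trans_eq (mul_comm _ _))
    have hab : (a + lowSize d p v h * m) / m = a / m + lowSize d p v h :=
      Nat.add_mul_div_right _ _ hm0
    have hpj : (0 : ℤ) ≤ p * (b / m : ℕ) := by positivity
    refine Eq.symm ((coeffMatrix_dilate_inv hd A hδ hA hE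
      ((lo + (a / m : ℕ)) - p * (lo + (b / m : ℕ)))
      (lowSize d p v h + winSize d v h) ?_ le_rfl _ _).trans ?_)
    · rw [hdv]
      push_cast [hlow] at ha hpj ⊢
      zify at ha
      have := Int.natCast_nonneg (winSize d v h)
      linarith
    · simp only [opM, Matrix.of_apply, opEntry, windowEquiv_snd, hab, Nat.add_mul_mod_self_right]
      refine Finset.sum_congr rfl fun k _ => if_congr ?_ rfl rfl
      rw [hdv, ← Nat.cast_inj (R := ℤ)]
      push_cast [hlow]
      constructor <;> intro <;> linarith
  have hN : opN E d p m v h = (windowMatrix _ _ p (dilate A d)⁻¹).submatrix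
      (windowEquiv m r (lo - 1) _ hW') (windowEquiv m lo hi _ hW) := by
    ext1 a b
    have ha : (a : ℕ) / m < lowSize d p v h :=
      Nat.div_lt_of_lt_mul (a.2.trans_eq (mul_comm _ _))
    have hpj : (0 : ℤ) ≤ p * (b / m : ℕ) := by positivity
    refine Eq.symm ((coeffMatrix_dilate_inv hd A hδ hA hE
      ((r + (a / m : ℕ)) - p * (lo + (b / m : ℕ)))
      (lowSize d p v h + winSize d v h) ?_ le_rfl _ _).trans ?_)
    · rw [hdv]
      push_cast [hlow] at ha hpj ⊢
      zify at ha
      have := Int.natCast_nonneg (winSize d v h)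
      linarith
    · simp only [opN, Matrix.of_apply, opEntry, windowEquiv_snd]
      refine Finset.sum_congr rfl fun k _ => if_congr ?_ rfl rfl
      rw [hdv, ← Nat.cast_inj (R := ℤ)]
      push_cast [hr]
      constructor <;> intro <;> linarith
  have hcore : Module.finrank F (core (opM E d p m v h) (opN E d p m v h)) =
      Module.finrank F (windowCore p (dilate A d)⁻¹ r lo hi) := by
    rw [hM, hN, finrank_core_submatrix]
    rfl
  rw [hcore]
  have hb : hi ≤ (p - 1) * hi := by
    have hp2 : (2 : ℤ) ≤ p := by exact_mod_cast hp
    nlinarith [Int.natCast_nonneg (d * v : ℕ)]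
  have hle := exists_isFrame_of_le_finrank (m := m) hp hB hb (lo := lo) (r := r) (by omega)
  refine ⟨⟨fun h1 => ?_, fun h1 => ?_⟩, ?_⟩
  · obtain ⟨Ψ, Λ, h2, h3⟩ :=
      (isEquivalentToConst_iff hd (by omega) A).1 (finrank_spaceX_of_le hp hd A h1).2
    have := h3.le_finrank_windowCore (r := r) (lo := lo) hp hB hb (fun c hc => by
      obtain ⟨v, rfl⟩ := h2
      calc c = (v⁻¹.1 * v.1) * c := by simp
        _ = 0 := by rw [Matrix.mul_assoc, hc, Matrix.mul_zero])
      (h3.coeffMatrix_eq_zero_of_lt hp (dilate_mul_inv A d)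
        (coeffMatrix_phi_laurent_eq_zero hd A hΔ hP) (by
          have hp2 : (2 : ℤ) ≤ p := by exact_mod_cast hp
          nlinarith [Int.natCast_nonneg (d * h : ℕ)]))
    rwa [Fintype.card_fin] at this
  · obtain ⟨-, Ψ, Λ, h2, h3, -⟩ := hle h1
    exact le_finrank_spaceX hp hd A
      ((isEquivalentToConst_iff hd (by omega) A).2 ⟨Ψ, Λ, h3, h2⟩)
  · by_contra hlt
    have := (hle (by omega)).1
    omega

end Windows

/-! ### Certificates as finite systems of polynomial identities. -/

section CertificateDefs

variable {R S : Type*} [CommRing R] [CommRing S]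

/-- Finitely many polynomials and matrices, addressed by a number and three indices. -/
abbrev Cells (R : Type*) : Type _ := ℕ → ℕ → ℕ → ℕ → R

/-- The coefficients of the product of two polynomials with `b` and `b'` coefficients. -/
def conv (b b' : ℕ) (f g : ℕ → R) (n : ℕ) : R :=
  ∑ i ∈ Finset.range b, ∑ k ∈ Finset.range b', if i + k = n then f i * g k else 0

-- `rel` will be equality in a field or congruence modulo f in ℤ[x], and `c` a common denominator of
-- the cells. For c = 1 the conditions below are the intended ones; the factors c make each of them
-- homogeneous in c and the cells jointly.
variable (rel : R → R → Prop) (p m d b v h q : ℕ) (c : R) (x : Cells R)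

/-- `P = Δ A` for the matrix `P` in cell `0` and the polynomial `Δ` in cell `1`. -/
def IsDenominator (K : ℕ) (num den : ℕ → ℕ → ℕ → R) : Prop :=
  h < b ∧ rel (x 1 h 0 0) c ∧ ∀ n < b + K, ∀ r < m, ∀ l < m,
    rel (conv b K (fun i => x 0 i r l) (den r l) n) (conv b K (fun i => x 1 i 0 0) (num r l) n)

/-- `P w = 0` for the vector `w ≠ 0` in cell `2`. -/
def IsSingular : Prop :=
  (∀ n < b + b, ∀ r < m,
    rel (∑ l ∈ Finset.range m, conv b b (fun i => x 0 i r l) (fun i => x 2 i l 0) n) 0) ∧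
  ∃ l < m, ∃ k < b, rel (x 2 k l 0) c

/-- `P N = z ^ v Δ δ` for the matrix `N` in cell `2` and the polynomial `δ`, with `δ(0) ≠ 0`, in
cell `3`. -/
def IsPseudoInverse : Prop :=
  0 < b ∧ rel (x 3 0 0 0) c ∧ ∀ n < b + b + v, ∀ r < m, ∀ s < m,
    rel (∑ l ∈ Finset.range m, conv b b (fun i => x 0 i r l) (fun i => x 2 i l s) n)
      (if r = s ∧ v ≤ n then conv b b (fun i => x 1 i 0 0) (fun i => x 3 i 0 0) (n - v) else 0)

/-- The first `L` coefficients of `N / δ` are in cell `4`. -/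
def IsExpansion (L : ℕ) : Prop :=
  ∀ n < L, ∀ r < m, ∀ l < m,
    rel (conv b L (fun i => x 3 i 0 0) (fun i => x 4 i r l) n)
      (c * if n < b then x 2 n r l else 0)

/-- The core of the operator has dimension at least `m`. -/
def IsPositive : Prop :=
  (∀ a < winSize d v h * m, ∀ s < m,
    rel (∑ k ∈ Finset.range (winSize d v h * m),
        opEntry (x 4) d p m (lowSize d p v h + winSize d v h) (a + lowSize d p v h * m) k *
          x 5 0 k s)
      (∑ t ∈ Finset.range m, x 5 0 a t * x 6 0 t s)) ∧
  (∀ a < lowSize d p v h * m, ∀ s < m,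
    rel (∑ k ∈ Finset.range (winSize d v h * m),
        opEntry (x 4) d p m (lowSize d p v h + winSize d v h) a k * x 5 0 k s) 0) ∧
  (∀ a < m, ∀ s < m, rel (∑ k ∈ Finset.range m, x 6 0 a k * x 7 0 k s)
    (if a = s then c * c else 0)) ∧
  ∀ a < m, ∀ s < m, rel (∑ k ∈ Finset.range (winSize d v h * m), x 8 0 a k * x 5 0 k s)
    (if a = s then c * c else 0)

/-- The core of the operator has dimension less than `m`. -/
def IsNegative : Prop :=
  (∀ a < winSize d v h * m, ∀ s < winSize d v h * m, rel (x 5 0 a s) (if a = s then c else 0)) ∧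
  (∀ t < q + 1, ∀ a < winSize d v h * m, ∀ s < winSize d v h * m,
    rel (∑ k ∈ Finset.range (winSize d v h * m),
        opEntry (x 4) d p m (lowSize d p v h + winSize d v h) (a + lowSize d p v h * m) k *
          x 5 t k s)
      (c * x 5 (t + 1) a s)) ∧
  (∀ t < q + 1, ∀ a < lowSize d p v h * m, ∀ s < winSize d v h * m,
    rel (∑ k ∈ Finset.range (winSize d v h * m),
        opEntry (x 4) d p m (lowSize d p v h + winSize d v h) a k * x 5 t k s)
      (c * x 6 t a s)) ∧
  ∀ a < winSize d v h * m, ∀ s < winSize d v h * m,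
    rel (c * x 5 (q + 1) a s)
      (∑ k ∈ Finset.range (m - 1), x 8 0 a k * x 9 0 k s +
        ∑ t ∈ Finset.range (q + 1), ∑ k ∈ Finset.range (lowSize d p v h * m),
          x 7 t a k * x 6 t k s)

end CertificateDefs

/-! ### Transport of certificates along ring homomorphisms and scalings. -/

section CertificateMaps

variable {R S : Type*} [CommRing R] [CommRing S] {rel : R → R → Prop} {p m d b v h q K : ℕ}
  {c : R} {x : Cells R} {num den : ℕ → ℕ → ℕ → R}

theorem map_conv (φ : R →+* S) (b b' : ℕ) (f g : ℕ → R) (n : ℕ) :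
    φ (conv b b' f g n) = conv b b' (fun i => φ (f i)) (fun i => φ (g i)) n := by
  simp only [conv, map_sum, apply_ite φ, map_mul, map_zero]

theorem map_opEntry (φ : R →+* S) (E : ℕ → ℕ → ℕ → R) (d p m L a b : ℕ) :
    φ (opEntry E d p m L a b) = opEntry (fun k r l => φ (E k r l)) d p m L a b := by
  simp only [opEntry, map_sum, apply_ite φ, map_zero]

variable {φ : R →+* S} (hφ : ∀ a b, rel a b ↔ φ a = φ b)
include hφ

/-- The conditions are built from ring operations and `rel`, so a homomorphism that detects `rel`
carries them to equalities. It will be evaluation at α, or the inclusion of ℚ(α) into the field of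
algebraic numbers. -/
theorem isDenominator_map : IsDenominator rel m b h c x K num den ↔
    IsDenominator Eq m b h (φ c) (fun t i r l => φ (x t i r l)) K
      (fun r l k => φ (num r l k)) (fun r l k => φ (den r l k)) := by
  simp only [IsDenominator, hφ, map_conv]

theorem isSingular_map : IsSingular rel m b c x ↔
    IsSingular Eq m b (φ c) (fun t i r l => φ (x t i r l)) := by
  simp only [IsSingular, hφ, map_conv, map_sum, map_zero]

theorem isPseudoInverse_map : IsPseudoInverse rel m b v c x ↔
    IsPseudoInverse Eq m b v (φ c) (fun t i r l => φ (x t i r l)) := by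
  simp only [IsPseudoInverse, hφ, map_conv, map_sum, map_zero, apply_ite φ]

theorem isExpansion_map {L : ℕ} : IsExpansion rel m b c x L ↔
    IsExpansion Eq m b (φ c) (fun t i r l => φ (x t i r l)) L := by
  simp only [IsExpansion, hφ, map_conv, map_mul, map_zero, apply_ite φ]

theorem isPositive_map : IsPositive rel p m d v h c x ↔
    IsPositive Eq p m d v h (φ c) (fun t i r l => φ (x t i r l)) := by
  simp only [IsPositive, hφ, map_sum, map_mul, map_zero, apply_ite φ, map_opEntry]

theorem isNegative_map : IsNegative rel p m d v h q c x ↔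
    IsNegative Eq p m d v h q (φ c) (fun t i r l => φ (x t i r l)) := by
  simp only [IsNegative, hφ, map_sum, map_mul, map_zero, map_add, apply_ite φ, map_opEntry]

end CertificateMaps

section CertificateScale

variable {R : Type*} [CommRing R] {p m d b v h q K : ℕ}
  {c : R} {x : Cells R} {num den : ℕ → ℕ → ℕ → R}

theorem conv_mul_left (e : R) (b b' : ℕ) (f g : ℕ → R) (n : ℕ) :
    conv b b' (fun i => e * f i) g n = e * conv b b' f g n := by
  simp only [conv, Finset.mul_sum, mul_ite, mul_zero, mul_assoc]

theorem conv_mul_right (e : R) (b b' : ℕ) (f g : ℕ → R) (n : ℕ) :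
    conv b b' f (fun i => e * g i) n = e * conv b b' f g n := by
  simp only [conv, Finset.mul_sum, mul_ite, mul_zero, mul_left_comm]

theorem opEntry_mul (e : R) (E : ℕ → ℕ → ℕ → R) (d p m L a b : ℕ) :
    opEntry (fun k r l => e * E k r l) d p m L a b = e * opEntry E d p m L a b := by
  simp only [opEntry, Finset.mul_sum, mul_ite, mul_zero]

variable (e : R)

/-- Homogeneity of the conditions, as in the five lemmas that follow: it serves to clear
denominators, and conversely to normalize c to 1. -/
theorem IsDenominator.scale (H : IsDenominator Eq m b h c x K num den) :
    IsDenominator Eq m b h (e * c) (fun t i r l => e * x t i r l) K num den := by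
  obtain ⟨h1, h2, h3⟩ := H
  refine ⟨h1, by simp only [h2], fun n hn r hr l hl => ?_⟩
  rw [conv_mul_left, conv_mul_left, h3 n hn r hr l hl]

theorem IsSingular.scale (H : IsSingular Eq m b c x) :
    IsSingular Eq m b (e * c) (fun t i r l => e * x t i r l) := by
  obtain ⟨h1, l, hl, k, hk, h2⟩ := H
  refine ⟨fun n hn r hr => ?_, l, hl, k, hk, by simp only [h2]⟩
  simp only [conv_mul_left, conv_mul_right, ← Finset.mul_sum, h1 n hn r hr, mul_zero]

theorem IsPseudoInverse.scale (H : IsPseudoInverse Eq m b v c x) :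
    IsPseudoInverse Eq m b v (e * c) (fun t i r l => e * x t i r l) := by
  obtain ⟨h1, h2, h3⟩ := H
  refine ⟨h1, by simp only [h2], fun n hn r hr s hs => ?_⟩
  simp only [conv_mul_left, conv_mul_right, ← Finset.mul_sum, h3 n hn r hr s hs]
  split_ifs <;> ring

theorem IsExpansion.scale {L : ℕ} (H : IsExpansion Eq m b c x L) :
    IsExpansion Eq m b (e * c) (fun t i r l => e * x t i r l) L := by
  intro n hn r hr l hl
  simp only [conv_mul_left, conv_mul_right, H n hn r hr l hl]
  split_ifs <;> ring

theorem IsPositive.scale (H : IsPositive Eq p m d v h c x) :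
    IsPositive Eq p m d v h (e * c) (fun t i r l => e * x t i r l) := by
  obtain ⟨h1, h2, h3, h4⟩ := H
  simp only [IsPositive, opEntry_mul, mul_mul_mul_comm e, ← Finset.mul_sum]
  refine ⟨fun a ha s hs => ?_, fun a ha s hs => ?_, fun a ha s hs => ?_, fun a ha s hs => ?_⟩
  · rw [h1 a ha s hs]
  · rw [h2 a ha s hs, mul_zero]
  · rw [h3 a ha s hs]
    split_ifs <;> ring
  · rw [h4 a ha s hs]
    split_ifs <;> ring

theorem IsNegative.scale (H : IsNegative Eq p m d v h q c x) :
    IsNegative Eq p m d v h q (e * c) (fun t i r l => e * x t i r l) := by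
  obtain ⟨h1, h2, h3, h4⟩ := H
  simp only [IsNegative, opEntry_mul, mul_mul_mul_comm e, ← Finset.mul_sum, ← mul_add]
  refine ⟨fun a ha s hs => ?_, fun t ht a ha s hs => ?_, fun t ht a ha s hs => ?_,
    fun a ha s hs => ?_⟩
  · rw [h1 a ha s hs, mul_ite, mul_zero]
  · rw [h2 t ht a ha s hs]
    ring
  · rw [h3 t ht a ha s hs]
    ring
  · rw [← h4 a ha s hs]
    ring

end CertificateScale

/-! ### What a certificate over a field with c = 1 means. -/

section CertificateMeaning

variable {F : Type*} [Field F]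

def toPoly (b : ℕ) (f : ℕ → F) : F[X] := ∑ i ∈ Finset.range b, C (f i) * X ^ i

theorem toPoly_coeff (b : ℕ) (f : ℕ → F) (n : ℕ) :
    (toPoly b f).coeff n = if n < b then f n else 0 := by
  simp only [toPoly, Polynomial.finsetSum_coeff, Polynomial.coeff_C_mul_X_pow,
    Finset.sum_ite_eq, Finset.mem_range]

theorem toPoly_of_natDegree_lt {P : F[X]} {b : ℕ} (h : P.natDegree < b) :
    toPoly b P.coeff = P := by
  ext n
  rw [toPoly_coeff]
  split_ifs with hn
  · rfl
  · exact (Polynomial.coeff_eq_zero_of_natDegree_lt (by omega)).symm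

theorem coeff_toPoly_mul (b b' : ℕ) (f g : ℕ → F) (n : ℕ) :
    (toPoly b f * toPoly b' g).coeff n = conv b b' f g n := by
  simp only [toPoly, Finset.sum_mul_sum, Polynomial.finsetSum_coeff, conv]
  refine Finset.sum_congr rfl fun i _ => Finset.sum_congr rfl fun k _ => ?_
  rw [mul_mul_mul_comm, ← Polynomial.C_mul, ← pow_add, Polynomial.coeff_C_mul_X_pow]
  exact if_congr eq_comm rfl rfl

/-- Because of this, comparing finitely many coefficients is enough to compare products of
polynomials. -/
theorem conv_eq_zero {b b' : ℕ} (f g : ℕ → F) {n : ℕ} (hn : b + b' ≤ n) :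
    conv b b' f g n = 0 := by
  refine Finset.sum_eq_zero fun i hi => Finset.sum_eq_zero fun k hk => if_neg ?_
  have := Finset.mem_range.1 hi
  have := Finset.mem_range.1 hk
  omega

theorem conv_eq_sum {b L : ℕ} (f g : ℕ → F) {n : ℕ} (hn : n < L) :
    conv b L f g n = ∑ i ∈ Finset.range (n + 1), (toPoly b f).coeff i * g (n - i) := by
  have h1 : ∀ i, ∑ k ∈ Finset.range L, (if i + k = n then f i * g k else 0) =
      if i < n + 1 then f i * g (n - i) else 0 := by
    intro i
    split_ifs with h
    · rw [Finset.sum_eq_single (n - i)]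
      · rw [if_pos (by omega)]
      · intro k _ hk
        rw [if_neg (by omega)]
      · intro hk
        exact absurd (Finset.mem_range.2 (by omega)) hk
    · exact Finset.sum_eq_zero fun k _ => if_neg (by omega)
  simp only [conv, h1, toPoly_coeff, ite_mul, zero_mul]
  rw [← Finset.sum_filter, ← Finset.sum_filter]
  refine Finset.sum_congr ?_ fun _ _ => rfl
  ext i
  simp only [Finset.mem_filter, Finset.mem_range]
  tauto

def toMat (a b : ℕ) (f : ℕ → ℕ → F) : Matrix (Fin a) (Fin b) F := Matrix.of fun i j => f i j

variable {p m d b v h q K : ℕ} {x : Cells F} {num den : ℕ → ℕ → ℕ → F}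

theorem isDenominator_iff : IsDenominator Eq m b h 1 x K num den ↔
    (toPoly b fun i => x 1 i 0 0).coeff h = 1 ∧ ∀ r < m, ∀ l < m,
      toPoly b (fun i => x 0 i r l) * toPoly K (den r l) =
        toPoly b (fun i => x 1 i 0 0) * toPoly K (num r l) := by
  constructor
  · rintro ⟨h1, h2, h3⟩
    refine ⟨by rw [toPoly_coeff, if_pos h1, h2], fun r hr l hl => ?_⟩
    ext n
    rw [coeff_toPoly_mul, coeff_toPoly_mul]
    by_cases hn : n < b + K
    · exact h3 n hn r hr l hl
    · rw [conv_eq_zero _ _ (by omega), conv_eq_zero _ _ (by omega)]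
  · rintro ⟨h1, h2⟩
    rw [toPoly_coeff] at h1
    split_ifs at h1 with h3
    · refine ⟨h3, h1, fun n _ r hr l hl => ?_⟩
      rw [← coeff_toPoly_mul, ← coeff_toPoly_mul, h2 r hr l hl]
    · exact absurd h1 zero_ne_one

def cellMatrix (m b : ℕ) (f : ℕ → ℕ → ℕ → F) : Matrix (Fin m) (Fin m) F[X] :=
  Matrix.of fun r l => toPoly b fun i => f i r l

theorem isPseudoInverse_iff : IsPseudoInverse Eq m b v 1 x ↔
    (toPoly b fun i => x 3 i 0 0).coeff 0 = 1 ∧ cellMatrix m b (x 0) * cellMatrix m b (x 2) =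
      (X ^ v * (toPoly b (fun i => x 1 i 0 0) * toPoly b fun i => x 3 i 0 0)) • 1 := by
  have key : ∀ (n : ℕ) (r s : Fin m),
      ((cellMatrix m b (x 0) * cellMatrix m b (x 2)) r s).coeff n =
        ∑ l ∈ Finset.range m, conv b b (fun i => x 0 i r l) (fun i => x 2 i l s) n ∧
      (((X ^ v * (toPoly b (fun i => x 1 i 0 0) * toPoly b fun i => x 3 i 0 0)) •
        (1 : Matrix (Fin m) (Fin m) F[X])) r s).coeff n = if (r : ℕ) = s ∧ v ≤ n then
          conv b b (fun i => x 1 i 0 0) (fun i => x 3 i 0 0) (n - v) else 0 := by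
    intro n r s
    constructor
    · simp only [Matrix.mul_apply, cellMatrix, Matrix.of_apply, Polynomial.finsetSum_coeff,
        coeff_toPoly_mul, Finset.sum_range]
    · rw [Matrix.smul_apply, Matrix.one_apply, smul_eq_mul]
      by_cases hrs : r = s
      · simp only [hrs, if_true, mul_one, true_and]
        rw [Polynomial.coeff_X_pow_mul', coeff_toPoly_mul]
      · have hrs' : (r : ℕ) ≠ s := fun h => hrs (Fin.ext h)
        simp [hrs, hrs']
  constructor
  · rintro ⟨h1, h2, h3⟩
    refine ⟨by rw [toPoly_coeff, if_pos h1, h2], ?_⟩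
    ext r s n
    rw [(key n r s).1, (key n r s).2]
    by_cases hn : n < b + b + v
    · exact h3 n hn r r.2 s s.2
    · rw [Finset.sum_eq_zero fun l _ => conv_eq_zero _ _ (by omega), conv_eq_zero _ _ (by omega),
        ite_self]
  · rintro ⟨h1, h2⟩
    rw [toPoly_coeff] at h1
    split_ifs at h1 with h3
    · refine ⟨h3, h1, fun n _ r hr s hs => ?_⟩
      have := (key n ⟨r, hr⟩ ⟨s, hs⟩)
      rw [← this.1, ← this.2, h2]
    · exact absurd h1 zero_ne_one

theorem isSingular_iff : IsSingular Eq m b 1 x ↔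
    (cellMatrix m b (x 0)).mulVec (fun l => toPoly b fun i => x 2 i l 0) = 0 ∧
      ∃ (l : Fin m) (k : ℕ), (toPoly b fun i => x 2 i l 0).coeff k = 1 := by
  have key : ∀ (n : ℕ) (r : Fin m),
      ((cellMatrix m b (x 0)).mulVec (fun l => toPoly b fun i => x 2 i l 0) r).coeff n =
        ∑ l ∈ Finset.range m, conv b b (fun i => x 0 i r l) (fun i => x 2 i l 0) n := by
    intro n r
    simp only [Matrix.mulVec, dotProduct, cellMatrix, Matrix.of_apply, Polynomial.finsetSum_coeff,
        coeff_toPoly_mul, Finset.sum_range]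
  constructor
  · rintro ⟨h1, l, hl, k, hk, h2⟩
    refine ⟨?_, ⟨l, hl⟩, k, by rw [toPoly_coeff, if_pos hk, h2]⟩
    ext r n
    rw [key, Pi.zero_apply, Polynomial.coeff_zero]
    by_cases hn : n < b + b
    · exact h1 n hn r r.2
    · rw [Finset.sum_eq_zero fun l _ => conv_eq_zero _ _ (by omega)]
  · rintro ⟨h1, l, k, h2⟩
    rw [toPoly_coeff] at h2
    split_ifs at h2 with h3
    · refine ⟨fun n _ r hr => ?_, l, l.2, k, h3, h2⟩
      rw [← key n ⟨r, hr⟩, h1]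
      rfl
    · exact absurd h2 zero_ne_one

theorem isExpansion_iff {L : ℕ} : IsExpansion Eq m b 1 x L ↔
    ∀ n < L, ∀ r l : Fin m, ∑ i ∈ Finset.range (n + 1),
      (toPoly b fun i => x 3 i 0 0).coeff i * x 4 (n - i) r l =
        (cellMatrix m b (x 2) r l).coeff n := by
  refine forall₂_congr fun n hn => ?_
  simp only [Fin.forall_iff, conv_eq_sum _ _ hn, cellMatrix, Matrix.of_apply, toPoly_coeff,
    one_mul]

theorem isPositive_iff : IsPositive Eq p m d v h 1 x ↔
    opM (x 4) d p m v h * toMat (winSize d v h * m) m (x 5 0) =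
      toMat (winSize d v h * m) m (x 5 0) * toMat m m (x 6 0) ∧
    opN (x 4) d p m v h * toMat (winSize d v h * m) m (x 5 0) = 0 ∧
    toMat m m (x 6 0) * toMat m m (x 7 0) = 1 ∧
    toMat m (winSize d v h * m) (x 8 0) * toMat (winSize d v h * m) m (x 5 0) = 1 := by
  simp only [IsPositive, ← Matrix.ext_iff, Matrix.mul_apply, Fin.forall_iff, Finset.sum_range,
    opM, opN, toMat, Matrix.of_apply, Matrix.zero_apply, Matrix.one_apply, Fin.mk.injEq, mul_one]

theorem isNegative_iff : IsNegative Eq p m d v h q 1 x ↔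
    toMat (winSize d v h * m) (winSize d v h * m) (x 5 0) = (1 : Matrix (Fin (winSize d v h * m)) (Fin (winSize d v h * m)) F) ∧
    (∀ t < q + 1, opM (x 4) d p m v h * toMat (winSize d v h * m) (winSize d v h * m) (x 5 t) =
      toMat (winSize d v h * m) (winSize d v h * m) (x 5 (t + 1))) ∧
    (∀ t < q + 1, opN (x 4) d p m v h * toMat (winSize d v h * m) (winSize d v h * m) (x 5 t) =
      toMat (lowSize d p v h * m) (winSize d v h * m) (x 6 t)) ∧
    toMat (winSize d v h * m) (winSize d v h * m) (x 5 (q + 1)) =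
      toMat (winSize d v h * m) (m - 1) (x 8 0) * toMat (m - 1) (winSize d v h * m) (x 9 0) +
        ∑ t ∈ Finset.range (q + 1), toMat (winSize d v h * m) (lowSize d p v h * m) (x 7 t) *
          toMat (lowSize d p v h * m) (winSize d v h * m) (x 6 t) := by
  simp only [IsNegative, ← Matrix.ext_iff, Matrix.mul_apply, Fin.forall_iff, Finset.sum_range,
    opM, opN, toMat, Matrix.of_apply, Matrix.one_apply, Fin.mk.injEq, one_mul,
    Matrix.add_apply, Matrix.sum_apply]

theorem IsPositive.le_finrank (H : IsPositive Eq p m d v h 1 x) :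
    m ≤ Module.finrank F (core (opM (x 4) d p m v h) (opN (x 4) d p m v h)) := by
  obtain ⟨h1, h2, h3, h4⟩ := isPositive_iff.1 H
  exact le_finrank_core h1 h2 h3 h4

/-- Cell 5 holds the powers of M and cell 6 the products N M^t, so the last condition is the
factorization required by `finrank_core_le`. -/
theorem IsNegative.finrank_le (H : IsNegative Eq p m d v h q 1 x) :
    Module.finrank F (core (opM (x 4) d p m v h) (opN (x 4) d p m v h)) ≤ m - 1 := by
  obtain ⟨h1, h2, h3, h4⟩ := isNegative_iff.1 H
  have h5 : ∀ t ≤ q + 1, toMat _ _ (x 5 t) = opM (x 4) d p m v h ^ t := by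
    intro t
    induction t with
    | zero => intro _; rw [h1, pow_zero]
    | succ t ih => intro ht; rw [← h2 t (by omega), ih (by omega), pow_succ']
  rw [h5 _ le_rfl] at h4
  refine finrank_core_le (q := q) (J' := toMat _ (m - 1) (x 8 0)) (J := toMat _ _ (x 9 0))
    (C := fun t => toMat (winSize d v h * m) (lowSize d p v h * m) (x 7 t)) (h4.trans ?_)
  congr 1
  refine Finset.sum_congr rfl fun t ht => ?_
  have := Finset.mem_range.1 ht
  rw [← h3 t this, h5 t (by omega)]

variable {A : Matrix.GeneralLinearGroup (Fin m) (RatFunc F)}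

theorem IsDenominator.mul_eq (H : IsDenominator Eq m b h 1 x K num den)
    (hden : ∀ r l : Fin m, toPoly K (den r l) ≠ 0)
    (hA : ∀ r l : Fin m, A.1 r l = algebraMap F[X] (RatFunc F) (toPoly K (num r l)) /
      algebraMap F[X] (RatFunc F) (toPoly K (den r l))) (r l : Fin m) :
    A.1 r l * algebraMap F[X] (RatFunc F) (toPoly b fun i => x 1 i 0 0) =
      algebraMap F[X] (RatFunc F) (cellMatrix m b (x 0) r l) := by
  have h0 : algebraMap F[X] (RatFunc F) (toPoly K (den r l)) ≠ 0 :=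
    (map_ne_zero_iff _ (RatFunc.algebraMap_injective F)).2 (hden r l)
  rw [hA, div_mul_eq_mul_div, div_eq_iff h0, ← map_mul, ← map_mul, cellMatrix, Matrix.of_apply,
    (isDenominator_iff.1 H).2 r r.2 l l.2, mul_comm]

theorem IsSingular.false (H : IsSingular Eq m b 1 x)
    (H0 : IsDenominator Eq m b h 1 x K num den)
    (hden : ∀ r l : Fin m, toPoly K (den r l) ≠ 0)
    (hA : ∀ r l : Fin m, A.1 r l = algebraMap F[X] (RatFunc F) (toPoly K (num r l)) /
      algebraMap F[X] (RatFunc F) (toPoly K (den r l))) : False := by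
  obtain ⟨h1, l, k, h2⟩ := isSingular_iff.1 H
  set w : Fin m → F[X] := fun l => toPoly b fun i => x 2 i l 0
  have h3 : A.1.mulVec (fun l => algebraMap F[X] (RatFunc F) (w l)) = 0 := by
    funext r
    have hΔ : algebraMap F[X] (RatFunc F) (toPoly b fun i => x 1 i 0 0) ≠ 0 := by
      rw [map_ne_zero_iff _ (RatFunc.algebraMap_injective F)]
      intro h0
      have := (isDenominator_iff.1 H0).1
      rw [h0] at this
      simp at this
    refine mul_left_cancel₀ hΔ ?_
    have h4 := congrArg (algebraMap F[X] (RatFunc F)) (congrFun h1 r)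
    simp only [Matrix.mulVec, dotProduct, map_sum, map_mul, ← H0.mul_eq hden hA] at h4 ⊢
    rw [Finset.mul_sum, Pi.zero_apply, mul_zero, ← map_zero (algebraMap F[X] (RatFunc F))]
    refine Eq.trans (Finset.sum_congr rfl fun l _ => ?_) h4
    ring
  have h5 : (fun l => algebraMap F[X] (RatFunc F) (w l)) = 0 := by
    have h6 : A⁻¹.1 * A.1 = 1 := A.inv_mul
    rw [← Matrix.one_mulVec fun l => algebraMap F[X] (RatFunc F) (w l), ← h6,
      ← Matrix.mulVec_mulVec, h3, Matrix.mulVec_zero]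
  have h6 : w l = 0 := RatFunc.algebraMap_injective F ((congrFun h5 l).trans (map_zero _).symm)
  rw [show (toPoly b fun i => x 2 i l 0) = 0 from h6] at h2
  simp at h2

/-- From P = Δ A and P N = z^v Δ δ, cancelling Δ gives A N = z^v δ, the hypothesis of
`le_finrank_spaceX_iff`. -/
theorem le_finrank_spaceX_iff_of_isExpansion (hp : 2 ≤ p) (hm : 1 ≤ m) (hd : d ≠ 0)
    (H0 : IsDenominator Eq m b h 1 x K num den)
    (hden : ∀ r l : Fin m, toPoly K (den r l) ≠ 0)
    (hA : ∀ r l : Fin m, A.1 r l = algebraMap F[X] (RatFunc F) (toPoly K (num r l)) /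
      algebraMap F[X] (RatFunc F) (toPoly K (den r l)))
    (H1 : IsPseudoInverse Eq m b v 1 x)
    (H2 : IsExpansion Eq m b 1 x (lowSize d p v h + winSize d v h)) :
    (m ≤ Module.finrank F (spaceX p A d) ↔
      m ≤ Module.finrank F (core (opM (x 4) d p m v h) (opN (x 4) d p m v h))) ∧
    Module.finrank F (core (opM (x 4) d p m v h) (opN (x 4) d p m v h)) ≤ m := by
  have hΔ := (isDenominator_iff.1 H0).1
  obtain ⟨h1, h2⟩ := isPseudoInverse_iff.1 H1
  have hΔ0 : algebraMap F[X] (RatFunc F) (toPoly b fun i => x 1 i 0 0) ≠ 0 := by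
    rw [map_ne_zero_iff _ (RatFunc.algebraMap_injective F)]
    intro h0
    rw [h0] at hΔ
    simp at hΔ
  refine le_finrank_spaceX_iff hp hm hd A (δ := toPoly b fun i => x 3 i 0 0)
    (N := cellMatrix m b (x 2)) (h1 ▸ one_ne_zero) ?_ (hΔ ▸ one_ne_zero) (H0.mul_eq hden hA)
    (isExpansion_iff.1 H2)
  ext r s
  refine mul_left_cancel₀ hΔ0 ?_
  have h3 := congrArg (algebraMap F[X] (RatFunc F)) (congrFun (congrFun h2 r) s)
  simp only [Matrix.mul_apply, map_sum, map_mul, ← H0.mul_eq hden hA, Matrix.smul_apply,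
    smul_eq_mul, Matrix.map_apply, Finset.mul_sum] at h3 ⊢
  refine Eq.trans (Finset.sum_congr rfl fun l _ => ?_) (h3.trans ?_)
  · ring
  · simp only [Matrix.one_apply, apply_ite (algebraMap F[X] (RatFunc F)), map_one, map_zero]
    ring

end CertificateMeaning

/-! ### Existence of certificates over an arbitrary field. -/

section CertificateExistence

variable {F : Type*} [Field F]

/-- Cells without nonzero entries outside a finite range of addresses. -/
def IsBounded (x : Cells F) : Prop :=
  ∃ I : ℕ, ∀ t i r l, I ≤ t ∨ I ≤ i ∨ I ≤ r ∨ I ≤ l → x t i r l = 0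

def seqCell {a b : ℕ} (n : ℕ) (M : ℕ → Matrix (Fin a) (Fin b) F) : ℕ → ℕ → ℕ → F :=
  fun t r l => if h : t < n ∧ r < a ∧ l < b then M t ⟨r, h.2.1⟩ ⟨l, h.2.2⟩ else 0

theorem seqCell_apply {a b n : ℕ} (M : ℕ → Matrix (Fin a) (Fin b) F) {t : ℕ} (ht : t < n)
    (r : Fin a) (l : Fin b) : seqCell n M t r l = M t r l :=
  dif_pos ⟨ht, r.2, l.2⟩

theorem toMat_seqCell {a b n : ℕ} (M : ℕ → Matrix (Fin a) (Fin b) F) {t : ℕ} (ht : t < n) :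
    toMat a b (seqCell n M t) = M t := by
  ext r l
  exact seqCell_apply M ht r l

def polyCell {a b : ℕ} (n : ℕ) (P : Matrix (Fin a) (Fin b) F[X]) : ℕ → ℕ → ℕ → F :=
  seqCell n fun i => P.map fun f => f.coeff i

theorem toPoly_polyCell {a b n : ℕ} (P : Matrix (Fin a) (Fin b) F[X])
    (hP : ∀ r l, (P r l).natDegree < n) (r : Fin a) (l : Fin b) :
    toPoly n (fun i => polyCell n P i r l) = P r l := by
  rw [← toPoly_of_natDegree_lt (hP r l)]
  refine Finset.sum_congr rfl fun i hi => ?_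
  exact congrArg (fun a => C a * X ^ i)
    (seqCell_apply (fun i => P.map fun f => f.coeff i) (Finset.mem_range.1 hi) r l)

def singleCell (n : ℕ) (f : F[X]) : ℕ → ℕ → ℕ → F :=
  polyCell n (Matrix.of fun _ _ : Fin 1 => f)

theorem toPoly_singleCell {n : ℕ} (f : F[X]) (hf : f.natDegree < n) :
    toPoly n (fun i => singleCell n f i 0 0) = f :=
  toPoly_polyCell _ (fun _ _ => hf) 0 0

theorem cellMatrix_polyCell {m n : ℕ} (P : Matrix (Fin m) (Fin m) F[X])
    (hP : ∀ r l, (P r l).natDegree < n) : cellMatrix m n (polyCell n P) = P := by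
  ext1 r l
  exact toPoly_polyCell P hP r l

def cellsOfList (fs : List (ℕ → ℕ → ℕ → F)) : Cells F := fun t => fs.getD t 0

theorem isBounded_cellsOfList (fs : List (ℕ → ℕ → ℕ → F))
    (h : ∀ f ∈ fs, ∃ I : ℕ, ∀ i r l, I ≤ i ∨ I ≤ r ∨ I ≤ l → f i r l = 0) :
    IsBounded (cellsOfList fs) := by
  induction fs with
  | nil => exact ⟨0, fun t i r l _ => rfl⟩
  | cons f fs ih =>
    obtain ⟨I, hI⟩ := ih fun g hg => h g (List.mem_cons_of_mem _ hg)
    obtain ⟨I', hI'⟩ := h f List.mem_cons_self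
    refine ⟨I + I' + 1, fun t i r l ht => ?_⟩
    rcases t with _ | t
    · exact hI' i r l (by omega)
    · exact hI t i r l (by omega)

theorem seqCell_eq_zero {a b : ℕ} (n : ℕ) (M : ℕ → Matrix (Fin a) (Fin b) F) :
    ∃ I : ℕ, ∀ i r l, I ≤ i ∨ I ≤ r ∨ I ≤ l → seqCell n M i r l = 0 :=
  ⟨n + a + b, fun i r l h => dif_neg (by omega)⟩

/-- Take the product of all denominators, made monic, and its degree for h. -/
theorem exists_common_denominator {m : ℕ} (num den : Matrix (Fin m) (Fin m) F[X])
    (hden : ∀ r l, den r l ≠ 0) : ∃ (Δ : F[X]) (P : Matrix (Fin m) (Fin m) F[X]) (h : ℕ),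
      Δ.coeff h = 1 ∧ ∀ r l, P r l * den r l = Δ * num r l := by
  obtain ⟨D, hDdef⟩ : ∃ D : F[X], D = ∏ i : Fin m × Fin m, den i.1 i.2 := ⟨_, rfl⟩
  have hD : D ≠ 0 := hDdef ▸ Finset.prod_ne_zero_iff.2 fun i _ => hden _ _
  have hdvd : ∀ r l, den r l ∣ D := fun r l => hDdef ▸
    Finset.dvd_prod_of_mem (fun i : Fin m × Fin m => den i.1 i.2) (Finset.mem_univ (r, l))
  choose Q hQ using hdvd
  have hlc : D.leadingCoeff ≠ 0 := Polynomial.leadingCoeff_ne_zero.2 hD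
  refine ⟨C D.leadingCoeff⁻¹ * D, Matrix.of fun r l => C D.leadingCoeff⁻¹ * (Q r l * num r l),
    D.natDegree, ?_, fun r l => ?_⟩
  · rw [Polynomial.coeff_C_mul]
    exact inv_mul_cancel₀ hlc
  · rw [Matrix.of_apply]
    calc _ = C D.leadingCoeff⁻¹ * (den r l * Q r l) * num r l := by ring
      _ = _ := by rw [← hQ r l]

theorem exists_natDegree_lt {ι : Type*} [Fintype ι] (f : ι → F[X]) :
    ∃ b, ∀ i, (f i).natDegree < b :=
  ⟨Finset.univ.sup (fun i => (f i).natDegree) + 1, fun i => Nat.lt_succ_of_le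
    (Finset.le_sup (f := fun i => (f i).natDegree) (Finset.mem_univ i))⟩

theorem exists_eq_X_pow_mul {f : F[X]} (hf : f ≠ 0) :
    ∃ (v : ℕ) (g : F[X]), f = X ^ v * g ∧ g.coeff 0 ≠ 0 := by
  obtain ⟨g, hg, hdvd⟩ := Polynomial.exists_eq_pow_rootMultiplicity_mul_and_not_dvd f hf 0
  rw [map_zero, sub_zero] at hg hdvd
  exact ⟨_, g, hg, fun h => hdvd (Polynomial.X_dvd_iff.2 h)⟩

/-- A pseudo-inverse of a regular matrix of polynomials. -/
theorem exists_pseudoInverse {m : ℕ} (P : Matrix (Fin m) (Fin m) F[X]) (hP : P.det ≠ 0)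
    (Δ : F[X]) : ∃ (v : ℕ) (δ : F[X]) (N : Matrix (Fin m) (Fin m) F[X]),
      δ.coeff 0 = 1 ∧ P * N = (X ^ v * (Δ * δ)) • 1 := by
  -- The adjugate inverts P up to det P = z^v g with g(0) ≠ 0, which is then rescaled to constant
  -- term 1.
  obtain ⟨v, g, hg, hg0⟩ := exists_eq_X_pow_mul hP
  refine ⟨v, C (g.coeff 0)⁻¹ * g, (C (g.coeff 0)⁻¹ * Δ) • P.adjugate, ?_, ?_⟩
  · rw [Polynomial.coeff_C_mul, inv_mul_cancel₀ hg0]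
  · rw [Matrix.mul_smul, Matrix.mul_adjugate, smul_smul, hg]
    congr 1
    ring

theorem exists_expansion {m : ℕ} (δ : F[X]) (hδ : δ.coeff 0 = 1)
    (N : Matrix (Fin m) (Fin m) F[X]) : ∃ E : ℕ → Matrix (Fin m) (Fin m) F, ∀ n r l,
      ∑ i ∈ Finset.range (n + 1), δ.coeff i * E (n - i) r l = (N r l).coeff n := by
  refine ⟨fun k => Matrix.of fun r l =>
    PowerSeries.coeff k ((N r l : PowerSeries F) * (δ : PowerSeries F)⁻¹), fun n r l => ?_⟩
  have h : (δ : PowerSeries F) * ((N r l : PowerSeries F) * (δ : PowerSeries F)⁻¹) = N r l := by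
    rw [mul_left_comm, PowerSeries.mul_inv_cancel _ (by
      rw [← PowerSeries.coeff_zero_eq_constantCoeff_apply, Polynomial.coeff_coe, hδ]
      exact one_ne_zero), mul_one]
  have h1 := congrArg (PowerSeries.coeff n) h
  rw [PowerSeries.coeff_mul, Polynomial.coeff_coe,
    Finset.Nat.sum_antidiagonal_eq_sum_range_succ fun i j =>
      PowerSeries.coeff i (δ : PowerSeries F) * PowerSeries.coeff j _] at h1
  rw [← h1]
  exact Finset.sum_congr rfl fun i _ => by rw [Polynomial.coeff_coe]; rfl

theorem exists_singular_certificate {m : ℕ} (P : Matrix (Fin m) (Fin m) F[X]) (hP : P.det = 0) :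
    ∃ w : Fin m → F[X], P.mulVec w = 0 ∧ ∃ l k, (w l).coeff k = 1 := by
  obtain ⟨w, hw0, hw⟩ := Matrix.exists_mulVec_eq_zero_iff.2 hP
  obtain ⟨l, hl⟩ := Function.ne_iff.1 hw0
  have hlc : (w l).leadingCoeff ≠ 0 := Polynomial.leadingCoeff_ne_zero.2 hl
  refine ⟨C (w l).leadingCoeff⁻¹ • w, by rw [Matrix.mulVec_smul, hw, smul_zero], l,
    (w l).natDegree, ?_⟩
  rw [Pi.smul_apply, smul_eq_mul, Polynomial.coeff_C_mul]
  exact inv_mul_cancel₀ hlc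

/-- If the matrix is singular, a kernel vector certifies this. Otherwise it lies in GL_m, so the
frame argument bounds the core of its window operator by m; the dimension is m or at most m - 1, and
each alternative has its matrix identities. The field is arbitrary so that the cells can be taken in
ℚ(α). -/
theorem exists_certificate {p m d K : ℕ} (hp : 2 ≤ p) (hm : 1 ≤ m) (hd : d ≠ 0)
    (num den : ℕ → ℕ → ℕ → F) (hden : ∀ r l : Fin m, toPoly K (den r l) ≠ 0) :
    ∃ (b v h q : ℕ) (x : Cells F), IsBounded x ∧ IsDenominator Eq m b h 1 x K num den ∧
      (IsSingular Eq m b 1 x ∨ IsPseudoInverse Eq m b v 1 x ∧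
        IsExpansion Eq m b 1 x (lowSize d p v h + winSize d v h) ∧
        (IsPositive Eq p m d v h 1 x ∨ IsNegative Eq p m d v h q 1 x)) := by
  obtain ⟨Δ, P, h, hΔ, hP⟩ := exists_common_denominator
    (Matrix.of fun r l : Fin m => toPoly K (num r l)) (Matrix.of fun r l => toPoly K (den r l)) hden
  obtain ⟨b₁, hb₁⟩ := exists_natDegree_lt fun i : Fin m × Fin m => P i.1 i.2
  have hden' : ∀ (b : ℕ) (fs : List (ℕ → ℕ → ℕ → F)), Δ.natDegree < b →
      (∀ r l, (P r l).natDegree < b) →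
      IsDenominator Eq m b h 1 (cellsOfList (polyCell b P :: singleCell b Δ :: fs)) K num den := by
    intro b fs h1 h2
    refine isDenominator_iff.2 ⟨?_, fun r hr l hl => ?_⟩
    · change (toPoly b fun i => singleCell b Δ i 0 0).coeff h = 1
      rw [toPoly_singleCell _ h1, hΔ]
    · change toPoly b (fun i => polyCell b P i r l) * _ =
        toPoly b (fun i => singleCell b Δ i 0 0) * _
      rw [toPoly_singleCell _ h1]
      have := toPoly_polyCell P h2 ⟨r, hr⟩ ⟨l, hl⟩
      exact (congrArg (· * toPoly K (den r l)) this).trans (hP ⟨r, hr⟩ ⟨l, hl⟩)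
  by_cases hdet : P.det = 0
  · obtain ⟨w, hw, l, k, hlk⟩ := exists_singular_certificate P hdet
    obtain ⟨b₂, hb₂⟩ := exists_natDegree_lt w
    let b := b₁ + b₂ + Δ.natDegree + 1
    have hb1 : ∀ r l, (P r l).natDegree < b := fun r l => (hb₁ (r, l)).trans_le (by omega)
    let W : Matrix (Fin m) (Fin 1) F[X] := Matrix.of fun l _ => w l
    have hW : ∀ l : Fin m, toPoly b (fun i => polyCell b W i l 0) = w l := fun l =>
      toPoly_polyCell W (fun l _ => (hb₂ l).trans_le (by omega)) l 0
    refine ⟨b, 0, h, 0, cellsOfList [polyCell b P, singleCell b Δ, polyCell b W],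
      isBounded_cellsOfList _ ?_, hden' b _ (by omega) hb1, Or.inl (isSingular_iff.2 ⟨?_, l, k, ?_⟩)⟩
    · simp only [List.forall_mem_cons]
      exact ⟨seqCell_eq_zero _ _, seqCell_eq_zero _ _, seqCell_eq_zero _ _, by simp⟩
    · change (cellMatrix m b (polyCell b P)).mulVec
        (fun l => toPoly b fun i => polyCell b W i l 0) = 0
      simp only [hW, cellMatrix_polyCell P hb1]
      exact hw
    · change (toPoly b fun i => polyCell b W i l 0).coeff k = 1
      rw [hW, hlk]
  · obtain ⟨v, δ, N, hδ, hN⟩ := exists_pseudoInverse P hdet Δ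
    obtain ⟨E, hE⟩ := exists_expansion δ hδ N
    obtain ⟨b₂, hb₂⟩ := exists_natDegree_lt fun i : Fin m × Fin m => N i.1 i.2
    let b := b₁ + b₂ + Δ.natDegree + δ.natDegree + 1
    have hb1 : ∀ r l, (P r l).natDegree < b := fun r l => (hb₁ (r, l)).trans_le (by omega)
    have hb2 : ∀ r l, (N r l).natDegree < b := fun r l => (hb₂ (r, l)).trans_le (by omega)
    have hΔ0 : Δ ≠ 0 := by rintro rfl; simp at hΔ
    let L := lowSize d p v h + winSize d v h
    have hH1 : ∀ fs, IsDenominator Eq m b h 1 (cellsOfList (polyCell b P :: singleCell b Δ :: fs))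
        K num den := fun fs => hden' b fs (by omega) hb1
    have hH2 : ∀ fs, IsPseudoInverse Eq m b v 1 (cellsOfList (polyCell b P :: singleCell b Δ ::
        polyCell b N :: singleCell b δ :: fs)) := by
      intro fs
      have h1 := toPoly_singleCell (n := b) Δ (by omega)
      have h2 := toPoly_singleCell (n := b) δ (by omega)
      refine isPseudoInverse_iff.2 ⟨?_, ?_⟩
      · change (toPoly b fun i => singleCell b δ i 0 0).coeff 0 = 1
        rw [h2, hδ]
      · change cellMatrix m b (polyCell b P) * cellMatrix m b (polyCell b N) =
          (X ^ v * (toPoly b (fun i => singleCell b Δ i 0 0) *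
            toPoly b fun i => singleCell b δ i 0 0)) • 1
        rw [h1, h2, cellMatrix_polyCell P hb1, cellMatrix_polyCell N hb2, hN]
    have hH3 : ∀ fs, IsExpansion Eq m b 1 (cellsOfList (polyCell b P :: singleCell b Δ ::
        polyCell b N :: singleCell b δ :: seqCell L E :: fs)) L := by
      intro fs
      refine isExpansion_iff.2 fun n hn r l => ?_
      change ∑ i ∈ Finset.range (n + 1), (toPoly b fun i => singleCell b δ i 0 0).coeff i *
        seqCell L E (n - i) r l = (cellMatrix m b (polyCell b N) r l).coeff n
      rw [cellMatrix_polyCell N hb2, toPoly_singleCell (n := b) δ (by omega), ← hE]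
      exact Finset.sum_congr rfl fun i _ => by rw [seqCell_apply _ (by omega)]
    let A' : Matrix (Fin m) (Fin m) (RatFunc F) := Matrix.of fun r l =>
      algebraMap F[X] (RatFunc F) (toPoly K (num r l)) /
        algebraMap F[X] (RatFunc F) (toPoly K (den r l))
    have hA' : algebraMap F[X] (RatFunc F) Δ • A' = P.map (algebraMap F[X] (RatFunc F)) := by
      ext1 r l
      have h0 : algebraMap F[X] (RatFunc F) (toPoly K (den r l)) ≠ 0 :=
        (map_ne_zero_iff _ (RatFunc.algebraMap_injective F)).2 (hden r l)
      change algebraMap F[X] (RatFunc F) Δ * (algebraMap F[X] (RatFunc F) (toPoly K (num r l)) /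
        algebraMap F[X] (RatFunc F) (toPoly K (den r l))) = algebraMap F[X] (RatFunc F) (P r l)
      rw [← mul_div_assoc, div_eq_iff h0, ← map_mul, ← map_mul]
      exact congrArg _ (hP r l).symm
    have hdetA : A'.det ≠ 0 := by
      intro h0
      have h1 := congrArg Matrix.det hA'
      rw [Matrix.det_smul, h0, mul_zero] at h1
      have h2 : (P.map (algebraMap F[X] (RatFunc F))).det = algebraMap F[X] (RatFunc F) P.det :=
        (RingHom.map_det _ _).symm
      rw [h2] at h1
      exact hdet ((map_eq_zero_iff _ (RatFunc.algebraMap_injective F)).1 h1.symm)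
    let A := Matrix.GeneralLinearGroup.mkOfDetNeZero A' hdetA
    have hcore : Module.finrank F (core (opM (seqCell L E) d p m v h)
        (opN (seqCell L E) d p m v h)) ≤ m :=
      (le_finrank_spaceX_iff_of_isExpansion (A := A) hp hm hd (hH1 _) hden (fun _ _ => rfl)
        (hH2 _) (hH3 [])).2
    rcases hcore.eq_or_lt with heq | hlt
    · obtain ⟨u, Λ, Γ, J, h1, h2, h3, h4⟩ := exists_of_finrank_core_eq heq
      refine ⟨b, v, h, 0, cellsOfList [polyCell b P, singleCell b Δ, polyCell b N, singleCell b δ,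
        seqCell L E, seqCell 1 fun _ => u, seqCell 1 fun _ => Λ, seqCell 1 fun _ => Γ,
        seqCell 1 fun _ => J], isBounded_cellsOfList _ ?_, hH1 _,
        Or.inr ⟨hH2 _, hH3 _, Or.inl (isPositive_iff.2 ?_)⟩⟩
      · simp only [List.forall_mem_cons]
        exact ⟨seqCell_eq_zero _ _, seqCell_eq_zero _ _, seqCell_eq_zero _ _, seqCell_eq_zero _ _,
          seqCell_eq_zero _ _, seqCell_eq_zero _ _, seqCell_eq_zero _ _, seqCell_eq_zero _ _,
          seqCell_eq_zero _ _, by simp⟩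
      · change opM (seqCell L E) d p m v h * toMat _ m (seqCell 1 (fun _ => u) 0) =
            toMat _ m (seqCell 1 (fun _ => u) 0) * toMat m m (seqCell 1 (fun _ => Λ) 0) ∧
          opN (seqCell L E) d p m v h * toMat _ m (seqCell 1 (fun _ => u) 0) = 0 ∧
          toMat m m (seqCell 1 (fun _ => Λ) 0) * toMat m m (seqCell 1 (fun _ => Γ) 0) = 1 ∧
          toMat m _ (seqCell 1 (fun _ => J) 0) * toMat _ m (seqCell 1 (fun _ => u) 0) = 1
        rw [toMat_seqCell _ one_pos, toMat_seqCell _ one_pos, toMat_seqCell _ one_pos,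
          toMat_seqCell _ one_pos]
        exact ⟨h1, h2, h3, h4⟩
    · obtain ⟨q, C', J', J, hq⟩ := exists_of_finrank_core_le
        (opM (seqCell L E) d p m v h) (opN (seqCell L E) d p m v h) (r := m - 1) (by omega)
      let M := opM (seqCell L E) d p m v h
      refine ⟨b, v, h, q, cellsOfList [polyCell b P, singleCell b Δ, polyCell b N, singleCell b δ,
        seqCell L E, seqCell (q + 2) fun t => M ^ t,
        seqCell (q + 1) fun t => opN (seqCell L E) d p m v h * M ^ t, seqCell (q + 1) C',
        seqCell 1 fun _ => J', seqCell 1 fun _ => J], isBounded_cellsOfList _ ?_, hH1 _,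
        Or.inr ⟨hH2 _, hH3 _, Or.inr (isNegative_iff.2 ?_)⟩⟩
      · simp only [List.forall_mem_cons]
        exact ⟨seqCell_eq_zero _ _, seqCell_eq_zero _ _, seqCell_eq_zero _ _, seqCell_eq_zero _ _,
          seqCell_eq_zero _ _, seqCell_eq_zero _ _, seqCell_eq_zero _ _, seqCell_eq_zero _ _,
          seqCell_eq_zero _ _, seqCell_eq_zero _ _, by simp⟩
      · have e5 : ∀ t < q + 2, toMat (winSize d v h * m) (winSize d v h * m)
            (seqCell (q + 2) (fun t => M ^ t) t) = M ^ t := fun t ht => toMat_seqCell _ ht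
        have e6 : ∀ t < q + 1, toMat (lowSize d p v h * m) (winSize d v h * m)
            (seqCell (q + 1) (fun t => opN (seqCell L E) d p m v h * M ^ t) t) =
            opN (seqCell L E) d p m v h * M ^ t := fun t ht => toMat_seqCell _ ht
        refine ⟨(e5 0 (by omega)).trans (pow_zero _), fun t ht => ?_, fun t ht => ?_, ?_⟩
        · exact (congrArg (M * ·) (e5 t (by omega))).trans
            ((pow_succ' M t).symm.trans (e5 (t + 1) (by omega)).symm)
        · exact (congrArg (opN (seqCell L E) d p m v h * ·) (e5 t (by omega))).trans
            (e6 t ht).symm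
        · refine (e5 (q + 1) (by omega)).trans (hq.trans ?_)
          congr 1
          · exact congrArg₂ (· * ·) (toMat_seqCell (fun _ => J') one_pos).symm
              (toMat_seqCell (fun _ => J) one_pos).symm
          · refine Finset.sum_congr rfl fun t ht => ?_
            have ht' := Finset.mem_range.1 ht
            exact congrArg₂ (· * ·) (toMat_seqCell C' ht').symm (e6 t ht').symm

end CertificateExistence

/-! ### Arithmetic in ℚ(α) through integer polynomials modulo f. -/

section Arithmetic

/-- An irreducible integer polynomial divides the integer polynomials vanishing at its root. -/
theorem aeval_eq_zero_iff_dvd {f : ℤ[X]} (hf : Irreducible f) {α : Qbar} (hα : aeval α f = 0)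
    (g : ℤ[X]) : aeval α g = 0 ↔ f ∣ g := by
  have hdeg : f.natDegree ≠ 0 := by
    intro h0
    obtain ⟨n, rfl⟩ := Polynomial.natDegree_eq_zero.1 h0
    rw [aeval_C, eq_intCast, Int.cast_eq_zero] at hα
    exact hf.ne_zero (by rw [hα, map_zero])
  -- Gauss's lemma: a nonconstant irreducible f is primitive and irreducible over ℚ, hence
  -- associated there to the minimal polynomial of α; primitivity brings divisibility back to ℤ[x].
  have hprim : f.IsPrimitive := hf.isPrimitive hdeg
  constructor
  · intro hg
    have hfQ : Irreducible (f.map (Int.castRingHom ℚ)) :=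
      (IsPrimitive.Int.irreducible_iff_irreducible_map_cast hprim).1 hf
    have hmap : ∀ u : ℤ[X], aeval α (u.map (Int.castRingHom ℚ)) = aeval α u := fun u =>
      Polynomial.aeval_map_algebraMap ℚ α u
    have hint : IsIntegral ℚ α := Algebra.IsIntegral.isIntegral α
    have h1 : minpoly ℚ α ∣ f.map (Int.castRingHom ℚ) := minpoly.dvd ℚ α (by rw [hmap, hα])
    have h2 : minpoly ℚ α ∣ g.map (Int.castRingHom ℚ) := minpoly.dvd ℚ α (by rw [hmap, hg])
    have h3 := (minpoly.irreducible hint).associated_of_dvd hfQ h1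
    exact (IsPrimitive.Int.dvd_iff_map_cast_dvd_map_cast f g hprim).2 (h3.symm.dvd.trans h2)
  · rintro ⟨u, rfl⟩
    rw [map_mul, hα, zero_mul]

theorem exists_intPoly_eq_mul {α : Qbar} (y : IntermediateField.adjoin ℚ {α}) :
    ∃ n : ℤ, n ≠ 0 ∧ ∃ l : List ℤ, aeval α (intPoly l) = (n : Qbar) * (y : Qbar) := by
  have h1 : (y : Qbar) ∈ IntermediateField.adjoin ℚ {α} := y.2
  rw [← IntermediateField.mem_toSubalgebra,
    IntermediateField.adjoin_simple_toSubalgebra_of_isAlgebraic (Algebra.IsAlgebraic.isAlgebraic α),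
    Algebra.adjoin_singleton_eq_range_aeval] at h1
  obtain ⟨g, hg⟩ := h1
  obtain ⟨b, hbm, hb⟩ := IsLocalization.integerNormalization_spec (nonZeroDivisors ℤ) g
  obtain ⟨l, hl⟩ := exists_evalList (IsLocalization.integerNormalization (nonZeroDivisors ℤ) g)
  refine ⟨b, nonZeroDivisors.ne_zero hbm, l, ?_⟩
  have h2 : aeval α ((IsLocalization.integerNormalization (nonZeroDivisors ℤ) g).map
      (algebraMap ℤ ℚ)) = aeval α (b • g) := congrArg _ hb
  rw [Polynomial.aeval_map_algebraMap, map_zsmul] at h2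
  rw [show intPoly l = _ from hl, h2, ← hg, zsmul_eq_mul]
  rfl

def address (t i r l : ℕ) : ℕ := Nat.pair t (Nat.pair i (Nat.pair r l))

/-- The cells held by a list of integer polynomials. -/
def readCells (mem : List (List ℤ)) : Cells ℤ[X] :=
  fun t i r l => intPoly (mem.getD (address t i r l) [])

theorem intPoly_nil : intPoly [] = 0 := rfl

theorem intPoly_cons (a : ℤ) (l : List ℤ) : intPoly (a :: l) = C a + X * intPoly l := rfl

theorem intPoly_map_mul (n : ℤ) (l : List ℤ) : intPoly (l.map (n * ·)) = C n * intPoly l := by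
  induction l with
  | nil => rw [List.map_nil, intPoly_nil, mul_zero]
  | cons a l ih => rw [List.map_cons, intPoly_cons, intPoly_cons, ih, C_mul]; ring

/-- Each new denominator is multiplied into the previous ones and the old entries are rescaled, so
that one integer n serves all entries. -/
theorem exists_common_multiple {α : Qbar} (y : ℕ → IntermediateField.adjoin ℚ {α}) (T : ℕ) :
    ∃ n : ℤ, n ≠ 0 ∧ ∃ mem : List (List ℤ), mem.length = T ∧
      ∀ a < T, aeval α (intPoly (mem.getD a [])) = (n : Qbar) * (y a : Qbar) := by
  induction T with
  | zero => exact ⟨1, one_ne_zero, [], rfl, fun a ha => absurd ha (Nat.not_lt_zero a)⟩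
  | succ T ih =>
    obtain ⟨n, hn, mem, hlen, hmem⟩ := ih
    obtain ⟨n', hn', l, hl⟩ := exists_intPoly_eq_mul (y T)
    refine ⟨n' * n, mul_ne_zero hn' hn, mem.map (fun l => l.map (n' * ·)) ++ [l.map (n * ·)],
      by simp [hlen], fun a ha => ?_⟩
    rcases Nat.lt_succ_iff_lt_or_eq.1 ha with h | rfl
    · have e : (mem.map (fun l => l.map (n' * ·)) ++ [l.map (n * ·)]).getD a [] =
          (mem.getD a []).map (n' * ·) := by
        simp [List.getD_eq_getElem?_getD, List.getElem?_append_left, hlen, h]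
      rw [e, intPoly_map_mul, map_mul, aeval_C, hmem a h]
      push_cast
      simp [mul_assoc]
    · have e : (mem.map (fun l => l.map (n' * ·)) ++ [l.map (n * ·)]).getD a [] =
          l.map (n * ·) := by
        simp [List.getD_eq_getElem?_getD, ← hlen]
      rw [e, intPoly_map_mul, map_mul, aeval_C, hl]
      push_cast
      simp [mul_assoc, mul_left_comm]

/-- Only finitely many addresses carry nonzero values, and positions beyond the end of the list are
read as the zero polynomial. -/
theorem exists_readCells {α : Qbar} (x : Cells (IntermediateField.adjoin ℚ {α}))
    (hx : IsBounded x) : ∃ n : ℤ, n ≠ 0 ∧ ∃ mem : List (List ℤ), ∀ t i r l,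
      aeval α (readCells mem t i r l) = (n : Qbar) * (x t i r l : Qbar) := by
  obtain ⟨I, hI⟩ := hx
  let y : ℕ → IntermediateField.adjoin ℚ {α} := fun a =>
    x a.unpair.1 a.unpair.2.unpair.1 a.unpair.2.unpair.2.unpair.1 a.unpair.2.unpair.2.unpair.2
  have hy : ∀ t i r l, y (address t i r l) = x t i r l := fun t i r l => by
    simp [y, address]
  let S := (Finset.range I ×ˢ Finset.range I) ×ˢ (Finset.range I ×ˢ Finset.range I)
  let T := S.sup (fun s => address s.1.1 s.1.2 s.2.1 s.2.2) + 1
  obtain ⟨n, hn, mem, hlen, hmem⟩ := exists_common_multiple y T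
  refine ⟨n, hn, mem, fun t i r l => ?_⟩
  by_cases h : address t i r l < T
  · rw [readCells, hmem _ h, hy]
  · have e : mem.getD (address t i r l) [] = [] := by
      rw [List.getD_eq_default]
      omega
    rw [readCells, e, intPoly_nil, map_zero, hI, ZeroMemClass.coe_zero, mul_zero]
    by_contra hlt
    push Not at hlt
    refine h (Nat.lt_succ_of_le ?_)
    exact Finset.le_sup (f := fun s : (ℕ × ℕ) × ℕ × ℕ => address s.1.1 s.1.2 s.2.1 s.2.2)
      (b := ((t, i), r, l)) (by simp [S, hlt])

end Arithmetic

/-! ### Codes of matrices and the three certified cases. -/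

section Codes

/-- The bound for the degrees in `z` of the numerators and denominators in a code. -/
def codeSize (c : Code) : ℕ := (c.2.flatten.map fun e => e.1.length + e.2.length).sum

def codeEntry (c : Code) (r l : ℕ) : List (List ℤ) × List (List ℤ) :=
  (c.2.getD r []).getD l ([], [])

def codeNum (c : Code) (r l k : ℕ) : ℤ[X] := intPoly ((codeEntry c r l).1.getD k [])

def codeDen (c : Code) (r l k : ℕ) : ℤ[X] := intPoly ((codeEntry c r l).2.getD k [])

theorem getD_mem_or_eq {β : Type*} (l : List β) (n : ℕ) (b : β) :
    l.getD n b ∈ l ∨ l.getD n b = b := by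
  rw [List.getD_eq_getElem?_getD]
  rcases h : l[n]? with _ | a
  · exact Or.inr rfl
  · exact Or.inl (List.mem_of_getElem? h)

theorem codeEntry_length_le (c : Code) (r l : ℕ) :
    (codeEntry c r l).1.length + (codeEntry c r l).2.length ≤ codeSize c := by
  rcases getD_mem_or_eq (c.2.getD r []) l ([], []) with h | h
  · rcases getD_mem_or_eq c.2 r [] with h' | h'
    · exact List.single_le_sum (by simp) _
        (List.mem_map_of_mem (f := fun e : List (List ℤ) × List (List ℤ) =>
          e.1.length + e.2.length) (List.mem_flatten.2 ⟨_, h', h⟩))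
    · rw [h'] at h
      exact absurd h List.not_mem_nil
  · rw [codeEntry, h]
    exact Nat.zero_le _

theorem algPoly_eq_toPoly (α : Qbar) (L : List (List ℤ)) {K : ℕ} (hK : L.length ≤ K) :
    algPoly α L = toPoly K fun k => aeval α (intPoly (L.getD k [])) := by
  induction L generalizing K with
  | nil =>
    refine Eq.symm (Finset.sum_eq_zero fun i _ => ?_)
    simp [intPoly_nil]
  | cons a L ih =>
    obtain ⟨K, rfl⟩ : ∃ K', K = K' + 1 := ⟨K - 1, by simp at hK; omega⟩
    have h1 : algPoly α (a :: L) = C (aeval α (intPoly a)) + X * algPoly α L := rfl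
    rw [h1, ih (K := K) (by simpa using hK), toPoly, toPoly, Finset.sum_range_succ',
      Finset.mul_sum, add_comm]
    congr 1
    · refine Finset.sum_congr rfl fun i _ => ?_
      rw [List.getD_cons_succ, pow_succ]
      ring
    · simp

def valueHom (α : Qbar) : ℤ[X] →+* Qbar := (aeval α : ℤ[X] →ₐ[ℤ] Qbar).toRingHom

/-- Congruence modulo `f`. -/
def ModEq (f a b : ℤ[X]) : Prop := f ∣ a - b

theorem modEq_iff {f : ℤ[X]} (hf : Irreducible f) {α : Qbar} (hα : aeval α f = 0) (a b : ℤ[X]) :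
    ModEq f a b ↔ valueHom α a = valueHom α b := by
  rw [ModEq, ← aeval_eq_zero_iff_dvd hf hα, map_sub, sub_eq_zero]
  rfl

/-- The code `c` is not one of a regular matrix. -/
def IsInvalid (p m d : ℕ) (c : Code) : Prop :=
  (p < 2 ∨ m < 1 ∨ d < 1) ∨ (∃ n : ℤ, intPoly c.1 = C n) ∨
  (∃ a b : List ℤ, intPoly c.1 = intPoly a * intPoly b ∧
    (intPoly a ≠ 1 ∧ intPoly a ≠ -1) ∧ (intPoly b ≠ 1 ∧ intPoly b ≠ -1)) ∨
  (∃ r < m, ∃ l < m, ∀ k < codeSize c, intPoly c.1 ∣ codeDen c r l k) ∨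
  ∃ (b h : ℕ) (n : ℤ) (mem : List (List ℤ)), n ≠ 0 ∧
    IsDenominator (ModEq (intPoly c.1)) m b h (C n) (readCells mem) (codeSize c) (codeNum c)
      (codeDen c) ∧
    IsSingular (ModEq (intPoly c.1)) m b (C n) (readCells mem)

/-- The certificate shared by the positive and the negative case. -/
def IsExpanded (p m d : ℕ) (c : Code) (b v h : ℕ) (n : ℤ) (x : Cells ℤ[X]) : Prop :=
  n ≠ 0 ∧
  IsDenominator (ModEq (intPoly c.1)) m b h (C n) x (codeSize c) (codeNum c) (codeDen c) ∧
  IsPseudoInverse (ModEq (intPoly c.1)) m b v (C n) x ∧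
  IsExpansion (ModEq (intPoly c.1)) m b (C n) x (lowSize d p v h + winSize d v h)

/-- The dimension of `𝔛_d` is at least `m`. -/
def IsLarge (p m d : ℕ) (c : Code) : Prop :=
  ∃ (b v h : ℕ) (n : ℤ) (mem : List (List ℤ)), IsExpanded p m d c b v h n (readCells mem) ∧
    IsPositive (ModEq (intPoly c.1)) p m d v h (C n) (readCells mem)

/-- The dimension of `𝔛_d` is less than `m`. -/
def IsSmall (p m d : ℕ) (c : Code) : Prop :=
  ∃ (b v h q : ℕ) (n : ℤ) (mem : List (List ℤ)), IsExpanded p m d c b v h n (readCells mem) ∧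
    IsNegative (ModEq (intPoly c.1)) p m d v h q (C n) (readCells mem)

end Codes

/-! ### Soundness of the certificates, and their existence for every input. -/

section Soundness

variable {p m d b v h q : ℕ} {c : Code} {A : Matrix.GeneralLinearGroup (Fin m) (RatFunc Qbar)}
  {α : Qbar} {n : ℤ} {x : Cells ℤ[X]}

theorem valueHom_C_ne_zero (α : Qbar) (hn : n ≠ 0) : valueHom α (C n) ≠ 0 := by
  rw [show valueHom α (C n) = (n : Qbar) from (aeval_C α n).trans (eq_intCast _ _)]
  exact_mod_cast hn

/-- The values of the cells, normalized. -/
def normalized (α : Qbar) (n : ℤ) (x : Cells ℤ[X]) : Cells Qbar :=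
  fun t i r l => (valueHom α (C n))⁻¹ * valueHom α (x t i r l)

theorem exists_root_of_describes (hc : Describes c A) : Irreducible (intPoly c.1) ∧
    ∃ α : Qbar, aeval α (intPoly c.1) = 0 ∧
      (∀ r l : Fin m, toPoly (codeSize c) (fun k => valueHom α (codeDen c r l k)) ≠ 0) ∧
      ∀ r l : Fin m, A.1 r l =
        algebraMap Qbar[X] (RatFunc Qbar)
          (toPoly (codeSize c) fun k => valueHom α (codeNum c r l k)) /
        algebraMap Qbar[X] (RatFunc Qbar)
          (toPoly (codeSize c) fun k => valueHom α (codeDen c r l k)) := by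
  obtain ⟨h1, α, h2, h3⟩ := hc
  refine ⟨h1, α, h2, fun r l => ?_, fun r l => ?_⟩
  · have : algPoly α (codeEntry c r l).2 ≠ 0 := (h3 r l).1
    rwa [algPoly_eq_toPoly α _ ((Nat.le_add_left _ _).trans (codeEntry_length_le c r l))] at this
  · have : A.1 r l = algebraMap Qbar[X] (RatFunc Qbar) (algPoly α (codeEntry c r l).1) /
        algebraMap Qbar[X] (RatFunc Qbar) (algPoly α (codeEntry c r l).2) := (h3 r l).2
    rwa [algPoly_eq_toPoly α _ ((Nat.le_add_left _ _).trans (codeEntry_length_le c r l)),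
      algPoly_eq_toPoly α _ ((Nat.le_add_right _ _).trans (codeEntry_length_le c r l))] at this

theorem IsInvalid.false (hp : 2 ≤ p) (hm : 1 ≤ m) (hd : d ≠ 0) (hc : Describes c A)
    (H : IsInvalid p m d c) : False := by
  obtain ⟨hf, α, hα, hden, hA⟩ := exists_root_of_describes hc
  rcases H with H | ⟨n, hn⟩ | ⟨a, b, hab, ha, hb⟩ | ⟨r, hr, l, hl, H⟩ |
    ⟨b, h, n, mem, hn, H1, H2⟩
  · omega
  · rw [hn, aeval_C, eq_intCast, Int.cast_eq_zero] at hα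
    exact hf.ne_zero (by rw [hn, hα, map_zero])
  -- The units of ℤ[x] are ±1, so the clause exhibits a factorization into two nonunits.
  · have hu : ∀ u : ℤ[X], IsUnit u → u = 1 ∨ u = -1 := by
      intro u hu
      obtain ⟨r, hr, rfl⟩ := Polynomial.isUnit_iff.1 hu
      rcases Int.isUnit_iff.1 hr with rfl | rfl
      · exact Or.inl (by simp)
      · exact Or.inr (by simp)
    rcases hf.isUnit_or_isUnit hab with h | h
    · exact (hu _ h).elim ha.1 ha.2
    · exact (hu _ h).elim hb.1 hb.2
  · refine hden ⟨r, hr⟩ ⟨l, hl⟩ (Finset.sum_eq_zero fun k hk => ?_)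
    have : valueHom α (codeDen c r l k) = 0 :=
      (aeval_eq_zero_iff_dvd hf hα _).2 (H k (Finset.mem_range.1 hk))
    simp [this]
  · have h1 := ((isDenominator_map (modEq_iff hf hα)).1 H1).scale (valueHom α (C n))⁻¹
    have h2 := ((isSingular_map (modEq_iff hf hα)).1 H2).scale (valueHom α (C n))⁻¹
    have e : (valueHom α (C n))⁻¹ * valueHom α (C n) = 1 :=
      inv_mul_cancel₀ (valueHom_C_ne_zero α hn)
    rw [e] at h1 h2
    exact IsSingular.false h2 h1 hden hA

/-- Congruences modulo f become equalities at α, and homogeneity allows division by the common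
denominator n. -/
theorem IsExpanded.normalized (hf : Irreducible (intPoly c.1)) (hα : aeval α (intPoly c.1) = 0)
    (H : IsExpanded p m d c b v h n x) :
    IsDenominator Eq m b h 1 (normalized α n x) (codeSize c)
      (fun r l k => valueHom α (codeNum c r l k)) (fun r l k => valueHom α (codeDen c r l k)) ∧
    IsPseudoInverse Eq m b v 1 (MahlerSystem.normalized α n x) ∧
    IsExpansion Eq m b 1 (MahlerSystem.normalized α n x)
      (lowSize d p v h + winSize d v h) := by
  obtain ⟨hn, H1, H2, H3⟩ := H
  have e : (valueHom α (C n))⁻¹ * valueHom α (C n) = 1 :=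
    inv_mul_cancel₀ (valueHom_C_ne_zero α hn)
  have h1 := ((isDenominator_map (modEq_iff hf hα)).1 H1).scale (valueHom α (C n))⁻¹
  have h2 := ((isPseudoInverse_map (modEq_iff hf hα)).1 H2).scale (valueHom α (C n))⁻¹
  have h3 := ((isExpansion_map (modEq_iff hf hα)).1 H3).scale (valueHom α (C n))⁻¹
  rw [e] at h1 h2 h3
  exact ⟨h1, h2, h3⟩

theorem IsLarge.le_finrank (hp : 2 ≤ p) (hm : 1 ≤ m) (hd : d ≠ 0) (hc : Describes c A)
    (H : IsLarge p m d c) : m ≤ Module.finrank Qbar (spaceX p A d) := by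
  obtain ⟨hf, α, hα, hden, hA⟩ := exists_root_of_describes hc
  obtain ⟨b, v, h, n, mem, H1, H2⟩ := H
  obtain ⟨h1, h2, h3⟩ := H1.normalized hf hα
  have e : (valueHom α (C n))⁻¹ * valueHom α (C n) = 1 :=
    inv_mul_cancel₀ (valueHom_C_ne_zero α H1.1)
  have h4 := ((isPositive_map (modEq_iff hf hα)).1 H2).scale (valueHom α (C n))⁻¹
  rw [e] at h4
  exact (le_finrank_spaceX_iff_of_isExpansion hp hm hd h1 hden hA h2 h3).1.2
    (IsPositive.le_finrank h4)

theorem IsSmall.finrank_lt (hp : 2 ≤ p) (hm : 1 ≤ m) (hd : d ≠ 0) (hc : Describes c A)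
    (H : IsSmall p m d c) : Module.finrank Qbar (spaceX p A d) < m := by
  obtain ⟨hf, α, hα, hden, hA⟩ := exists_root_of_describes hc
  obtain ⟨b, v, h, q, n, mem, H1, H2⟩ := H
  obtain ⟨h1, h2, h3⟩ := H1.normalized hf hα
  have e : (valueHom α (C n))⁻¹ * valueHom α (C n) = 1 :=
    inv_mul_cancel₀ (valueHom_C_ne_zero α H1.1)
  have h4 := ((isNegative_map (modEq_iff hf hα)).1 H2).scale (valueHom α (C n))⁻¹
  rw [e] at h4
  by_contra hlt
  have h5 := (le_finrank_spaceX_iff_of_isExpansion hp hm hd h1 hden hA h2 h3).1.1 (not_lt.1 hlt)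
  have h6 := IsNegative.finrank_le h4
  exact absurd (h5.trans h6) (by omega)

/-- Each case is certified. -/
theorem isInvalid_or_isLarge_or_isSmall (p m d : ℕ) (c : Code) :
    IsInvalid p m d c ∨ IsLarge p m d c ∨ IsSmall p m d c := by
  by_contra hnot
  push Not at hnot
  obtain ⟨hI, hL, hS⟩ := hnot
  simp only [IsInvalid, not_or] at hI
  obtain ⟨⟨hp, hm, hd⟩, hconst, hred, hden, hsing⟩ := hI
  -- The failure of the clauses of `IsInvalid` makes f nonconstant and irreducible, with nonzero
  -- denominators at any of its roots.
  have hf : Irreducible (intPoly c.1) := by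
    refine ⟨fun hu => ?_, fun a b hab => ?_⟩
    · obtain ⟨r, -, hr⟩ := Polynomial.isUnit_iff.1 hu
      exact hconst ⟨r, hr.symm⟩
    · by_contra hu
      push Not at hu
      obtain ⟨la, hla⟩ := exists_evalList a
      obtain ⟨lb, hlb⟩ := exists_evalList b
      change intPoly la = a at hla
      change intPoly lb = b at hlb
      refine hred ⟨la, lb, by rw [hla, hlb, hab], ⟨?_, ?_⟩, ?_, ?_⟩
      · rintro h; exact hu.1 (by rw [← hla, h]; exact isUnit_one)
      · rintro h; exact hu.1 (by rw [← hla, h]; exact isUnit_one.neg)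
      · rintro h; exact hu.2 (by rw [← hlb, h]; exact isUnit_one)
      · rintro h; exact hu.2 (by rw [← hlb, h]; exact isUnit_one.neg)
  obtain ⟨α, hα⟩ : ∃ α : Qbar, aeval α (intPoly c.1) = 0 := by
    have h0 : ((intPoly c.1).map (algebraMap ℤ Qbar)).degree ≠ 0 := by
      rw [Polynomial.degree_map_eq_of_injective (algebraMap ℤ Qbar).injective_int]
      intro h
      exact hconst ⟨_, Polynomial.eq_C_of_degree_eq_zero h⟩
    obtain ⟨α, hα⟩ := IsAlgClosed.exists_root _ h0
    exact ⟨α, by rwa [Polynomial.IsRoot.def, Polynomial.eval_map_algebraMap] at hα⟩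
  -- Certificates are taken over ℚ(α), where each cell is an integer polynomial in α up to an
  -- integer factor. The identities themselves are then carried over, so dimensions over ℚ(α) and
  -- over the algebraic numbers need not be compared.
  let k := IntermediateField.adjoin ℚ {α}
  let g : k := ⟨α, IntermediateField.mem_adjoin_simple_self ℚ α⟩
  let ψ : ℤ[X] →+* k := (aeval g : ℤ[X] →ₐ[ℤ] k).toRingHom
  let ι : k →+* Qbar := k.val.toRingHom
  have hψ : ∀ u, ι (ψ u) = valueHom α u := fun u => by
    have h1 : ι.comp ψ = valueHom α := by
      refine Polynomial.ringHom_ext' (RingHom.ext_int _ _) ?_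
      simp [ψ, valueHom, g, ι]
    exact RingHom.congr_fun h1 u
  have hι : ∀ a b : k, a = b ↔ ι a = ι b := fun a b => ι.injective.eq_iff.symm
  have hden' : ∀ r l : Fin m, toPoly (codeSize c) (fun j => ψ (codeDen c r l j)) ≠ 0 := by
    intro r l h0
    refine hden ⟨r, r.2, l, l.2, fun j hj => ?_⟩
    have h1 := congrArg (fun u => Polynomial.coeff u j) h0
    simp only [toPoly_coeff, if_pos hj, Polynomial.coeff_zero] at h1
    refine (aeval_eq_zero_iff_dvd hf hα _).1 ?_
    have := hψ (codeDen c r l j)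
    rw [h1, map_zero] at this
    exact this.symm
  obtain ⟨b, v, h, q, x, hx, H1, H2⟩ := exists_certificate (K := codeSize c) (not_lt.1 hp)
    (not_lt.1 hm) (by omega : d ≠ 0) (fun r l j => ψ (codeNum c r l j))
    (fun r l j => ψ (codeDen c r l j)) hden'
  obtain ⟨n, hn, mem, hmem⟩ := exists_readCells x hx
  have hC : valueHom α (C n) = (n : Qbar) * ι 1 := by
    rw [map_one, mul_one]
    exact (aeval_C α n).trans (eq_intCast _ _)
  have hcells : (fun t i r l => valueHom α (readCells mem t i r l)) =
      fun t i r l => (n : Qbar) * ι (x t i r l) := by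
    funext t i r l
    exact hmem t i r l
  have E1 : IsDenominator (ModEq (intPoly c.1)) m b h (C n) (readCells mem) (codeSize c)
      (codeNum c) (codeDen c) := by
    refine (isDenominator_map (modEq_iff hf hα)).2 ?_
    have := ((isDenominator_map hι).1 H1).scale (n : Qbar)
    simp only [hψ] at this
    exact hC ▸ hcells ▸ this
  rcases H2 with H2 | ⟨H2, H3, H4⟩
  · refine hsing ⟨b, h, n, mem, hn, E1, (isSingular_map (modEq_iff hf hα)).2 ?_⟩
    exact hC ▸ hcells ▸ ((isSingular_map hι).1 H2).scale (n : Qbar)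
  · have E2 : IsExpanded p m d c b v h n (readCells mem) := by
      refine ⟨hn, E1, (isPseudoInverse_map (modEq_iff hf hα)).2 ?_,
        (isExpansion_map (modEq_iff hf hα)).2 ?_⟩
      · exact hC ▸ hcells ▸ ((isPseudoInverse_map hι).1 H2).scale (n : Qbar)
      · exact hC ▸ hcells ▸ ((isExpansion_map hι).1 H3).scale (n : Qbar)
    rcases H4 with H4 | H4
    · refine hL ⟨b, v, h, n, mem, E2, (isPositive_map (modEq_iff hf hα)).2 ?_⟩
      exact hC ▸ hcells ▸ ((isPositive_map hι).1 H4).scale (n : Qbar)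
    · refine hS ⟨b, v, h, q, n, mem, E2, (isNegative_map (modEq_iff hf hα)).2 ?_⟩
      exact hC ▸ hcells ▸ ((isNegative_map hι).1 H4).scale (n : Qbar)

end Soundness

-- Primitive recursive arithmetic.

attribute [fun_prop] Primrec
attribute [fun_prop] Primrec.id Primrec.const Primrec.comp

section PrimrecFunctions

variable {α β γ σ : Type*} [Primcodable α] [Primcodable β] [Primcodable γ] [Primcodable σ]

@[fun_prop]
theorem primrec_fst {f : α → β × γ} (hf : Primrec f) : Primrec fun a => (f a).1 :=
  Primrec.fst.comp hf

@[fun_prop]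
theorem primrec_snd {f : α → β × γ} (hf : Primrec f) : Primrec fun a => (f a).2 :=
  Primrec.snd.comp hf

@[fun_prop]
theorem primrec_pair {f : α → β} {g : α → γ} (hf : Primrec f) (hg : Primrec g) :
    Primrec fun a => (f a, g a) :=
  hf.pair hg

@[fun_prop]
theorem primrec_nat_add {f g : α → ℕ} (hf : Primrec f) (hg : Primrec g) :
    Primrec fun a => f a + g a :=
  Primrec.nat_add.comp hf hg

@[fun_prop]
theorem primrec_nat_sub {f g : α → ℕ} (hf : Primrec f) (hg : Primrec g) :
    Primrec fun a => f a - g a :=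
  Primrec.nat_sub.comp hf hg

@[fun_prop]
theorem primrec_nat_mul {f g : α → ℕ} (hf : Primrec f) (hg : Primrec g) :
    Primrec fun a => f a * g a :=
  Primrec.nat_mul.comp hf hg

@[fun_prop]
theorem primrec_nat_div {f g : α → ℕ} (hf : Primrec f) (hg : Primrec g) :
    Primrec fun a => f a / g a :=
  Primrec.nat_div.comp hf hg

@[fun_prop]
theorem primrec_nat_mod {f g : α → ℕ} (hf : Primrec f) (hg : Primrec g) :
    Primrec fun a => f a % g a :=
  Primrec.nat_mod.comp hf hg

@[fun_prop]
theorem primrec_nat_pair {f g : α → ℕ} (hf : Primrec f) (hg : Primrec g) :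
    Primrec fun a => Nat.pair (f a) (g a) :=
  Primrec₂.natPair.comp hf hg

@[fun_prop]
theorem primrec_list_getD {f : α → List β} {g : α → ℕ} (b : β) (hf : Primrec f)
    (hg : Primrec g) : Primrec fun a => (f a).getD (g a) b :=
  (Primrec.list_getD b).comp hf hg

@[fun_prop]
theorem primrec_list_length {f : α → List β} (hf : Primrec f) : Primrec fun a => (f a).length :=
  Primrec.list_length.comp hf

theorem primrec_encode_int : Primrec (fun z : ℤ => Encodable.encode z) := Primrec.encode

/-- The parity of the code of an integer is its sign. Integer operations are reduced through this to
natural numbers, by means of positive and negative parts. -/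
theorem encode_int_natCast (n : ℕ) : Encodable.encode (n : ℤ) = 2 * n := rfl

theorem encode_int_negSucc (n : ℕ) : Encodable.encode (Int.negSucc n) = 2 * n + 1 := rfl

@[fun_prop]
theorem primrec_int_toNat {f : α → ℤ} (hf : Primrec f) : Primrec fun a => (f a).toNat := by
  have h : Primrec fun z : ℤ => z.toNat := by
    refine (Primrec.ite (c := fun z : ℤ => Encodable.encode z % 2 = 0)
      (Primrec.eq.comp ((primrec_nat_mod primrec_encode_int (Primrec.const 2))) (Primrec.const 0))
      (primrec_nat_div primrec_encode_int (Primrec.const 2)) (Primrec.const 0)).of_eq ?_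
    rintro (n | n)
    · change (if 2 * n % 2 = 0 then 2 * n / 2 else 0) = n
      rw [if_pos (by omega)]
      omega
    · change (if (2 * n + 1) % 2 = 0 then (2 * n + 1) / 2 else 0) = 0
      rw [if_neg (by omega)]
  exact h.comp hf

@[fun_prop]
theorem primrec_int_neg_toNat {f : α → ℤ} (hf : Primrec f) : Primrec fun a => (-f a).toNat := by
  have h : Primrec fun z : ℤ => (-z).toNat := by
    refine (Primrec.ite (c := fun z : ℤ => Encodable.encode z % 2 = 0)
      (Primrec.eq.comp ((primrec_nat_mod primrec_encode_int (Primrec.const 2))) (Primrec.const 0))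
      (Primrec.const 0) (primrec_nat_div (primrec_nat_add primrec_encode_int (Primrec.const 1))
        (Primrec.const 2))).of_eq ?_
    rintro (n | n)
    · change (if 2 * n % 2 = 0 then 0 else (2 * n + 1) / 2) = (-(n : ℤ)).toNat
      rw [if_pos (by omega)]
      omega
    · change (if (2 * n + 1) % 2 = 0 then 0 else (2 * n + 1 + 1) / 2) = (-Int.negSucc n).toNat
      rw [if_neg (by omega)]
      omega
  exact h.comp hf

theorem primrec_int_subNat {f g : α → ℕ} (hf : Primrec f) (hg : Primrec g) :
    Primrec fun a => (f a : ℤ) - g a := by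
  refine Primrec.encode_iff.1 ((Primrec.ite (c := fun a => g a ≤ f a) (Primrec.nat_le.comp hg hf)
    (f := fun a => 2 * (f a - g a)) (g := fun a => 2 * (g a - f a - 1) + 1)
    (by fun_prop) (by fun_prop)).of_eq fun a => ?_)
  split_ifs with h
  · rw [← encode_int_natCast, Nat.cast_sub h]
  · rw [← encode_int_negSucc]
    congr 1
    omega

@[fun_prop]
theorem primrec_int_add {f g : α → ℤ} (hf : Primrec f) (hg : Primrec g) :
    Primrec fun a => f a + g a := by
  refine (primrec_int_subNat (f := fun a => (f a).toNat + (g a).toNat)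
    (g := fun a => (-f a).toNat + (-g a).toNat) (by fun_prop) (by fun_prop)).of_eq fun a => ?_
  omega

@[fun_prop]
theorem primrec_int_neg {f : α → ℤ} (hf : Primrec f) : Primrec fun a => -f a := by
  refine (primrec_int_subNat (f := fun a => (-f a).toNat) (g := fun a => (f a).toNat)
    (by fun_prop) (by fun_prop)).of_eq fun a => ?_
  omega

@[fun_prop]
theorem primrec_int_mul {f g : α → ℤ} (hf : Primrec f) (hg : Primrec g) :
    Primrec fun a => f a * g a := by
  refine (primrec_int_subNat
    (f := fun a => (f a).toNat * (g a).toNat + (-f a).toNat * (-g a).toNat)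
    (g := fun a => (-f a).toNat * (g a).toNat + (f a).toNat * (-g a).toNat)
    (by fun_prop) (by fun_prop)).of_eq fun a => ?_
  have h1 : f a = (f a).toNat - (-f a).toNat := by omega
  have h2 : g a = (g a).toNat - (-g a).toNat := by omega
  conv_rhs => rw [h1, h2]
  push_cast
  ring

theorem primrec_sum_range {M : Type*} [AddCommMonoid M] [Primcodable M]
    (hM : Primrec₂ fun a b : M => a + b) {f : α × ℕ → M} {n : α → ℕ} (hf : Primrec f)
    (hn : Primrec n) : Primrec fun a => ∑ k ∈ Finset.range (n a), f (a, k) := by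
  refine (Primrec.nat_rec' (f := n) (g := fun _ => (0 : M))
    (h := fun a q => q.2 + f (a, q.1)) hn (Primrec.const 0) ?_).of_eq fun a => ?_
  · exact hM.comp (Primrec.snd.comp Primrec.snd)
      (hf.comp (Primrec.fst.pair (Primrec.fst.comp Primrec.snd)))
  · induction n a with
    | zero => rfl
    | succ n ih => rw [Finset.sum_range_succ, ← ih]

theorem primrecPred_forall_lt {P : α × ℕ → Prop} {n : α → ℕ} (hP : PrimrecPred P)
    (hn : Primrec n) : PrimrecPred fun a => ∀ k < n a, P (a, k) := by
  have h : PrimrecRel fun (k : ℕ) (a : α) => P (a, k) :=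
    PrimrecPred.comp hP (Primrec.snd.pair Primrec.fst)
  refine (h.forall_mem_list.comp (Primrec.list_range.comp hn) Primrec.id).of_eq fun a => ?_
  simp

theorem primrecPred_exists_lt {P : α × ℕ → Prop} {n : α → ℕ} (hP : PrimrecPred P)
    (hn : Primrec n) : PrimrecPred fun a => ∃ k < n a, P (a, k) := by
  have h : PrimrecRel fun (k : ℕ) (a : α) => P (a, k) :=
    PrimrecPred.comp hP (Primrec.snd.pair Primrec.fst)
  refine (h.exists_mem_list.comp (Primrec.list_range.comp hn) Primrec.id).of_eq fun a => ?_
  simp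

end PrimrecFunctions

/-! ### Primitive recursive families of integer polynomials. -/

section PolynomialFunctions

variable {α β : Type*} [Primcodable α] [Primcodable β]

/-- The integer polynomial `e a` is a primitive recursive function of `a`. -/
structure PolyPrimrec (e : α → ℤ[X]) : Prop where
  coeff : Primrec fun p : α × ℕ => (e p.1).coeff p.2
  bound : ∃ N : α → ℕ, Primrec N ∧ ∀ a i, N a ≤ i → (e a).coeff i = 0

namespace PolyPrimrec

variable {e e' : α → ℤ[X]}

theorem comp (h : PolyPrimrec e) {g : β → α} (hg : Primrec g) : PolyPrimrec fun b => e (g b) := by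
  obtain ⟨h1, N, h2, h3⟩ := h
  exact ⟨h1.comp (g := fun p : β × ℕ => (g p.1, p.2)) (by fun_prop), fun b => N (g b), by fun_prop,
    fun b i => h3 (g b) i⟩

theorem C {f : α → ℤ} (hf : Primrec f) : PolyPrimrec fun a => Polynomial.C (f a) := by
  refine ⟨?_, fun _ => 1, Primrec.const 1, fun a i hi => ?_⟩
  · refine (Primrec.ite (c := fun p : α × ℕ => p.2 = 0)
      (Primrec.eq.comp (by fun_prop) (Primrec.const 0)) (f := fun p => f p.1) (by fun_prop)
      (Primrec.const 0)).of_eq fun p => ?_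
    rw [Polynomial.coeff_C]
  · have hi' : 1 ≤ i := hi
    rw [Polynomial.coeff_C, if_neg (by omega)]

theorem zero : PolyPrimrec fun _ : α => (0 : ℤ[X]) :=
  ⟨Primrec.const 0, fun _ => 0, Primrec.const 0, fun _ _ _ => rfl⟩

theorem add (h : PolyPrimrec e) (h' : PolyPrimrec e') : PolyPrimrec fun a => e a + e' a := by
  obtain ⟨h1, N, h2, h3⟩ := h
  obtain ⟨h1', N', h2', h3'⟩ := h'
  refine ⟨?_, fun a => N a + N' a, by fun_prop, fun a i hi => ?_⟩
  · simp only [Polynomial.coeff_add]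
    fun_prop
  · have hi' : N a + N' a ≤ i := hi
    rw [Polynomial.coeff_add, h3 a i (by omega), h3' a i (by omega), add_zero]

theorem neg (h : PolyPrimrec e) : PolyPrimrec fun a => -e a := by
  obtain ⟨h1, N, h2, h3⟩ := h
  refine ⟨?_, N, h2, fun a i hi => ?_⟩
  · simp only [Polynomial.coeff_neg]
    fun_prop
  · rw [Polynomial.coeff_neg, h3 a i hi, neg_zero]

theorem sub (h : PolyPrimrec e) (h' : PolyPrimrec e') : PolyPrimrec fun a => e a - e' a := by
  simpa only [sub_eq_add_neg] using h.add h'.neg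

theorem mul (h : PolyPrimrec e) (h' : PolyPrimrec e') : PolyPrimrec fun a => e a * e' a := by
  obtain ⟨h1, N, h2, h3⟩ := h
  obtain ⟨h1', N', h2', h3'⟩ := h'
  refine ⟨?_, fun a => N a + N' a, by fun_prop, fun a i hi => ?_⟩
  · refine (primrec_sum_range (M := ℤ) (primrec_int_add Primrec.fst Primrec.snd)
      (f := fun p : (α × ℕ) × ℕ => (e p.1.1).coeff p.2 * (e' p.1.1).coeff (p.1.2 - p.2))
      (n := fun p => p.2 + 1) ?_ (by fun_prop)).of_eq fun p => ?_
    · exact primrec_int_mul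
        (h1.comp (g := fun p : (α × ℕ) × ℕ => (p.1.1, p.2)) (by fun_prop))
        (h1'.comp (g := fun p : (α × ℕ) × ℕ => (p.1.1, p.1.2 - p.2)) (by fun_prop))
    · rw [Polynomial.coeff_mul, Finset.Nat.sum_antidiagonal_eq_sum_range_succ fun i j =>
        (e p.1).coeff i * (e' p.1).coeff j]
  · have hi' : N a + N' a ≤ i := hi
    rw [Polynomial.coeff_mul]
    refine Finset.sum_eq_zero fun x hx => ?_
    have := Finset.HasAntidiagonal.mem_antidiagonal.1 hx
    by_cases hx1 : N a ≤ x.1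
    · rw [h3 a _ hx1, zero_mul]
    · rw [h3' a x.2 (by omega), mul_zero]

theorem sum {e : α → ℕ → ℤ[X]} (h : PolyPrimrec fun p : α × ℕ => e p.1 p.2) {n : α → ℕ}
    (hn : Primrec n) : PolyPrimrec fun a => ∑ k ∈ Finset.range (n a), e a k := by
  obtain ⟨h1, N, h2, h3⟩ := h
  refine ⟨?_, fun a => ∑ k ∈ Finset.range (n a), N (a, k), ?_, fun a i hi => ?_⟩
  · refine (primrec_sum_range (M := ℤ) (primrec_int_add Primrec.fst Primrec.snd)
      (f := fun p : (α × ℕ) × ℕ => (e p.1.1 p.2).coeff p.1.2) (n := fun p => n p.1) ?_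
      (by fun_prop)).of_eq fun p => ?_
    · exact h1.comp (g := fun p : (α × ℕ) × ℕ => ((p.1.1, p.2), p.1.2)) (by fun_prop)
    · rw [Polynomial.finsetSum_coeff]
  · exact primrec_sum_range (M := ℕ) (primrec_nat_add Primrec.fst Primrec.snd) h2 hn
  · rw [Polynomial.finsetSum_coeff]
    refine Finset.sum_eq_zero fun k hk => h3 (a, k) i (le_trans ?_ hi)
    exact Finset.single_le_sum (f := fun k => N (a, k)) (fun _ _ => Nat.zero_le _) hk

theorem ite {P : α → Prop} [DecidablePred P] (hP : PrimrecPred P) (h : PolyPrimrec e)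
    (h' : PolyPrimrec e') : PolyPrimrec fun a => if P a then e a else e' a := by
  obtain ⟨h1, N, h2, h3⟩ := h
  obtain ⟨h1', N', h2', h3'⟩ := h'
  refine ⟨?_, fun a => N a + N' a, by fun_prop, fun a i hi => ?_⟩
  · refine (Primrec.ite (c := fun p : α × ℕ => P p.1) (hP.comp Primrec.fst) h1 h1').of_eq
      fun p => ?_
    split_ifs <;> rfl
  · have hi' : N a + N' a ≤ i := hi
    split_ifs
    · exact h3 a i (by omega)
    · exact h3' a i (by omega)

theorem intPoly {f : α → List ℤ} (hf : Primrec f) :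
    PolyPrimrec fun a => MahlerSystem.intPoly (f a) := by
  have key : ∀ (l : List ℤ) (i : ℕ), (MahlerSystem.intPoly l).coeff i = l.getD i 0 := by
    intro l
    induction l with
    | nil => intro i; simp [intPoly_nil]
    | cons a l ih =>
      intro i
      rw [intPoly_cons, Polynomial.coeff_add]
      rcases i with _ | i
      · simp
      · rw [Polynomial.coeff_C_succ, mul_comm, Polynomial.coeff_mul_X, ih, zero_add,
          List.getD_cons_succ]
  refine ⟨?_, fun a => (f a).length, by fun_prop, fun a i hi => ?_⟩
  · simp only [key]
    fun_prop
  · rw [key, List.getD_eq_default _ _ hi]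

/-- The primitive recursive bound on the degree turns vanishing into a bounded check. -/
theorem eq_zero (h : PolyPrimrec e) : PrimrecPred fun a => e a = 0 := by
  obtain ⟨h1, N, h2, h3⟩ := h
  refine (primrecPred_forall_lt (P := fun p : α × ℕ => (e p.1).coeff p.2 = 0)
    (Primrec.eq.comp h1 (Primrec.const 0)) h2).of_eq fun a => ?_
  constructor
  · intro h
    ext i
    by_cases hi : i < N a
    · exact h i hi
    · exact h3 a i (by omega)
  · intro h i _
    rw [h, Polynomial.coeff_zero]

theorem eq (h : PolyPrimrec e) (h' : PolyPrimrec e') : PrimrecPred fun a => e a = e' a :=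
  (h.sub h').eq_zero.of_eq fun _ => sub_eq_zero

end PolyPrimrec

end PolynomialFunctions

/-! ### Enumerable predicates and their closure properties. -/

section Enumerable

variable {α β : Type*} [Primcodable α] [Primcodable β]

/-- Predicates of the form "there is `n` such that `R a n`" with `R` primitive recursive. -/
def IsSigma (P : α → Prop) : Prop :=
  ∃ R : α × ℕ → Prop, PrimrecPred R ∧ ∀ a, P a ↔ ∃ n, R (a, n)

namespace IsSigma

variable {P Q : α → Prop}

theorem of_primrecPred (h : PrimrecPred P) : IsSigma P :=
  ⟨fun p => P p.1, h.comp Primrec.fst, fun _ => ⟨fun h => ⟨0, h⟩, fun ⟨_, h⟩ => h⟩⟩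

theorem of_eq (h : IsSigma P) (H : ∀ a, P a ↔ Q a) : IsSigma Q := by
  rwa [← show P = Q from funext fun a => propext (H a)]

theorem exists_nat {P : α → ℕ → Prop} (h : IsSigma fun p : α × ℕ => P p.1 p.2) :
    IsSigma fun a => ∃ k, P a k := by
  obtain ⟨R, h1, h2⟩ := h
  refine ⟨fun p => R ((p.1, p.2.unpair.1), p.2.unpair.2), h1.comp ?_, fun a => ?_⟩
  · exact (Primrec.fst.pair (Primrec.fst.comp (Primrec.unpair.comp Primrec.snd))).pair
      (Primrec.snd.comp (Primrec.unpair.comp Primrec.snd))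
  · constructor
    · rintro ⟨k, hk⟩
      obtain ⟨n, hn⟩ := (h2 (a, k)).1 hk
      exact ⟨Nat.pair k n, by simpa using hn⟩
    · rintro ⟨n, hn⟩
      exact ⟨_, (h2 (a, n.unpair.1)).2 ⟨_, hn⟩⟩

theorem and (hP : IsSigma P) (hQ : IsSigma Q) : IsSigma fun a => P a ∧ Q a := by
  obtain ⟨R, h1, h2⟩ := hP
  obtain ⟨R', h1', h2'⟩ := hQ
  refine (exists_nat (P := fun a k => ∃ n, R (a, k) ∧ R' (a, n)) (exists_nat
    (P := fun p n => R p ∧ R' (p.1, n)) (of_primrecPred ((h1.comp Primrec.fst).and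
      (h1'.comp (f := fun p : (α × ℕ) × ℕ => (p.1.1, p.2)) (by fun_prop)))))).of_eq fun a => ?_
  rw [h2, h2']
  simp only [exists_and_left, exists_and_right]

theorem or (hP : IsSigma P) (hQ : IsSigma Q) : IsSigma fun a => P a ∨ Q a := by
  obtain ⟨R, h1, h2⟩ := hP
  obtain ⟨R', h1', h2'⟩ := hQ
  refine ⟨fun p => R p ∨ R' p, h1.or h1', fun a => ?_⟩
  change P a ∨ Q a ↔ ∃ n, R (a, n) ∨ R' (a, n)
  rw [h2, h2', exists_or]

/-- Finitely many witnesses have a common bound, so the unbounded quantifier can be moved in front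
of the bounded one. -/
theorem forall_lt {P : α → ℕ → Prop} {n : α → ℕ} (hn : Primrec n)
    (h : IsSigma fun p : α × ℕ => P p.1 p.2) : IsSigma fun a => ∀ k < n a, P a k := by
  obtain ⟨R, h1, h2⟩ := h
  refine ⟨fun p => ∀ k < n p.1, ∃ j < p.2, R ((p.1, k), j), ?_, fun a => ?_⟩
  · refine primrecPred_forall_lt (P := fun q : (α × ℕ) × ℕ => ∃ j < q.1.2, R ((q.1.1, q.2), j))
      (primrecPred_exists_lt (P := fun q : ((α × ℕ) × ℕ) × ℕ => R ((q.1.1.1, q.1.2), q.2))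
        (h1.comp (f := fun q : ((α × ℕ) × ℕ) × ℕ => ((q.1.1.1, q.1.2), q.2)) (by fun_prop))
        (by fun_prop)) (by fun_prop)
  · constructor
    · intro H
      choose! g hg using fun k hk => (h2 (a, k)).1 (H k hk)
      refine ⟨(Finset.range (n a)).sup g + 1, fun k hk => ⟨g k, Nat.lt_succ_of_le ?_, hg k hk⟩⟩
      exact Finset.le_sup (Finset.mem_range.2 hk)
    · rintro ⟨N, hN⟩ k hk
      obtain ⟨j, -, hj⟩ := hN k hk
      exact (h2 (a, k)).2 ⟨j, hj⟩

theorem exists_lt {P : α → ℕ → Prop} {n : α → ℕ} (hn : Primrec n)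
    (h : IsSigma fun p : α × ℕ => P p.1 p.2) : IsSigma fun a => ∃ k < n a, P a k :=
  exists_nat (P := fun a k => k < n a ∧ P a k)
    ((of_primrecPred (Primrec.nat_lt.comp (by fun_prop) (by fun_prop))).and h)

theorem exists_code {P : α → β → Prop} (h : IsSigma fun p : α × β => P p.1 p.2) :
    IsSigma fun a => ∃ b, P a b := by
  classical
  obtain ⟨R, h1, h2⟩ := h
  refine (exists_nat (P := fun a k => ∃ n, ((Encodable.decode (α := β) k).elim false
    fun b => decide (R ((a, b), n))) = true) (exists_nat (P := fun (p : α × ℕ) n =>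
      ((Encodable.decode (α := β) p.2).elim false
        fun b => decide (R ((p.1, b), n))) = true) (of_primrecPred ?_))).of_eq fun a => ?_
  · refine Primrec.eq.comp ((Primrec.option_casesOn
      (o := fun p : (α × ℕ) × ℕ => Encodable.decode (α := β) p.1.2)
      (f := fun _ => false) (g := fun p b => decide (R ((p.1.1, b), p.2)))
      (Primrec.decode.comp (by fun_prop)) (Primrec.const false)
      (h1.decide.comp (g := fun q : ((α × ℕ) × ℕ) × β => ((q.1.1.1, q.2), q.1.2))
        (by fun_prop))).of_eq fun p => ?_) (Primrec.const true)
    cases Encodable.decode (α := β) p.1.2 <;> rfl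
  · constructor
    · rintro ⟨k, n, hk⟩
      rcases hd : Encodable.decode (α := β) k with _ | b
      · rw [hd] at hk
        exact absurd hk (by simp)
      · rw [hd] at hk
        exact ⟨b, (h2 (a, b)).2 ⟨n, by simpa using hk⟩⟩
    · rintro ⟨b, hb⟩
      obtain ⟨n, hn⟩ := (h2 (a, b)).1 hb
      exact ⟨Encodable.encode b, n, by simpa using hn⟩

/-- The quotient is searched for as a list of integers, so no division algorithm enters. -/
theorem dvd {f e : α → ℤ[X]} (hf : PolyPrimrec f) (he : PolyPrimrec e) :
    IsSigma fun a => f a ∣ e a := by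
  refine (exists_code (β := List ℤ) (P := fun a l => e a = f a * intPoly l) (of_primrecPred
    ((he.comp Primrec.fst).eq ((hf.comp Primrec.fst).mul (PolyPrimrec.intPoly Primrec.snd))))).of_eq
      fun a => ?_
  constructor
  · rintro ⟨l, hl⟩
    exact ⟨_, hl⟩
  · rintro ⟨g, hg⟩
    obtain ⟨l, hl⟩ := exists_evalList g
    exact ⟨l, by rw [hg, show intPoly l = g from hl]⟩

theorem modEq {f e e' : α → ℤ[X]} (hf : PolyPrimrec f) (he : PolyPrimrec e)
    (he' : PolyPrimrec e') : IsSigma fun a => ModEq (f a) (e a) (e' a) :=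
  dvd hf (he.sub he')

end IsSigma

end Enumerable

/-! ### The certificate conditions are enumerable. -/

section CertificatePrimrec

variable {α β : Type*} [Primcodable α] [Primcodable β]

@[fun_prop]
theorem primrec_winSize {d v h : α → ℕ} (hd : Primrec d) (hv : Primrec v) (hh : Primrec h) :
    Primrec fun a => winSize (d a) (v a) (h a) := by
  unfold winSize
  fun_prop

@[fun_prop]
theorem primrec_lowSize {d p v h : α → ℕ} (hd : Primrec d) (hp : Primrec p) (hv : Primrec v)
    (hh : Primrec h) : Primrec fun a => lowSize (d a) (p a) (v a) (h a) := by
  unfold lowSize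
  fun_prop

theorem PolyPrimrec.conv {b b' n : α → ℕ} {f g : α → ℕ → ℤ[X]} (hb : Primrec b)
    (hb' : Primrec b') (hn : Primrec n) (hf : PolyPrimrec fun p : α × ℕ => f p.1 p.2)
    (hg : PolyPrimrec fun p : α × ℕ => g p.1 p.2) :
    PolyPrimrec fun a => MahlerSystem.conv (b a) (b' a) (f a) (g a) (n a) := by
  unfold MahlerSystem.conv
  refine PolyPrimrec.sum (PolyPrimrec.sum (PolyPrimrec.ite ?_ (PolyPrimrec.mul ?_ ?_)
    PolyPrimrec.zero) (by fun_prop)) hb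
  · exact Primrec.eq.comp (by fun_prop) (by fun_prop)
  · exact hf.comp (g := fun q : (α × ℕ) × ℕ => (q.1.1, q.1.2)) (by fun_prop)
  · exact hg.comp (g := fun q : (α × ℕ) × ℕ => (q.1.1, q.2)) (by fun_prop)

/-- The cells `x a` are primitive recursive functions of `a` and the address. -/
def CellsPrimrec (x : α → Cells ℤ[X]) : Prop :=
  PolyPrimrec fun w : α × ℕ × ℕ × ℕ × ℕ => x w.1 w.2.1 w.2.2.1 w.2.2.2.1 w.2.2.2.2

theorem CellsPrimrec.cell {x : α → Cells ℤ[X]} (hx : CellsPrimrec x) {g : β → α}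
    {t i r l : β → ℕ} (hg : Primrec g) (ht : Primrec t) (hi : Primrec i) (hr : Primrec r)
    (hl : Primrec l) : PolyPrimrec fun w => x (g w) (t w) (i w) (r w) (l w) :=
  PolyPrimrec.comp hx (g := fun w => (g w, t w, i w, r w, l w)) (by fun_prop)

theorem CellsPrimrec.opEntry {x : α → Cells ℤ[X]} (hx : CellsPrimrec x) {g : β → α}
    {d p m L s t : β → ℕ} (hg : Primrec g) (hd : Primrec d) (hp : Primrec p) (hm : Primrec m)
    (hL : Primrec L) (hs : Primrec s) (ht : Primrec t) :
    PolyPrimrec fun w => MahlerSystem.opEntry (x (g w) 4) (d w) (p w) (m w) (L w) (s w) (t w) := by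
  unfold MahlerSystem.opEntry
  refine PolyPrimrec.sum (PolyPrimrec.ite (Primrec.eq.comp (by fun_prop) (by fun_prop))
    (hx.cell ?_ ?_ ?_ ?_ ?_) PolyPrimrec.zero) hL <;> fun_prop

/-- Families of polynomials with three indices. -/
def FamilyPrimrec (y : α → ℕ → ℕ → ℕ → ℤ[X]) : Prop :=
  PolyPrimrec fun w : α × ℕ × ℕ × ℕ => y w.1 w.2.1 w.2.2.1 w.2.2.2

theorem FamilyPrimrec.member {y : α → ℕ → ℕ → ℕ → ℤ[X]} (hy : FamilyPrimrec y) {g : β → α}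
    {i r l : β → ℕ} (hg : Primrec g) (hi : Primrec i) (hr : Primrec r)
    (hl : Primrec l) : PolyPrimrec fun w => y (g w) (i w) (r w) (l w) :=
  PolyPrimrec.comp hy (g := fun w => (g w, i w, r w, l w)) (by fun_prop)

variable {p m d b v h q K L : α → ℕ} {f c : α → ℤ[X]} {x : α → Cells ℤ[X]}
  {num den : α → ℕ → ℕ → ℕ → ℤ[X]}

theorem isSigma_isDenominator (hm : Primrec m) (hb : Primrec b) (hh : Primrec h)
    (hK : Primrec K) (hf : PolyPrimrec f) (hc : PolyPrimrec c) (hx : CellsPrimrec x)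
    (hnum : FamilyPrimrec num) (hden : FamilyPrimrec den) :
    IsSigma fun a => IsDenominator (ModEq (f a)) (m a) (b a) (h a) (c a) (x a) (K a) (num a)
      (den a) := by
  have h1 : IsSigma fun a => ModEq (f a) (x a 1 (h a) 0 0) (c a) :=
    IsSigma.modEq hf (hx.cell (g := id) (by fun_prop) (by fun_prop) (by fun_prop) (by fun_prop)
      (by fun_prop)) hc
  have h2 : IsSigma fun a => ∀ n < b a + K a, ∀ r < m a, ∀ l < m a,
      ModEq (f a) (conv (b a) (K a) (fun i => x a 0 i r l) (fun i => den a r l i) n)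
        (conv (b a) (K a) (fun i => x a 1 i 0 0) (fun i => num a r l i) n) := by
    refine IsSigma.forall_lt ?_ (IsSigma.forall_lt ?_ (IsSigma.forall_lt ?_
      (IsSigma.modEq (hf.comp ?_) (PolyPrimrec.conv ?_ ?_ ?_
        (hx.cell ?_ ?_ ?_ ?_ ?_) (hden.member ?_ ?_ ?_ ?_)) (PolyPrimrec.conv ?_ ?_ ?_
        (hx.cell ?_ ?_ ?_ ?_ ?_) (hnum.member ?_ ?_ ?_ ?_))))) <;> fun_prop
  exact (IsSigma.of_primrecPred (Primrec.nat_lt.comp hh hb)).and (h1.and h2)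

theorem isSigma_isSingular (hm : Primrec m) (hb : Primrec b) (hf : PolyPrimrec f)
    (hc : PolyPrimrec c) (hx : CellsPrimrec x) :
    IsSigma fun a => IsSingular (ModEq (f a)) (m a) (b a) (c a) (x a) := by
  have h1 : IsSigma fun a => ∀ n < b a + b a, ∀ r < m a,
      ModEq (f a) (∑ l ∈ Finset.range (m a),
        conv (b a) (b a) (fun i => x a 0 i r l) (fun i => x a 2 i l 0) n) 0 := by
    have h0 : PolyPrimrec fun w : ((α × ℕ) × ℕ) × ℕ => conv (b w.1.1.1) (b w.1.1.1)
        (fun i => x w.1.1.1 0 i w.1.2 w.2) (fun i => x w.1.1.1 2 i w.2 0) w.1.1.2 := by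
      refine PolyPrimrec.conv ?_ ?_ ?_ (hx.cell ?_ ?_ ?_ ?_ ?_) (hx.cell ?_ ?_ ?_ ?_ ?_) <;>
        fun_prop
    refine IsSigma.forall_lt ?_ (IsSigma.forall_lt ?_ (IsSigma.modEq (hf.comp ?_)
      (PolyPrimrec.sum h0 ?_) PolyPrimrec.zero)) <;> fun_prop
  have h2 : IsSigma fun a => ∃ l < m a, ∃ k < b a, ModEq (f a) (x a 2 k l 0) (c a) := by
    refine IsSigma.exists_lt ?_ (IsSigma.exists_lt ?_ (IsSigma.modEq (hf.comp ?_)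
      (hx.cell ?_ ?_ ?_ ?_ ?_) (hc.comp ?_))) <;> fun_prop
  exact h1.and h2

theorem isSigma_isPseudoInverse (hm : Primrec m) (hb : Primrec b) (hv : Primrec v)
    (hf : PolyPrimrec f) (hc : PolyPrimrec c) (hx : CellsPrimrec x) :
    IsSigma fun a => IsPseudoInverse (ModEq (f a)) (m a) (b a) (v a) (c a) (x a) := by
  have h1 : IsSigma fun a => ModEq (f a) (x a 3 0 0 0) (c a) :=
    IsSigma.modEq hf (hx.cell (g := id) (by fun_prop) (by fun_prop) (by fun_prop) (by fun_prop)
      (by fun_prop)) hc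
  have h2 : IsSigma fun a => ∀ n < b a + b a + v a, ∀ r < m a, ∀ s < m a, ModEq (f a)
      (∑ l ∈ Finset.range (m a),
        conv (b a) (b a) (fun i => x a 0 i r l) (fun i => x a 2 i l s) n)
      (if r = s ∧ v a ≤ n then
        conv (b a) (b a) (fun i => x a 1 i 0 0) (fun i => x a 3 i 0 0) (n - v a) else 0) := by
    have h0 : PolyPrimrec fun w : (((α × ℕ) × ℕ) × ℕ) × ℕ => conv (b w.1.1.1.1) (b w.1.1.1.1)
        (fun i => x w.1.1.1.1 0 i w.1.1.2 w.2) (fun i => x w.1.1.1.1 2 i w.2 w.1.2)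
          w.1.1.1.2 := by
      refine PolyPrimrec.conv ?_ ?_ ?_ (hx.cell ?_ ?_ ?_ ?_ ?_) (hx.cell ?_ ?_ ?_ ?_ ?_) <;>
        fun_prop
    refine IsSigma.forall_lt ?_ (IsSigma.forall_lt ?_ (IsSigma.forall_lt ?_
      (IsSigma.modEq (hf.comp ?_) (PolyPrimrec.sum h0 ?_)
        (PolyPrimrec.ite (PrimrecPred.and (Primrec.eq.comp ?_ ?_) (Primrec.nat_le.comp ?_ ?_))
          (PolyPrimrec.conv ?_ ?_ ?_ (hx.cell ?_ ?_ ?_ ?_ ?_) (hx.cell ?_ ?_ ?_ ?_ ?_))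
          PolyPrimrec.zero)))) <;> fun_prop
  exact (IsSigma.of_primrecPred (Primrec.nat_lt.comp (Primrec.const 0) hb)).and (h1.and h2)

theorem isSigma_isExpansion (hm : Primrec m) (hb : Primrec b) (hL : Primrec L)
    (hf : PolyPrimrec f) (hc : PolyPrimrec c) (hx : CellsPrimrec x) :
    IsSigma fun a => IsExpansion (ModEq (f a)) (m a) (b a) (c a) (x a) (L a) := by
  unfold IsExpansion
  refine IsSigma.forall_lt ?_ (IsSigma.forall_lt ?_
      (IsSigma.forall_lt ?_ (IsSigma.modEq (hf.comp ?_) (PolyPrimrec.conv ?_ ?_ ?_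
        (hx.cell ?_ ?_ ?_ ?_ ?_) (hx.cell ?_ ?_ ?_ ?_ ?_))
        ((hc.comp ?_).mul (PolyPrimrec.ite (Primrec.nat_lt.comp ?_ ?_)
          (hx.cell ?_ ?_ ?_ ?_ ?_) PolyPrimrec.zero))))) <;> fun_prop

theorem isSigma_isPositive (hp : Primrec p) (hm : Primrec m) (hd : Primrec d) (hv : Primrec v)
    (hh : Primrec h) (hf : PolyPrimrec f) (hc : PolyPrimrec c) (hx : CellsPrimrec x) :
    IsSigma fun a =>
      IsPositive (ModEq (f a)) (p a) (m a) (d a) (v a) (h a) (c a) (x a) := by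
  unfold IsPositive
  refine (IsSigma.forall_lt ?_ (IsSigma.forall_lt ?_ (IsSigma.modEq (hf.comp ?_)
      (PolyPrimrec.sum ((hx.opEntry ?_ ?_ ?_ ?_ ?_ ?_ ?_).mul (hx.cell ?_ ?_ ?_ ?_ ?_)) ?_)
      (PolyPrimrec.sum ((hx.cell ?_ ?_ ?_ ?_ ?_).mul (hx.cell ?_ ?_ ?_ ?_ ?_)) ?_)))).and
    ((IsSigma.forall_lt ?_ (IsSigma.forall_lt ?_ (IsSigma.modEq (hf.comp ?_)
      (PolyPrimrec.sum ((hx.opEntry ?_ ?_ ?_ ?_ ?_ ?_ ?_).mul (hx.cell ?_ ?_ ?_ ?_ ?_)) ?_)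
      PolyPrimrec.zero))).and
    ((IsSigma.forall_lt ?_ (IsSigma.forall_lt ?_ (IsSigma.modEq (hf.comp ?_)
      (PolyPrimrec.sum ((hx.cell ?_ ?_ ?_ ?_ ?_).mul (hx.cell ?_ ?_ ?_ ?_ ?_)) ?_)
      (PolyPrimrec.ite (Primrec.eq.comp ?_ ?_) ((hc.comp ?_).mul (hc.comp ?_))
        PolyPrimrec.zero)))).and
    (IsSigma.forall_lt ?_ (IsSigma.forall_lt ?_ (IsSigma.modEq (hf.comp ?_)
      (PolyPrimrec.sum ((hx.cell ?_ ?_ ?_ ?_ ?_).mul (hx.cell ?_ ?_ ?_ ?_ ?_)) ?_)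
      (PolyPrimrec.ite (Primrec.eq.comp ?_ ?_) ((hc.comp ?_).mul (hc.comp ?_))
        PolyPrimrec.zero)))))) <;> fun_prop

set_option maxHeartbeats 1000000 in
theorem isSigma_isNegative (hp : Primrec p) (hm : Primrec m) (hd : Primrec d) (hv : Primrec v)
    (hh : Primrec h) (hq : Primrec q) (hf : PolyPrimrec f) (hc : PolyPrimrec c)
    (hx : CellsPrimrec x) : IsSigma fun a =>
      IsNegative (ModEq (f a)) (p a) (m a) (d a) (v a) (h a) (q a) (c a) (x a) := by
  refine IsSigma.and ?_ (IsSigma.and ?_ (IsSigma.and ?_ ?_))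
  · refine IsSigma.forall_lt ?_ (IsSigma.forall_lt ?_ (IsSigma.modEq (hf.comp ?_)
      (hx.cell ?_ ?_ ?_ ?_ ?_) (PolyPrimrec.ite (Primrec.eq.comp ?_ ?_) (hc.comp ?_)
        PolyPrimrec.zero))) <;> fun_prop
  · refine IsSigma.forall_lt ?_ (IsSigma.forall_lt ?_ (IsSigma.forall_lt ?_
      (IsSigma.modEq (hf.comp ?_)
        (PolyPrimrec.sum ((hx.opEntry ?_ ?_ ?_ ?_ ?_ ?_ ?_).mul (hx.cell ?_ ?_ ?_ ?_ ?_)) ?_)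
        ((hc.comp ?_).mul (hx.cell ?_ ?_ ?_ ?_ ?_))))) <;> fun_prop
  · refine IsSigma.forall_lt ?_ (IsSigma.forall_lt ?_ (IsSigma.forall_lt ?_
      (IsSigma.modEq (hf.comp ?_)
        (PolyPrimrec.sum ((hx.opEntry ?_ ?_ ?_ ?_ ?_ ?_ ?_).mul (hx.cell ?_ ?_ ?_ ?_ ?_)) ?_)
        ((hc.comp ?_).mul (hx.cell ?_ ?_ ?_ ?_ ?_))))) <;> fun_prop
  · have h1 : PolyPrimrec fun w : (α × ℕ) × ℕ => ∑ k ∈ Finset.range (m w.1.1 - 1),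
        x w.1.1 8 0 w.1.2 k * x w.1.1 9 0 k w.2 := by
      refine PolyPrimrec.sum ((hx.cell ?_ ?_ ?_ ?_ ?_).mul (hx.cell ?_ ?_ ?_ ?_ ?_)) ?_ <;> fun_prop
    have h2 : PolyPrimrec fun w : (α × ℕ) × ℕ => ∑ t ∈ Finset.range (q w.1.1 + 1),
        ∑ k ∈ Finset.range (lowSize (d w.1.1) (p w.1.1) (v w.1.1) (h w.1.1) * m w.1.1),
          x w.1.1 7 t w.1.2 k * x w.1.1 6 t k w.2 := by
      refine PolyPrimrec.sum (PolyPrimrec.sum ((hx.cell ?_ ?_ ?_ ?_ ?_).mul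
          (hx.cell ?_ ?_ ?_ ?_ ?_)) ?_) ?_ <;> fun_prop
    refine IsSigma.forall_lt ?_ (IsSigma.forall_lt ?_ (IsSigma.modEq (hf.comp ?_)
      ((hc.comp ?_).mul (hx.cell ?_ ?_ ?_ ?_ ?_)) (h1.add h2))) <;> fun_prop

end CertificatePrimrec

/-! ### The three cases are enumerable in the parameters and the code. -/

section CodePrimrec

variable {α : Type*} [Primcodable α]

@[fun_prop]
theorem primrec_codeSize {c : α → Code} (hc : Primrec c) : Primrec fun a => codeSize (c a) := by
  have key : ∀ l : List (List (List ℤ) × List (List ℤ)),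
      (l.map fun e => e.1.length + e.2.length).sum =
        l.foldr (fun e s => e.1.length + e.2.length + s) 0 := by
    intro l
    induction l with
    | nil => rfl
    | cons a l ih => rw [List.map_cons, List.sum_cons, ih, List.foldr_cons]
  unfold codeSize
  simp only [key]
  refine Primrec.list_foldr (Primrec.list_flatten.comp (Primrec.snd.comp hc))
    (Primrec.const 0) (h := fun _ q => q.1.1.length + q.1.2.length + q.2) ?_
  unfold Primrec₂
  fun_prop

theorem familyPrimrec_codeNum {c : α → Code} (hc : Primrec c) :
    FamilyPrimrec fun a => codeNum (c a) := by
  unfold FamilyPrimrec codeNum codeEntry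
  exact PolyPrimrec.intPoly (by fun_prop)

theorem familyPrimrec_codeDen {c : α → Code} (hc : Primrec c) :
    FamilyPrimrec fun a => codeDen (c a) := by
  unfold FamilyPrimrec codeDen codeEntry
  exact PolyPrimrec.intPoly (by fun_prop)

theorem cellsPrimrec_readCells {mem : α → List (List ℤ)} (hmem : Primrec mem) :
    CellsPrimrec fun a => readCells (mem a) := by
  unfold CellsPrimrec readCells address
  exact PolyPrimrec.intPoly (by fun_prop)

theorem IsSigma.ne_zero {n : α → ℤ} (hn : Primrec n) : IsSigma fun a => n a ≠ 0 :=
  of_primrecPred (Primrec.eq.comp hn (Primrec.const 0)).not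

theorem isSigma_isInvalid : IsSigma fun a : ℕ × ℕ × ℕ × Code =>
    IsInvalid a.1 a.2.1 a.2.2.1 a.2.2.2 := by
  have hf : PolyPrimrec fun a : ℕ × ℕ × ℕ × Code => intPoly a.2.2.2.1 :=
    PolyPrimrec.intPoly (by fun_prop)
  have one : ∀ {β : Type} [Primcodable β], PolyPrimrec fun _ : β => (1 : ℤ[X]) :=
    fun {β} _ => by simpa using PolyPrimrec.C (Primrec.const (α := β) (1 : ℤ))
  refine IsSigma.or (.of_primrecPred ?_) (.or ?_ (.or ?_ (.or ?_ ?_)))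
  · exact (Primrec.nat_lt.comp (by fun_prop) (by fun_prop)).or
      ((Primrec.nat_lt.comp (by fun_prop) (by fun_prop)).or
        (Primrec.nat_lt.comp (by fun_prop) (by fun_prop)))
  · refine .exists_code (.of_primrecPred (PolyPrimrec.eq (hf.comp ?_) (.C ?_))) <;> fun_prop
  · refine .exists_code (.exists_code (.of_primrecPred ?_))
    have ha : PolyPrimrec fun w : ((ℕ × ℕ × ℕ × Code) × List ℤ) × List ℤ => intPoly w.1.2 :=
      PolyPrimrec.intPoly (by fun_prop)
    have hb : PolyPrimrec fun w : ((ℕ × ℕ × ℕ × Code) × List ℤ) × List ℤ => intPoly w.2 :=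
      PolyPrimrec.intPoly (by fun_prop)
    exact (PolyPrimrec.eq (hf.comp (by fun_prop)) (ha.mul hb)).and
      (((ha.eq one).not.and (ha.eq one.neg).not).and ((hb.eq one).not.and (hb.eq one.neg).not))
  · refine .exists_lt (by fun_prop) (.exists_lt (by fun_prop) (.forall_lt (by fun_prop)
      (.dvd (hf.comp (by fun_prop)) ((familyPrimrec_codeDen (c := fun a : ℕ × ℕ × ℕ × Code =>
        a.2.2.2) (by fun_prop)).member ?_ ?_ ?_ ?_)))) <;> fun_prop
  · refine .exists_nat (.exists_nat (.exists_code (.exists_code (.and (.ne_zero ?_) (.and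
      (isSigma_isDenominator ?_ ?_ ?_ ?_ (hf.comp ?_) (.C ?_) (cellsPrimrec_readCells ?_)
        (familyPrimrec_codeNum ?_) (familyPrimrec_codeDen ?_))
      (isSigma_isSingular ?_ ?_ (hf.comp ?_) (.C ?_) (cellsPrimrec_readCells ?_))))))) <;> fun_prop

theorem isSigma_isExpanded {p m d b v h : α → ℕ} {c : α → Code} {n : α → ℤ} {x : α → Cells ℤ[X]}
    (hp : Primrec p) (hm : Primrec m) (hd : Primrec d) (hc : Primrec c) (hb : Primrec b)
    (hv : Primrec v) (hh : Primrec h) (hn : Primrec n) (hx : CellsPrimrec x) :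
    IsSigma fun a => IsExpanded (p a) (m a) (d a) (c a) (b a) (v a) (h a) (n a) (x a) := by
  have hf : PolyPrimrec fun a => intPoly (c a).1 := PolyPrimrec.intPoly (by fun_prop)
  exact (IsSigma.ne_zero hn).and ((isSigma_isDenominator hm hb hh (by fun_prop) hf (.C hn) hx
    (familyPrimrec_codeNum hc) (familyPrimrec_codeDen hc)).and
    ((isSigma_isPseudoInverse hm hb hv hf (.C hn) hx).and
      (isSigma_isExpansion hm hb (by fun_prop) hf (.C hn) hx)))

theorem isSigma_isLarge : IsSigma fun a : ℕ × ℕ × ℕ × Code =>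
    IsLarge a.1 a.2.1 a.2.2.1 a.2.2.2 := by
  refine .exists_nat (.exists_nat (.exists_nat (.exists_code (.exists_code (.and
    (isSigma_isExpanded ?_ ?_ ?_ ?_ ?_ ?_ ?_ ?_ (cellsPrimrec_readCells ?_))
    (isSigma_isPositive ?_ ?_ ?_ ?_ ?_ (.intPoly ?_) (.C ?_) (cellsPrimrec_readCells ?_))))))) <;>
    fun_prop

theorem isSigma_isSmall : IsSigma fun a : ℕ × ℕ × ℕ × Code =>
    IsSmall a.1 a.2.1 a.2.2.1 a.2.2.2 := by
  refine .exists_nat (.exists_nat (.exists_nat (.exists_nat (.exists_code (.exists_code (.and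
    (isSigma_isExpanded ?_ ?_ ?_ ?_ ?_ ?_ ?_ ?_ (cellsPrimrec_readCells ?_))
    (isSigma_isNegative ?_ ?_ ?_ ?_ ?_ ?_ (.intPoly ?_) (.C ?_)
      (cellsPrimrec_readCells ?_)))))))) <;>
    fun_prop

end CodePrimrec

/-! ### Unbounded and bounded search. -/

section Search

variable {α : Type*} [Primcodable α] {P Q : α → Prop}

/-- Two enumerable predicates, one of which holds everywhere, can be told apart by a computable
function. -/
theorem exists_computable_of_isSigma (hP : IsSigma P) (hQ : IsSigma Q) (h : ∀ a, P a ∨ Q a) :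
    ∃ χ : α → Bool, Computable χ ∧ (∀ a, χ a = true → P a) ∧ ∀ a, χ a = false → Q a := by
  classical
  obtain ⟨R, h1, h2⟩ := hP
  obtain ⟨S, h3, h4⟩ := hQ
  -- An answer is given only together with a witness for it, so it is correct even where both
  -- predicates hold.
  let g : α → ℕ → Option Bool := fun a n =>
    if R (a, n) then some true else if S (a, n) then some false else none
  have hg : Primrec₂ g := Primrec.ite (h1.comp (f := fun w : α × ℕ => (w.1, w.2)) (by fun_prop))
    (Primrec.const _) (Primrec.ite (h3.comp (f := fun w : α × ℕ => (w.1, w.2)) (by fun_prop))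
      (Primrec.const _) (Primrec.const _))
  have hdom : ∀ a, (Nat.rfindOpt (g a)).Dom := fun a => by
    rw [Nat.rfindOpt_dom]
    by_cases hR : ∃ n, R (a, n)
    · obtain ⟨n, hn⟩ := hR
      exact ⟨n, true, by simp [g, hn]⟩
    · obtain ⟨n, hn⟩ := (h4 a).1 ((h a).resolve_left fun hp => hR ((h2 a).1 hp))
      exact ⟨n, false, by simp [g, hn, not_exists.1 hR n]⟩
  have hspec : ∀ a, ∃ n, (Nat.rfindOpt (g a)).get (hdom a) ∈ g a n := fun a =>
    Nat.rfindOpt_spec (Part.get_mem (hdom a))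
  refine ⟨fun a => (Nat.rfindOpt (g a)).get (hdom a), ?_, fun a ha => ?_, fun a ha => ?_⟩
  · exact (Partrec.rfindOpt hg.to_comp).of_eq fun a => (Part.some_get (hdom a)).symm
  · obtain ⟨n, hn⟩ := hspec a
    rw [show (Nat.rfindOpt (g a)).get (hdom a) = _ from ha] at hn
    refine (h2 a).2 ⟨n, ?_⟩
    by_contra hR
    simp only [g, if_neg hR] at hn
    split_ifs at hn <;> simp at hn
  · obtain ⟨n, hn⟩ := hspec a
    rw [show (Nat.rfindOpt (g a)).get (hdom a) = _ from ha] at hn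
    refine (h4 a).2 ⟨n, ?_⟩
    by_contra hS
    simp only [g, if_neg hS] at hn
    split_ifs at hn <;> simp at hn

theorem primrec_pow : Primrec fun w : ℕ × ℕ => w.1 ^ w.2 :=
  (Primrec.nat_rec' (f := fun w : ℕ × ℕ => w.2) (g := fun _ => 1) (h := fun w q => q.2 * w.1)
    (by fun_prop) (by fun_prop) (by unfold Primrec₂; fun_prop)).of_eq fun w => by
      induction w.2 with
      | zero => rfl
      | succ n ih => rw [pow_succ, ← ih]

theorem primrecPred_gcd_eq_one : PrimrecPred fun w : ℕ × ℕ => Nat.gcd w.1 w.2 = 1 := by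
  refine (primrecPred_forall_lt (P := fun w : (ℕ × ℕ) × ℕ =>
    ¬(w.1.1 % w.2 = 0 ∧ w.1.2 % w.2 = 0) ∨ w.2 = 1) (n := fun w => w.1 + w.2 + 1)
    (((Primrec.eq.comp (by fun_prop) (by fun_prop)).and
      (Primrec.eq.comp (by fun_prop) (by fun_prop))).not.or
        (Primrec.eq.comp (by fun_prop) (by fun_prop))) (by fun_prop)).of_eq fun w => ?_
  obtain ⟨a, b⟩ := w
  simp only [← imp_iff_not_or, ← Nat.dvd_iff_mod_eq_zero]
  constructor
  · intro H
    -- The test at k = 0 excludes a = b = 0, where the gcd is 0: remainders modulo 0 leave the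
    -- number unchanged.
    rcases Nat.eq_zero_or_pos (a + b) with h0 | h0
    · have := H 0 (by omega) ⟨by rw [show a = 0 by omega], by rw [show b = 0 by omega]⟩
      omega
    · refine H _ ?_ ⟨Nat.gcd_dvd_left a b, Nat.gcd_dvd_right a b⟩
      have := Nat.le_of_dvd h0 (Nat.dvd_add (Nat.gcd_dvd_left a b) (Nat.gcd_dvd_right a b))
      omega
  · rintro H k - ⟨h1, h2⟩
    exact Nat.dvd_one.1 (H ▸ Nat.dvd_gcd h1 h2)

/-- A bounded search for an element satisfying a computable condition. -/
theorem exists_computable_search {χ : α × ℕ → Bool} (hχ : Computable χ) {n : α → ℕ}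
    (hn : Computable n) {S : α → Set ℕ} (h1 : ∀ a, 1 ∈ S a)
    (hS : ∀ a, ∀ k < n a, χ (a, k) = true → k ∈ S a) :
    ∃ f : α → ℕ, Computable f ∧ ∀ a, f a ∈ S a ∧
      ((∃ k < n a, χ (a, k) = true) → χ (a, f a) = true) := by
  -- The recursion keeps the last k below `n a` that passes the test, and returns 1 if none does.
  refine ⟨fun a => Nat.rec 1 (fun k best => bif χ (a, k) then k else best) (n a),
    Computable.nat_rec hn (Computable.const 1)
      (h := fun a q => bif χ (a, q.1) then q.1 else q.2)
      (Computable.cond (hχ.comp (Computable.fst.pair (Computable.fst.comp Computable.snd)))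
        (Computable.fst.comp Computable.snd) (Computable.snd.comp Computable.snd)), fun a => ?_⟩
  have hSa := hS a
  beta_reduce
  generalize n a = N at hSa
  induction N with
  | zero => exact ⟨h1 a, fun ⟨k, hk, _⟩ => absurd hk (Nat.not_lt_zero k)⟩
  | succ N ih =>
    obtain ⟨ih1, ih2⟩ := ih fun k hk => hSa k (by omega)
    dsimp only
    cases hN : χ (a, N)
    · refine ⟨ih1, fun ⟨k, hk, hk'⟩ => ih2 ⟨k, ?_, hk'⟩⟩
      refine lt_of_le_of_ne (by omega) ?_
      rintro rfl
      rw [hN] at hk'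
      exact Bool.noConfusion hk'
    · exact ⟨hSa N (by omega) hN, fun _ => hN⟩

end Search

/-! ### The algorithm. -/

section Algorithm

/-- Invalid inputs are merged with large ones, which makes the two alternatives exhaustive. The
merging does no harm, because the code of a regular matrix is never invalid when p ≥ 2 and m, d ≥ 1.
-/
theorem exists_computable_isLarge : ∃ χ : ℕ × ℕ × ℕ × Code → Bool, Computable χ ∧
    (∀ a, χ a = true → IsInvalid a.1 a.2.1 a.2.2.1 a.2.2.2 ∨ IsLarge a.1 a.2.1 a.2.2.1 a.2.2.2) ∧
    ∀ a, χ a = false → IsSmall a.1 a.2.1 a.2.2.1 a.2.2.2 :=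
  exists_computable_of_isSigma (isSigma_isInvalid.or isSigma_isLarge) isSigma_isSmall fun _ =>
    or_assoc.2 (isInvalid_or_isLarge_or_isSmall _ _ _ _)

/-- An exponent `d` for which `𝔛_d` is large can be computed, if there is one. -/
theorem exists_computable_exponent : ∃ computeD : ℕ × ℕ × Code → ℕ, Computable computeD ∧
    ∀ (p m : ℕ) (_ : 2 ≤ p) (_ : 1 ≤ m) (A : Matrix.GeneralLinearGroup (Fin m) (RatFunc Qbar))
      (c : Code), Describes c A → computeD (p, m, c) ∈ setD p m ∧
        ((∃ d ∈ setD p m, m ≤ Module.finrank Qbar (spaceX p A d)) →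
          m ≤ Module.finrank Qbar (spaceX p A (computeD (p, m, c)))) := by
  classical
  obtain ⟨χ, hχ, hχ1, hχ2⟩ := exists_computable_isLarge
  have hadm : PrimrecPred fun w : (ℕ × ℕ × Code) × ℕ => 1 ≤ w.2 ∧ Nat.gcd w.2 w.1.1 = 1 :=
    (Primrec.nat_le.comp (by fun_prop) (by fun_prop)).and
      (primrecPred_gcd_eq_one.comp (f := fun w : (ℕ × ℕ × Code) × ℕ => (w.2, w.1.1)) (by fun_prop))
  let T : (ℕ × ℕ × Code) × ℕ → Bool := fun w =>
    bif decide (1 ≤ w.2 ∧ Nat.gcd w.2 w.1.1 = 1) then χ (w.1.1, w.1.2.1, w.2, w.1.2.2) else false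
  have hT : Computable T := Computable.cond hadm.decide.to_comp
    (hχ.comp (Primrec.to_comp (by fun_prop))) (Computable.const false)
  have hTiff : ∀ w, T w = true ↔ (1 ≤ w.2 ∧ Nat.gcd w.2 w.1.1 = 1) ∧
      χ (w.1.1, w.1.2.1, w.2, w.1.2.2) = true := fun w => by
    by_cases hw : 1 ≤ w.2 ∧ Nat.gcd w.2 w.1.1 = 1 <;> simp [T, hw]
  obtain ⟨f, hf, hspec⟩ := exists_computable_search hT (n := fun a => a.1 ^ a.2.1)
    (primrec_pow.comp (g := fun a : ℕ × ℕ × Code => (a.1, a.2.1)) (by fun_prop)).to_comp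
    -- Membership is conditional on p ≥ 2 and m ≥ 1, so that the default value 1 belongs to the set
    -- for every input.
    (S := fun a => {k | (2 ≤ a.1 → 1 ≤ a.2.1 → k ∈ setD a.1 a.2.1)})
    (fun a h2 h1 => ⟨le_rfl, by
      have := Nat.pow_le_pow_right (show 0 < a.1 by omega) h1
      rw [pow_one] at this
      omega, Nat.gcd_one_left _⟩)
    (fun _ k hk hTk _ _ => ⟨((hTiff _).1 hTk).1.1, by omega, ((hTiff _).1 hTk).1.2⟩)
  refine ⟨f, hf, fun p m hp hm A c hc => ⟨(hspec (p, m, c)).1 hp hm, ?_⟩⟩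
  rintro ⟨d, ⟨hd1, hd2, hd3⟩, hd⟩
  have hpow : 0 < p ^ m := Nat.pow_pos (by omega)
  have hd' : d ≠ 0 := by omega
  have hmem := (hspec (p, m, c)).1 hp hm
  -- A large d passes the test, since the answer `false` would certify dimension less than m. Hence
  -- the search succeeds, and the exponent it returns has passed the test as well.
  have hchosen := (hspec (p, m, c)).2 ⟨d, by change d < p ^ m; omega, (hTiff _).2 ⟨⟨hd1, hd3⟩, by
    by_contra hne
    exact absurd ((hχ2 (p, m, d, c) (Bool.eq_false_iff.2 hne)).finrank_lt hp hm hd' hc)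
      (not_lt.2 hd)⟩⟩
  have hd0 : f (p, m, c) ≠ 0 := by
    have := hmem.1
    omega
  exact (hχ1 _ ((hTiff _).1 hchosen).2).elim (fun H => (H.false hp hm hd0 hc).elim)
    fun H => H.le_finrank hp hm hd0 hc

end Algorithm

end

end MahlerSystem

theorem mainTheorem1 :
    (∀ (p m : ℕ) (_ : 2 ≤ p) (_ : 1 ≤ m)
        (A : Matrix.GeneralLinearGroup (Fin m) (RatFunc MahlerSystem.Qbar)),
      (MahlerSystem.IsRegularSingular p A ↔
        ∃ d ∈ MahlerSystem.setD p m,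
          m ≤ Module.finrank MahlerSystem.Qbar (MahlerSystem.spaceX p A d)) ∧
      (∀ d ∈ MahlerSystem.setD p m,
        m ≤ Module.finrank MahlerSystem.Qbar (MahlerSystem.spaceX p A d) →
          Module.finrank MahlerSystem.Qbar (MahlerSystem.spaceX p A d) = m ∧
          MahlerSystem.IsEquivalentToConst
            (MahlerSystem.rootField MahlerSystem.Qbar d) p A)) ∧
    (∃ computeD : ℕ × ℕ × MahlerSystem.Code → ℕ, Computable computeD ∧
      ∀ (p m : ℕ) (_ : 2 ≤ p) (_ : 1 ≤ m)
          (A : Matrix.GeneralLinearGroup (Fin m) (RatFunc MahlerSystem.Qbar))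
          (c : MahlerSystem.Code), MahlerSystem.Describes c A →
        computeD (p, m, c) ∈ MahlerSystem.setD p m ∧
        (MahlerSystem.IsRegularSingular p A →
          m ≤ Module.finrank MahlerSystem.Qbar
            (MahlerSystem.spaceX p A (computeD (p, m, c))))) := by
  refine ⟨fun p m hp hm A => ⟨MahlerSystem.isRegularSingular_iff_exists hp hm A, fun d hd h => ?_⟩,
    ?_⟩
  · exact MahlerSystem.finrank_spaceX_of_le hp (Nat.one_le_iff_ne_zero.1 hd.1) A h
  · obtain ⟨f, hf, h⟩ := MahlerSystem.exists_computable_exponent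
    exact ⟨f, hf, fun p m hp hm A c hc => ⟨(h p m hp hm A c hc).1, fun hreg =>
      (h p m hp hm A c hc).2 ((MahlerSystem.isRegularSingular_iff_exists hp hm A).1 hreg)⟩⟩
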